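/- Let $\Gamma>0$, let $h:\mathbb R\to\mathbb R$ be $\Gamma$-periodic with $h\in W^{2,\infty}$, and let $$\Omega=\{(y_1,y_2): 0<y_1<\Gamma,\ h(y_1)<y_2<1+h(y_1)\},$$ with bottom wall $\gamma^-=\{y_2=h(y_1)\}$ and top wall $\gamma^+=\{y_2=1+h(y_1)\}$ ($0<y_1<\Gamma$). Let $n=\pm(1+h'^2)^{-1/2}(-h',1)$ on $\gamma^\pm$ be the outward unit normal, $\tau=(-n_2,n_1)$ the tangent, and $\kappa=\pm h''(1+h'^2)^{-3/2}$ on $\gamma^\pm$ the curvature. Let $\mathrm{Pr}>0$, $\mathrm{Ra}\ge 1$, and let $\alpha>0$ be a function on $\gamma^-\cup\gamma^+$. Let $(u,T,p)$, with all variables $\Gamma$-periodic in $y_1$, be a global strong solution of $$\tfrac1{\mathrm{Pr}}(u_t+u\cdot\nabla u)-\Delta u+\nabla p=\mathrm{Ra}\,T e_2,\qquad \nabla\cdot u=0,\qquad T_t+u\cdot\nabla T-\Delta T=0\quad\text{in }\Omega,\ t>0,$$ with $T=1$ on $\gamma^-$, $T=0$ on $\gamma^+$, and, on $\gamma^-\cup\gamma^+$,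 $u\cdot n=0$ and $\tau\cdot\mathbb D u\cdot n+\alpha\,u\cdot\tau=0$, where $\mathbb Du=\frac12(\nabla u+\nabla u^{\mathsf T})$. Here strong means that $u,T\in L^2_{loc}((0,\infty);H^2(\Omega))\cap H^1_{loc}((0,\infty);L^2(\Omega))$, that $\nabla p\in L^2_{loc}((0,\infty);L^2(\Omega))$ with $p(t)\in H^1(\Omega)$ for almost every $t$, that the equations hold almost everywhere and the boundary conditions hold in the sense of traces, and that $u(t)\to u_0$, $T(t)\to T_0$ in $L^2(\Omega)$ as $t\to0^+$. Assume $u_0\in L^2(\Omega)$, $0\le T_0\le1$ almost everywhere, and $$|\kappa|\le 2\alpha+\frac{1}{4\sqrt{1+(h')^2}}\min\{1,\sqrt\alpha\}\quad\text{almost everywhere on }\gamma^-\cup\gamma^+ .$$ Then the Nusselt number $$\mathrm{Nu}=\limsup_{t\to\infty}\frac1t\int_0^t\frac1{|\Omega|}\int_{\gamma^-}n\cdot\nabla T\,dS\,ds$$ is well defined (the boundary integral converges for almost every $s>0$ and the time integral converges for every $t>0$), and $$\mathrm{Nu}\le C\left(\mathrm{Ra}^{1/2}+\|\kappa\|_\infty\right),$$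 where $C>0$ depends only on $\|h'\|_\infty$ and $|\Omega|$; in particular $C$ does not depend on $\mathrm{Ra}$, $\mathrm{Pr}$, $\alpha$, or the solution. -/

import Mathlib

open MeasureTheory Filter Topology Set
open scoped ContDiff ENNReal

noncomputable section

namespace RayleighBenard

/-! ### Geometry

Points of the plane are pairs `y = (y₁, y₂) : ℝ × ℝ` with Lebesgue measure. Everything is
`Γ`-periodic in `y₁`; the periodic domain is described by the infinite strip between the walls
together with one period cell `Ω`. -/

/-- The profile `h` is `Γ`-periodic and of class `W^{2,∞} = C^{1,1}`: it is differentiable and `h'`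
is Lipschitz. In particular `h''` exists almost everywhere and is bounded. -/
structure IsProfile (Γ : ℝ) (h : ℝ → ℝ) : Prop where
  periodic : Function.Periodic h Γ
  differentiable : Differentiable ℝ h
  lipschitz_deriv : ∃ K : NNReal, LipschitzWith K (deriv h)

/-- The infinite strip `h(y₁) < y₂ < 1 + h(y₁)`. -/
def strip (h : ℝ → ℝ) : Set (ℝ × ℝ) := {y | h y.1 < y.2 ∧ y.2 < 1 + h y.1}

/-- The period cell `Ω = {0 < y₁ < Γ, h(y₁) < y₂ < 1 + h(y₁)}`. -/
def cell (Γ : ℝ) (h : ℝ → ℝ) : Set (ℝ × ℝ) := {y | (0 < y.1 ∧ y.1 < Γ) ∧ y ∈ strip h}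

/-- The area `|Ω|`. -/
def area (Γ : ℝ) (h : ℝ → ℝ) : ℝ := (volume (cell Γ h)).toReal

/-- The two walls: `bot` is `γ⁻ = {y₂ = h(y₁)}` and `top` is `γ⁺ = {y₂ = 1 + h(y₁)}`. Functions on
a wall are written as functions of the horizontal coordinate `y₁`. -/
inductive Wall
  | bot
  | top

/-- `+1` on the top wall and `-1` on the bottom wall. -/
def Wall.sign : Wall → ℝ
  | .bot => -1
  | .top => 1

/-- The height of a wall above the point `y₁`. -/
def Wall.height (h : ℝ → ℝ) : Wall → ℝ → ℝ
  | .bot, y₁ => h y₁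
  | .top, y₁ => 1 + h y₁

/-- The line element `√(1 + h'²)`, so that `dS = √(1 + h'²) dy₁` on either wall. -/
def lineElement (h : ℝ → ℝ) (y₁ : ℝ) : ℝ := Real.sqrt (1 + deriv h y₁ ^ 2)

/-- The outward unit normal `n = ± (-h', 1) / √(1 + h'²)` on `γ^±`. -/
def normal (h : ℝ → ℝ) (w : Wall) (y₁ : ℝ) : Fin 2 → ℝ :=
  ![w.sign * (-deriv h y₁) / lineElement h y₁, w.sign / lineElement h y₁]

/-- The unit tangent `τ = n^⊥ = (-n₂, n₁)`. -/
def tangent (h : ℝ → ℝ) (w : Wall) (y₁ : ℝ) : Fin 2 → ℝ :=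
  ![-normal h w y₁ 1, normal h w y₁ 0]

/-- The curvature `κ = ± h'' / (1 + h'²)^{3/2}` on `γ^±`. -/
def curvature (h : ℝ → ℝ) (w : Wall) (y₁ : ℝ) : ℝ :=
  w.sign * deriv (deriv h) y₁ / (1 + deriv h y₁ ^ 2) ^ (3 / 2 : ℝ)

/-- The `L^∞` norm of a function of `y₁` over one period. -/
def supNorm (Γ : ℝ) (f : ℝ → ℝ) : ℝ :=
  (eLpNorm f ∞ (volume.restrict (Ioo 0 Γ))).toReal

/-- The norm `‖κ‖_∞` over `γ⁻ ∪ γ⁺`. -/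
def curvatureNorm (Γ : ℝ) (h : ℝ → ℝ) : ℝ :=
  max (supNorm Γ (curvature h .bot)) (supNorm Γ (curvature h .top))

/-! ### Weak derivatives, traces, strong fields -/

/-- The classical partial derivative `∂_i φ` (`i = 0` horizontal, `i = 1` vertical). -/
def pderiv (i : Fin 2) (φ : ℝ × ℝ → ℝ) (y : ℝ × ℝ) : ℝ :=
  fderiv ℝ φ y (![((1 : ℝ), (0 : ℝ)), ((0 : ℝ), (1 : ℝ))] i)

/-- `g` is the weak partial derivative `∂_i f` in the strip. -/
structure IsWeakPartial (h : ℝ → ℝ) (i : Fin 2) (f g : ℝ × ℝ → ℝ) : Prop where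
  locInt : LocallyIntegrableOn f (strip h)
  locInt_deriv : LocallyIntegrableOn g (strip h)
  byParts : ∀ φ : ℝ × ℝ → ℝ, ContDiff ℝ ∞ φ → HasCompactSupport φ → tsupport φ ⊆ strip h →
    ∫ y in strip h, f y * pderiv i φ y = -∫ y in strip h, g y * φ y

/-- The trace on the wall `w` of a function on the strip: the limit as `δ → 0+` of its averages
over the vertical segments of length `δ` that start at the wall and point into the strip. For a
function with weak partial derivatives in `L²(Ω)` the limit exists at almost every `y₁` and is the
usual Sobolev trace. -/
def trace (h : ℝ → ℝ) (w : Wall) (f : ℝ × ℝ → ℝ) (y₁ : ℝ) : ℝ :=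
  limUnder (𝓝[>] (0 : ℝ)) fun δ : ℝ =>
    δ⁻¹ * ∫ z in (0 : ℝ)..δ, f (y₁, w.height h y₁ - w.sign * z)

/-- `f ∈ L²_loc((0,∞); L²(Ω))`. -/
def LocL2 (Γ : ℝ) (h : ℝ → ℝ) (f : ℝ → ℝ × ℝ → ℝ) : Prop :=
  ∀ a b : ℝ, 0 < a → a < b →
    MemLp (Function.uncurry f) 2
      ((volume.restrict (Ioo a b)).prod (volume.restrict (cell Γ h)))

/-- `Γ`-periodicity in `y₁`. -/
def HPeriodic (Γ : ℝ) (f : ℝ × ℝ → ℝ) : Prop := ∀ y : ℝ × ℝ, f (y.1 + Γ, y.2) = f y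

/-- A scalar field of strong-solution regularity: periodic in `y₁`, of class
`L²_loc((0,∞); H²(Ω)) ∩ H¹_loc((0,∞); L²(Ω)) ∩ C([0,∞); L²(Ω))`. Nothing but convergence in `L²(Ω)`
to the initial value is required as `t → 0+`. The field is given with its first and second spatial
derivatives and its time derivative. -/
structure StrongField (Γ : ℝ) (h : ℝ → ℝ) where
  /-- the field -/
  val : ℝ → ℝ × ℝ → ℝ
  /-- `grad i = ∂_i` of the field -/
  grad : Fin 2 → ℝ → ℝ × ℝ → ℝ
  /-- `hess i k = ∂_i ∂_k` of the field -/
  hess : Fin 2 → Fin 2 → ℝ → ℝ × ℝ → ℝ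
  /-- the time derivative -/
  dt : ℝ → ℝ × ℝ → ℝ
  periodic : ∀ t, 0 < t → HPeriodic Γ (val t)
  val_L2 : LocL2 Γ h val
  grad_L2 : ∀ i, LocL2 Γ h (grad i)
  hess_L2 : ∀ i k, LocL2 Γ h (hess i k)
  dt_L2 : LocL2 Γ h dt
  weak_grad : ∀ i, ∀ᵐ t ∂volume.restrict (Ioi (0 : ℝ)), IsWeakPartial h i (val t) (grad i t)
  weak_hess : ∀ i k, ∀ᵐ t ∂volume.restrict (Ioi (0 : ℝ)),
    IsWeakPartial h i (grad k t) (hess i k t)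
  time_deriv : ∀ s t : ℝ, 0 < s → s ≤ t → ∀ᵐ y ∂volume.restrict (cell Γ h),
    val t y - val s y = ∫ r in s..t, dt r y
  initial : Tendsto (fun t : ℝ => eLpNorm (val t - val 0) 2 (volume.restrict (cell Γ h)))
    (𝓝[>] (0 : ℝ)) (𝓝 0)

/-! ### The Boussinesq system with Navier-slip conditions -/

/-- A (global in time, strong) solution `(u, T, p)` of the Boussinesq system
`Pr⁻¹ (u_t + u·∇u) - Δu + ∇p = Ra T e₂`, `∇·u = 0`, `T_t + u·∇T - ΔT = 0` in `Ω`, with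
`T = 1` on `γ⁻`, `T = 0` on `γ⁺`, and `τ·𝔻u·n + α u_τ = 0`, `u·n = 0` on both walls. -/
structure StrongSolution (Γ : ℝ) (h : ℝ → ℝ) (α : Wall → ℝ → ℝ) (Pr Ra : ℝ) where
  /-- the velocity components -/
  u : Fin 2 → StrongField Γ h
  /-- the temperature -/
  T : StrongField Γ h
  /-- the pressure -/
  p : ℝ → ℝ × ℝ → ℝ
  /-- the pressure gradient -/
  gradp : Fin 2 → ℝ → ℝ × ℝ → ℝ
  p_periodic : ∀ t, 0 < t → HPeriodic Γ (p t)
  p_L2 : ∀ᵐ t ∂volume.restrict (Ioi (0 : ℝ)), MemLp (p t) 2 (volume.restrict (cell Γ h))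
  gradp_L2 : ∀ i, LocL2 Γ h (gradp i)
  weak_gradp : ∀ i, ∀ᵐ t ∂volume.restrict (Ioi (0 : ℝ)), IsWeakPartial h i (p t) (gradp i t)
  momentum : ∀ j : Fin 2, ∀ᵐ t ∂volume.restrict (Ioi (0 : ℝ)),
    ∀ᵐ y ∂volume.restrict (cell Γ h),
      Pr⁻¹ * ((u j).dt t y + ∑ i, (u i).val t y * (u j).grad i t y)
        - ∑ i, (u j).hess i i t y + gradp j t y = Ra * T.val t y * ![(0 : ℝ), 1] j
  divergence_free : ∀ᵐ t ∂volume.restrict (Ioi (0 : ℝ)), ∀ᵐ y ∂volume.restrict (cell Γ h),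
    ∑ i, (u i).grad i t y = 0
  heat : ∀ᵐ t ∂volume.restrict (Ioi (0 : ℝ)), ∀ᵐ y ∂volume.restrict (cell Γ h),
    T.dt t y + ∑ i, (u i).val t y * T.grad i t y - ∑ i, T.hess i i t y = 0
  T_bot : ∀ᵐ t ∂volume.restrict (Ioi (0 : ℝ)), ∀ᵐ y₁ ∂volume.restrict (Ioo 0 Γ),
    trace h .bot (T.val t) y₁ = 1
  T_top : ∀ᵐ t ∂volume.restrict (Ioi (0 : ℝ)), ∀ᵐ y₁ ∂volume.restrict (Ioo 0 Γ),
    trace h .top (T.val t) y₁ = 0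
  slip : ∀ w : Wall, ∀ᵐ t ∂volume.restrict (Ioi (0 : ℝ)), ∀ᵐ y₁ ∂volume.restrict (Ioo 0 Γ),
    ∑ i, ∑ j, tangent h w y₁ i *
        ((1 / 2) * (trace h w ((u j).grad i t) y₁ + trace h w ((u i).grad j t) y₁)) *
        normal h w y₁ j
      + α w y₁ * ∑ i, tangent h w y₁ i * trace h w ((u i).val t) y₁ = 0
  no_penetration : ∀ w : Wall, ∀ᵐ t ∂volume.restrict (Ioi (0 : ℝ)),
    ∀ᵐ y₁ ∂volume.restrict (Ioo 0 Γ),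
      ∑ i, normal h w y₁ i * trace h w ((u i).val t) y₁ = 0

namespace StrongSolution

variable {Γ : ℝ} {h : ℝ → ℝ} {α : Wall → ℝ → ℝ} {Pr Ra : ℝ}

/-- The density `(n·∇T) √(1 + h'²)` with respect to `dy₁` of the heat flux through `γ⁻`. -/
def fluxDensity (S : StrongSolution Γ h α Pr Ra) (t y₁ : ℝ) : ℝ :=
  (∑ i, normal h .bot y₁ i * trace h .bot (S.T.grad i t) y₁) * lineElement h y₁

/-- The heat flux `∫_{γ⁻} n·∇T dS` at time `t`. -/
def flux (S : StrongSolution Γ h α Pr Ra) (t : ℝ) : ℝ :=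
  ∫ y₁ in Ioo 0 Γ, S.fluxDensity t y₁

/-- The Nusselt number `limsup_{t→∞} (1/t) ∫₀ᵗ |Ω|⁻¹ ∫_{γ⁻} n·∇T dS ds`, as an extended real. -/
def nusselt (S : StrongSolution Γ h α Pr Ra) : EReal :=
  limsup (fun t : ℝ => ((t⁻¹ * ∫ s in (0 : ℝ)..t, (area Γ h)⁻¹ * S.flux s : ℝ) : EReal)) atTop

end StrongSolution

end RayleighBenard

end

/-! The argument is a boundary-layer estimate closed by energy balances. In the coordinates x = y₁,
z = y₂ - h(y₁) the cell becomes (0,Γ) × (0,1) with unit Jacobian. Fix a time, let N be the flux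
through the bottom wall, D = ‖h'‖_∞, and M a bound for |h - h(0)|. Four tests of the equations give,
up to time-derivative terms, four relations.

Heat equation tested with T: ∫|∇T|² = N (`HeatSlice.energy`). Heat equation tested with the height
y₂ - h(0): ∫ T u₂ ≤ (1 + 2M) N (`HeatSlice.buoyancy_le`). This uses that heat enters at the bottom
and leaves at the top pointwise (`HeatSlice.flux_signs`), a consequence of 0 ≤ T ≤ 1. Momentum
equation tested with u: ½ ∫|∂_z u|² ≤ Ra ∫ T u₂ (`momentum_energy`). The slip condition and the
derivative of u·n = 0 along the walls turn the boundary terms into 2α ± κ times squared wall speeds,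
possibly of the wrong sign. The hypothesis on κ bounds the bad part by the difference of the
velocities at vertically opposite wall points (`wall_coercive`), hence by half of the vertical
dissipation. Heat equation tested with (1 - z/δ)₊: N is at most the convective plus the conductive
flux through the layer z < δ (`HeatSlice.flux_le`). Both 1 - T and u₂ - h'u₁ vanish at the bottom,
so convection costs δ/2 (l ∫|∂_z T|² + l⁻¹ ∫|∂_z(u₂ - h'u₁)|²), with u₁, u₂ the components and h'
constant in z. Conduction costs (1 + D²)Γ/δ, plus a term with h'' from moving a tangential
derivative off T; this is where ‖κ‖_∞ enters.

With l = √Ra and δ = θ/√Ra, the first three relations bound the convective part by a multiple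
θ(...)N; choosing θ in terms of D and M makes this N/2 (`combine_estimates`). What remains is of
order √Ra + ‖κ‖_∞. Integrated in time, the time-derivative terms telescope to quantities bounded
independently of t, because 0 ≤ T ≤ 1 and the kinetic energy is bounded near t = 0
(`combine_integrals`, `StrongSolution.integral_flux_le`). The factor 1/Pr occurs only there, so
division by t removes it.

The regularity is treated without density arguments for the solution. Weak derivatives are
derivatives along almost every line of the flattened cell (`hasDz_of_weak`, `hasDx_of_weak`), so
Green's formula (`H1.green`) is Fubini and the fundamental theorem of calculus. The same device in
time (`TimeReg.acRep`) justifies the energy identities, and the maximum principle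
(`StrongSolution.ae_temperature_mem`) comes from testing with bounded increasing functions of T. -/

namespace RayleighBenard

/-! ### Functions with an absolutely continuous representative -/

/-- On `(a, b)` the function `f` agrees almost everywhere with an absolutely continuous function
whose derivative is `g` and whose boundary values are `α` at `a` and `β` at `b`. -/
def ACRep (a b : ℝ) (f g : ℝ → ℝ) (α β : ℝ) : Prop :=
  a < b ∧ ∃ F : ℝ → ℝ, AbsolutelyContinuousOnInterval F a b ∧ F a = α ∧ F b = β ∧
    (∀ᵐ x ∂volume.restrict (Ioo a b), f x = F x) ∧
    ∀ᵐ x ∂volume.restrict (Ioo a b), HasDerivAt F (g x) x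

theorem lipschitz_comp_absolutelyContinuous {Φ F : ℝ → ℝ} {K : NNReal} {a b : ℝ}
    (hΦ : LipschitzWith K Φ) (hF : AbsolutelyContinuousOnInterval F a b) :
    AbsolutelyContinuousOnInterval (fun x => Φ (F x)) a b := by
  rw [absolutelyContinuousOnInterval_iff] at hF ⊢
  intro ε hε
  obtain ⟨δ, hδ, H⟩ := hF (ε / (K + 1)) (by positivity)
  refine ⟨δ, hδ, fun E hE hl => ?_⟩
  have h1 := H E hE hl
  have h2 : ∑ i ∈ Finset.range E.1, dist (Φ (F (E.2 i).1)) (Φ (F (E.2 i).2)) ≤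
      ∑ i ∈ Finset.range E.1, K * dist (F (E.2 i).1) (F (E.2 i).2) :=
    Finset.sum_le_sum fun i _ => hΦ.dist_le_mul _ _
  rw [← Finset.mul_sum] at h2
  have hK : (0 : ℝ) ≤ K := K.2
  rw [lt_div_iff₀ (by positivity)] at h1
  have h3 : 0 ≤ ∑ i ∈ Finset.range E.1, dist (F (E.2 i).1) (F (E.2 i).2) :=
    Finset.sum_nonneg fun i _ => dist_nonneg
  nlinarith

theorem ae_Ioo_iff_Ioc {a b : ℝ} {p : ℝ → Prop} :
    (∀ᵐ x ∂volume.restrict (Ioo a b), p x) ↔ ∀ᵐ x ∂volume.restrict (Ioc a b), p x := by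
  rw [restrict_Ioo_eq_restrict_Ioc]

theorem measurePreserving_one_sub : MeasurePreserving (fun x : ℝ => 1 - x)
    (volume.restrict (Ioo 0 1)) (volume.restrict (Ioo 0 1)) := by
  have := (Measure.measurePreserving_sub_left (volume : Measure ℝ) 1).restrict_preimage
    (measurableSet_Ioo (a := (0 : ℝ)) (b := 1))
  simpa using this

namespace ACRep

variable {a b α β α' β' : ℝ} {f g f' g' : ℝ → ℝ}

theorem intervalIntegrable (H : ACRep a b f g α β) : IntervalIntegrable g volume a b := by
  obtain ⟨hab, F, hF, -, -, -, hd⟩ := H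
  refine hF.intervalIntegrable_deriv.congr_ae ?_
  rw [uIoc_of_le hab.le]
  rw [ae_Ioo_iff_Ioc] at hd
  filter_upwards [hd] with x hx using hx.deriv

theorem integral_eq (H : ACRep a b f g α β) : ∫ x in a..b, g x = β - α := by
  obtain ⟨hab, F, hF, rfl, rfl, -, hd⟩ := H
  rw [← hF.integral_deriv_eq_sub]
  refine intervalIntegral.integral_congr_ae_restrict ?_
  rw [uIoc_of_le hab.le]
  rw [ae_Ioo_iff_Ioc] at hd
  filter_upwards [hd] with x hx using hx.deriv.symm

theorem integrableOn (H : ACRep a b f g α β) : IntegrableOn g (Ioo a b) :=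
  (intervalIntegrable_iff_integrableOn_Ioo_of_le H.1.le).1 H.intervalIntegrable

theorem setIntegral_eq (H : ACRep a b f g α β) : ∫ x in Ioo a b, g x = β - α := by
  rw [← H.integral_eq, intervalIntegral.integral_of_le H.1.le, integral_Ioc_eq_integral_Ioo]

theorem eq_integral (H : ACRep a b f g α β) :
    ∀ᵐ x ∂volume.restrict (Ioo a b), f x = α + ∫ s in a..x, g s := by
  obtain ⟨hab, F, hF, rfl, rfl, he, hd⟩ := H
  filter_upwards [he, ae_restrict_mem measurableSet_Ioo] with x hx hm
  have hF' : AbsolutelyContinuousOnInterval F a x := hF.mono (by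
    rw [uIcc_of_le hm.1.le, uIcc_of_le hab.le]; exact Icc_subset_Icc_right hm.2.le)
  have h1 : ∫ s in a..x, g s = ∫ s in a..x, deriv F s := by
    refine intervalIntegral.integral_congr_ae_restrict ?_
    rw [uIoc_of_le hm.1.le]
    rw [ae_Ioo_iff_Ioc] at hd
    filter_upwards [ae_restrict_of_ae_restrict_of_subset (Ioc_subset_Ioc_right hm.2.le) hd]
      with s hs using hs.deriv.symm
  rw [h1, hF'.integral_deriv_eq_sub, hx]; ring

theorem of_integral (hab : a < b) (hg : IntervalIntegrable g volume a b)
    (he : ∀ᵐ x ∂volume.restrict (Ioo a b), f x = α + ∫ s in a..x, g s) :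
    ACRep a b f g α (α + ∫ s in a..b, g s) := by
  refine ⟨hab, fun x => α + ∫ s in a..x, g s, ?_, by simp, rfl, he, ?_⟩
  · exact (LipschitzOnWith.absolutelyContinuousOnInterval (K := 0)
      (LipschitzWith.const α).lipschitzOnWith).fun_add
      (hg.absolutelyContinuousOnInterval_intervalIntegral left_mem_uIcc)
  · rw [ae_restrict_iff' measurableSet_Ioo]
    filter_upwards [hg.ae_hasDerivAt_integral] with x hx hm
    refine (hx ?_ a left_mem_uIcc).const_add α
    rw [uIcc_of_le hab.le]; exact Ioo_subset_Icc_self hm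

theorem congr (H : ACRep a b f g α β) (hf : ∀ᵐ x ∂volume.restrict (Ioo a b), f' x = f x)
    (hg : ∀ᵐ x ∂volume.restrict (Ioo a b), g' x = g x) : ACRep a b f' g' α β := by
  obtain ⟨hab, F, hF, h1, h2, he, hd⟩ := H
  refine ⟨hab, F, hF, h1, h2, ?_, ?_⟩
  · filter_upwards [hf, he] with x h1 h2 using h1.trans h2
  · filter_upwards [hg, hd] with x h1 h2
    rwa [h1]

theorem add (H : ACRep a b f g α β) (H' : ACRep a b f' g' α' β') :
    ACRep a b (fun x => f x + f' x) (fun x => g x + g' x) (α + α') (β + β') := by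
  obtain ⟨hab, F, hF, rfl, rfl, he, hd⟩ := H
  obtain ⟨-, F', hF', rfl, rfl, he', hd'⟩ := H'
  refine ⟨hab, fun x => F x + F' x, hF.fun_add hF', rfl, rfl, ?_, ?_⟩
  · filter_upwards [he, he'] with x h1 h2; rw [h1, h2]
  · filter_upwards [hd, hd'] with x h1 h2 using h1.add h2

theorem mul (H : ACRep a b f g α β) (H' : ACRep a b f' g' α' β') :
    ACRep a b (fun x => f x * f' x) (fun x => g x * f' x + f x * g' x) (α * α') (β * β') := by
  obtain ⟨hab, F, hF, rfl, rfl, he, hd⟩ := H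
  obtain ⟨-, F', hF', rfl, rfl, he', hd'⟩ := H'
  refine ⟨hab, fun x => F x * F' x, hF.fun_mul hF', rfl, rfl, ?_, ?_⟩
  · filter_upwards [he, he'] with x h1 h2; rw [h1, h2]
  · filter_upwards [hd, hd', he, he'] with x h1 h2 h3 h4
    rw [h3, h4]; exact h1.mul h2

theorem comp {Φ Φ' : ℝ → ℝ} {K : NNReal} (H : ACRep a b f g α β) (hL : LipschitzWith K Φ)
    (hΦ : ∀ s, HasDerivAt Φ (Φ' s) s) :
    ACRep a b (fun x => Φ (f x)) (fun x => Φ' (f x) * g x) (Φ α) (Φ β) := by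
  obtain ⟨hab, F, hF, rfl, rfl, he, hd⟩ := H
  refine ⟨hab, fun x => Φ (F x), lipschitz_comp_absolutelyContinuous hL hF, rfl, rfl, ?_, ?_⟩
  · filter_upwards [he] with x h1; rw [h1]
  · filter_upwards [hd, he] with x h1 h2
    rw [h2]; exact (hΦ _).comp x h1

theorem of_lipschitz {K : NNReal} (hab : a < b) (hL : LipschitzWith K f)
    (hd : ∀ᵐ x ∂volume.restrict (Ioo a b), HasDerivAt f (g x) x) :
    ACRep a b f g (f a) (f b) :=
  ⟨hab, f, hL.lipschitzOnWith.absolutelyContinuousOnInterval, rfl, rfl, by simp, hd⟩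

theorem const (hab : a < b) (c : ℝ) : ACRep a b (fun _ => c) (fun _ => 0) c c :=
  of_lipschitz (K := 0) hab (LipschitzWith.const c) (by simp [hasDerivAt_const])

theorem const_mul (H : ACRep a b f g α β) (c : ℝ) :
    ACRep a b (fun x => c * f x) (fun x => c * g x) (c * α) (c * β) :=
  ((const H.1 c).mul H).congr (by simp) (by simp)

theorem neg (H : ACRep a b f g α β) :
    ACRep a b (fun x => - f x) (fun x => - g x) (-α) (-β) := by
  simpa using H.const_mul (-1)

theorem sub (H : ACRep a b f g α β) (H' : ACRep a b f' g' α' β') :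
    ACRep a b (fun x => f x - f' x) (fun x => g x - g' x) (α - α') (β - β') := by
  simpa [sub_eq_add_neg] using H.add H'.neg

theorem id (hab : a < b) : ACRep a b (fun x => x) (fun _ => 1) a b :=
  of_lipschitz (f := fun x => x) hab LipschitzWith.id (by simp [hasDerivAt_id'])

theorem mono_right (H : ACRep a b f g α β) {c : ℝ} (hac : a < c) (hcb : c ≤ b) :
    ∃ γ, ACRep a c f g α γ := by
  obtain ⟨hab, F, hF, rfl, rfl, he, hd⟩ := H
  have hs : Ioo a c ⊆ Ioo a b := Ioo_subset_Ioo_right hcb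
  exact ⟨F c, hac, F, hF.mono (by
    rw [uIcc_of_le hac.le, uIcc_of_le hab.le]; exact Icc_subset_Icc_right hcb), rfl, rfl,
    ae_restrict_of_ae_restrict_of_subset hs he, ae_restrict_of_ae_restrict_of_subset hs hd⟩

theorem integrableOn_fun (H : ACRep a b f g α β) : IntegrableOn f (Ioo a b) := by
  obtain ⟨hab, F, hF, -, -, he, -⟩ := H
  have h1 : IntegrableOn F (Icc a b) := by
    have := hF.continuousOn
    rw [uIcc_of_le hab.le] at this
    exact this.integrableOn_Icc
  exact (h1.mono_set Ioo_subset_Icc_self).congr (by filter_upwards [he] with x hx using hx.symm)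

/-- The averages over `(0, δ)` converge to the value at the left end point. -/
theorem tendsto_average (H : ACRep 0 b f g α β) :
    Tendsto (fun δ : ℝ => δ⁻¹ * ∫ z in (0 : ℝ)..δ, f z) (𝓝[>] 0) (𝓝 α) := by
  obtain ⟨hab, F, hF, rfl, rfl, he, hd⟩ := H
  have hc := hF.continuousOn
  rw [uIcc_of_le hab.le] at hc
  have hci : IntervalIntegrable F volume 0 b := hc.intervalIntegrable_of_Icc hab.le
  have hder : HasDerivWithinAt (fun u => ∫ x in (0 : ℝ)..u, F x) (F 0) (Ici 0) 0 := by
    have hm : IntervalIntegrable F volume 0 0 := by simp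
    have hcw : ContinuousWithinAt F (Ici 0) 0 :=
      (hc 0 ⟨le_rfl, hab.le⟩).mono_of_mem_nhdsWithin (Icc_mem_nhdsGE hab)
    refine intervalIntegral.integral_hasDerivWithinAt_right hm ?_
      (hcw.mono Ioi_subset_Ici_self)
    refine ⟨Ioc 0 b, Ioc_mem_nhdsGT hab, ?_⟩
    exact ((hc.mono Ioc_subset_Icc_self).aestronglyMeasurable measurableSet_Ioc)
  have h2 := (hasDerivWithinAt_iff_tendsto_slope' (s := Ioi (0 : ℝ)) (by simp)).1
    (hder.mono Ioi_subset_Ici_self)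
  refine h2.congr' ?_
  filter_upwards [Ioc_mem_nhdsGT hab] with δ hδ
  rw [slope_def_field, div_eq_inv_mul]
  simp only [intervalIntegral.integral_same, sub_zero]
  congr 1
  refine intervalIntegral.integral_congr_ae_restrict ?_
  rw [uIoc_of_le hδ.1.le]
  rw [ae_Ioo_iff_Ioc] at he
  filter_upwards [ae_restrict_of_ae_restrict_of_subset (Ioc_subset_Ioc_right hδ.2) he]
    with s hs using hs.symm

/-- The substitution x ↦ 1 - x exchanges the two walls, so statements at the top wall reduce to
statements at the bottom. -/
theorem reflect (H : ACRep 0 1 f g α β) :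
    ACRep 0 1 (fun x => f (1 - x)) (fun x => -g (1 - x)) β α := by
  have H' := H
  have hab := H.1
  have hmp := measurePreserving_one_sub
  have hae := hmp.quasiMeasurePreserving.ae H'.eq_integral
  have hg : IntervalIntegrable (fun x => -g (1 - x)) volume 0 1 := by
    have := (H'.intervalIntegrable.comp_sub_left 1).symm
    have h := this.neg
    simp only [sub_zero, sub_self] at h
    exact h
  have hsub : ∀ x, ∫ s in (0 : ℝ)..x, -g (1 - s) = -∫ s in (1 - x)..1, g s := by
    intro x
    rw [intervalIntegral.integral_neg, intervalIntegral.integral_comp_sub_left (fun s => g s) 1]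
    simp
  have hr := of_integral (f := fun x => f (1 - x)) (α := β) hab hg ?_
  · rw [hsub, sub_self, H'.integral_eq] at hr
    convert hr using 1; ring
  · filter_upwards [hae, ae_restrict_mem measurableSet_Ioo] with x hx hm
    rw [hx, hsub]
    have h1 := H'.integral_eq
    have hx' : 1 - x ∈ uIcc (0 : ℝ) 1 := by
      rw [uIcc_of_le zero_le_one]; constructor <;> linarith [hm.1, hm.2]
    have hi := H'.intervalIntegrable
    rw [← intervalIntegral.integral_add_adjacent_intervals
      (hi.mono_set (uIcc_subset_uIcc_left hx')) (hi.mono_set (uIcc_subset_uIcc_right hx'))] at h1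
    linarith

/-- The averages over `(1 - δ, 1)` converge to the value at the right end point. -/
theorem tendsto_average_right (H : ACRep 0 1 f g α β) :
    Tendsto (fun δ : ℝ => δ⁻¹ * ∫ z in (0 : ℝ)..δ, f (1 - z)) (𝓝[>] 0) (𝓝 β) :=
  H.reflect.tendsto_average

/-- An almost-everywhere inequality passes to the continuous representative on the open interval and
then to its end point by continuity. -/
theorem right_nonneg_of_nonneg (H : ACRep 0 b f g α β)
    (hf : ∀ᵐ x ∂volume.restrict (Ioo 0 b), 0 ≤ f x) : 0 ≤ β := by
  obtain ⟨hab, F, hF, rfl, rfl, he, hd⟩ := H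
  have hc := hF.continuousOn
  rw [uIcc_of_le hab.le] at hc
  have hcl : ∀ x ∈ Ioo 0 b, 0 ≤ F x := by
    have h0 : ∀ᵐ x ∂volume.restrict (Ioo 0 b), 0 ≤ F x := by
      filter_upwards [hf, he] with x h1 h2; rwa [← h2]
    have hmin : (fun x => min (F x) 0) =ᵐ[volume.restrict (Ioo 0 b)] fun _ => 0 := by
      filter_upwards [h0] with x hx; simp [hx]
    have := Measure.eqOn_of_ae_eq hmin
      (ContinuousOn.inf (hc.mono Ioo_subset_Icc_self) continuousOn_const) continuousOn_const
      (by rw [interior_Ioo]; exact subset_closure)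
    intro x hx
    simpa using this hx
  have hb : Tendsto F (𝓝[Ioo 0 b] b) (𝓝 (F b)) :=
    (hc b ⟨hab.le, le_rfl⟩).mono_left (nhdsWithin_mono _ Ioo_subset_Icc_self)
  have : (𝓝[Ioo 0 b] b).NeBot := by
    rw [← mem_closure_iff_nhdsWithin_neBot, closure_Ioo hab.ne]; exact ⟨hab.le, le_rfl⟩
  exact ge_of_tendsto hb (by filter_upwards [self_mem_nhdsWithin] with x hx using hcl x hx)

/-- If `f` attains its maximum at the left end, its derivative is nonpositive there. -/
theorem deriv_left_nonpos {k : ℝ → ℝ} {γ γ' : ℝ} (H : ACRep 0 b f g α β)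
    (H' : ACRep 0 b g k γ γ') (hf : ∀ᵐ x ∂volume.restrict (Ioo 0 b), f x ≤ α) : γ ≤ 0 := by
  refine le_of_tendsto H'.tendsto_average ?_
  filter_upwards [Ioc_mem_nhdsGT H.1] with δ hδ
  obtain ⟨η, hη⟩ := H.mono_right hδ.1 hδ.2
  -- The average of the derivative over (0, δ) is the difference quotient of the function, which is
  -- nonpositive at a maximum.
  rw [hη.integral_eq]
  have h1 := ((const hδ.1 α).sub hη).right_nonneg_of_nonneg (by
    filter_upwards [ae_restrict_of_ae_restrict_of_subset (Ioo_subset_Ioo_right hδ.2) hf] with x hx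
    linarith)
  exact mul_nonpos_of_nonneg_of_nonpos (inv_nonneg.2 hδ.1.le) (by linarith)

/-- One-dimensional Sobolev embedding of W^{1,1} into L^∞: the oscillation is at most the integral
of the absolute value of the derivative, and averaging over the second point gives the mean of |f|.
-/
theorem abs_le_of_integral (H : ACRep a b f g α β) :
    ∀ᵐ x ∂volume.restrict (Ioo a b),
      |f x| ≤ (b - a)⁻¹ * (∫ s in Ioo a b, |f s|) + ∫ s in Ioo a b, |g s| := by
  have hfi := H.integrableOn_fun
  have hgi := H.integrableOn
  have hab := H.1
  obtain ⟨-, F, hF, rfl, rfl, he, hd⟩ := _root_.id H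
  have hdiff : ∀ x ∈ Ioo a b, ∀ y ∈ Ioo a b, |F x - F y| ≤ ∫ s in Ioo a b, |g s| := by
    intro x hx y hy
    have hF' : AbsolutelyContinuousOnInterval F y x := hF.mono (by
      rw [uIcc_of_le hab.le]; exact uIcc_subset_Icc ⟨hy.1.le, hy.2.le⟩ ⟨hx.1.le, hx.2.le⟩)
    have hsub : uIoc y x ⊆ Ioo a b := by
      intro s hs; rw [mem_uIoc] at hs
      constructor <;> rcases hs with h | h <;> linarith [h.1, h.2, hx.1, hx.2, hy.1, hy.2]
    rw [← hF'.integral_deriv_eq_sub, ← Real.norm_eq_abs]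
    refine (intervalIntegral.norm_integral_le_integral_norm_uIoc).trans ?_
    have h1 : ∫ s in uIoc y x, ‖deriv F s‖ = ∫ s in uIoc y x, |g s| := by
      refine integral_congr_ae ?_
      filter_upwards [ae_restrict_of_ae_restrict_of_subset hsub hd] with s hs
      rw [hs.deriv, Real.norm_eq_abs]
    rw [h1]
    exact setIntegral_mono_set hgi.abs (ae_of_all _ fun _ => abs_nonneg _)
      (LE.le.eventuallyLE hsub)
  filter_upwards [he, ae_restrict_mem measurableSet_Ioo] with x hx hm
  rw [hx]
  have hle : ∀ᵐ y ∂volume.restrict (Ioo a b), |F x| - ∫ s in Ioo a b, |g s| ≤ |f y| := by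
    filter_upwards [he, ae_restrict_mem measurableSet_Ioo] with y hy hym
    have h1 := hdiff x hm y hym
    have h2 := abs_sub_abs_le_abs_sub (F x) (F y)
    rw [hy]; linarith
  have h3 := integral_mono_ae (μ := volume.restrict (Ioo a b)) (integrable_const _) hfi.abs hle
  simp only [integral_const, smul_eq_mul, measureReal_restrict_apply_univ,
    Real.volume_real_Ioo_of_le hab.le] at h3
  have hba : 0 < b - a := by linarith
  have h4 : |F x| - ∫ s in Ioo a b, |g s| ≤ (b - a)⁻¹ * ∫ s in Ioo a b, |f s| := by
    rw [inv_mul_eq_div, le_div_iff₀ hba]; linarith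
  linarith

theorem sq_integral_le {δ : ℝ} {g : ℝ → ℝ} (hab : a ≤ δ) (hg : IntegrableOn g (Ioo a δ))
    (hg2 : IntegrableOn (fun x => g x ^ 2) (Ioo a δ)) :
    (∫ s in a..δ, g s) ^ 2 ≤ (δ - a) * ∫ s in Ioo a δ, g s ^ 2 := by
  rw [intervalIntegral.integral_of_le hab, integral_Ioc_eq_integral_Ioo]
  set μ := volume.restrict (Ioo a δ)
  set m := ∫ s in Ioo a δ, g s
  set q := ∫ s in Ioo a δ, g s ^ 2
  -- Cauchy–Schwarz from ∫(g - c)² ≥ 0; below, c is taken to be the mean of g.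
  have key : ∀ c : ℝ, 0 ≤ q - 2 * c * m + c ^ 2 * (δ - a) := by
    intro c
    have h0 : 0 ≤ ∫ s in Ioo a δ, (g s - c) ^ 2 := integral_nonneg fun _ => sq_nonneg _
    have h1 : ∫ s in Ioo a δ, (g s - c) ^ 2 = q - 2 * c * m + c ^ 2 * (δ - a) := by
      have : ∀ s, (g s - c) ^ 2 = g s ^ 2 - 2 * c * g s + c ^ 2 := fun s => by ring
      simp only [this]
      have hg' : Integrable (fun s => 2 * c * g s) μ := hg.const_mul _
      have hs : Integrable (fun s => g s ^ 2 - 2 * c * g s) μ := hg2.sub hg'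
      rw [integral_add hs (integrable_const _), integral_sub hg2 hg', integral_const_mul]
      have hμ : μ.real univ = δ - a := by simp [μ, Real.volume_real_Ioo_of_le hab]
      simp [hμ, mul_comm, m, q]
    rwa [h1] at h0
  rcases hab.eq_or_lt with h | h
  · subst h; simp [m]
  · have hd : 0 < δ - a := by linarith
    have := key (m / (δ - a))
    have h2 : q - 2 * (m / (δ - a)) * m + (m / (δ - a)) ^ 2 * (δ - a)
      = q - m ^ 2 / (δ - a) := by field_simp; ring
    rw [h2, sub_nonneg, div_le_iff₀ hd] at this
    linarith

/-- Cauchy–Schwarz applied to the primitive. The factor x - a is the gain near a wall that makes the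
convective flux through a thin layer small. -/
theorem sq_sub_le (H : ACRep a b f g α β) (hg2 : IntegrableOn (fun x => g x ^ 2) (Ioo a b)) :
    ∀ᵐ x ∂volume.restrict (Ioo a b),
      (f x - α) ^ 2 ≤ (x - a) * ∫ s in Ioo a b, g s ^ 2 := by
  filter_upwards [H.eq_integral, ae_restrict_mem measurableSet_Ioo] with x hx hm
  have hs : Ioo a x ⊆ Ioo a b := Ioo_subset_Ioo_right hm.2.le
  have h1 := sq_integral_le hm.1.le (H.integrableOn.mono_set hs) (hg2.mono_set hs)
  rw [hx, add_sub_cancel_left]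
  refine h1.trans (mul_le_mul_of_nonneg_left ?_ (by linarith [hm.1]))
  exact setIntegral_mono_set hg2 (ae_of_all _ fun _ => sq_nonneg _) (LE.le.eventuallyLE hs)

theorem sq_endpoints_le (H : ACRep a b f g α β)
    (hg2 : IntegrableOn (fun x => g x ^ 2) (Ioo a b)) :
    (β - α) ^ 2 ≤ (b - a) * ∫ s in Ioo a b, g s ^ 2 := by
  rw [← H.integral_eq]
  exact sq_integral_le H.1.le H.integrableOn hg2

end ACRep

end RayleighBenard

namespace RayleighBenard

/-! ### Weak derivatives in one variable -/

theorem exists_Icc_of_compact_subset_Ioo {K : Set ℝ} {a b : ℝ} (hab : a < b) (hK : IsCompact K)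
    (hs : K ⊆ Ioo a b) : ∃ p q, a < p ∧ p < q ∧ q < b ∧ K ⊆ Icc p q := by
  rcases K.eq_empty_or_nonempty with rfl | hne
  · exact ⟨a + (b - a) / 3, a + 2 * (b - a) / 3, by linarith, by linarith, by linarith, by simp⟩
  · obtain ⟨p, hp, hpm⟩ := hK.exists_isLeast hne
    obtain ⟨q, hq, hqm⟩ := hK.exists_isGreatest hne
    have h1 := hs hp
    have h2 := hs hq
    have h3 : p ≤ q := hpm hq
    exact ⟨(a + p) / 2, (q + b) / 2, by linarith [h1.1], by linarith [h1.1, h2.2],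
      by linarith [h2.2], fun x hx => ⟨by linarith [hpm hx, h1.1], by linarith [hqm hx, h2.2]⟩⟩

/-- Smooth functions with compact support in `(a, b)`. -/
def IsTest (a b : ℝ) (φ : ℝ → ℝ) : Prop :=
  ContDiff ℝ ∞ φ ∧ HasCompactSupport φ ∧ tsupport φ ⊆ Ioo a b

namespace IsTest

variable {a b : ℝ} {φ : ℝ → ℝ}

theorem exists_Icc (h : IsTest a b φ) (hab : a < b) :
    ∃ p q, a < p ∧ p < q ∧ q < b ∧ tsupport φ ⊆ Icc p q :=
  exists_Icc_of_compact_subset_Ioo hab h.2.1 h.2.2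

theorem deriv (h : IsTest a b φ) : IsTest a b (deriv φ) :=
  ⟨(contDiff_infty_iff_deriv.1 h.1).2, h.2.1.deriv,
    (closure_minimal support_deriv_subset (isClosed_tsupport φ)).trans h.2.2⟩

theorem hasDerivAt (h : IsTest a b φ) (x : ℝ) : HasDerivAt φ (_root_.deriv φ x) x :=
  ((h.1.differentiable (by simp)) x).hasDerivAt

theorem continuous (h : IsTest a b φ) : Continuous φ := h.1.continuous

theorem of_Icc (hφ : ContDiff ℝ ∞ φ) {p q : ℝ} (hp : a < p) (hq : q < b)
    (h0 : ∀ x, x ∉ Icc p q → φ x = 0) : IsTest a b φ := by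
  have hs : tsupport φ ⊆ Icc p q := by
    refine closure_minimal (fun x hx => ?_) isClosed_Icc
    by_contra hn
    exact hx (h0 x hn)
  exact ⟨hφ, HasCompactSupport.of_support_subset_isCompact isCompact_Icc
    ((subset_tsupport φ).trans hs), hs.trans (Icc_subset_Ioo hp hq)⟩

theorem integrableOn_mul (h : IsTest a b φ) {f : ℝ → ℝ} (hf : LocallyIntegrableOn f (Ioo a b)) :
    IntegrableOn (fun x => f x * φ x) (Ioo a b) := by
  have h1 : IntegrableOn f (tsupport φ) := hf.integrableOn_compact_subset h.2.2 h.2.1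
  have h2 : IntegrableOn (fun x => f x * φ x) (tsupport φ) :=
    h1.mul_continuousOn h.continuous.continuousOn h.2.1
  refine (integrableOn_iff_integrable_of_support_subset ?_).1 h2 |>.integrableOn
  exact (Function.support_mul_subset_right _ _).trans (subset_tsupport φ)

theorem exists_unit_integral (hab : a < b) : ∃ φ, IsTest a b φ ∧ ∫ x in Ioo a b, φ x = 1 := by
  let ψ : ContDiffBump ((a + b) / 2) := ⟨(b - a) / 8, (b - a) / 4, by linarith, by linarith⟩
  have ht : IsTest a b ψ := by
    refine ⟨ψ.contDiff, ψ.hasCompactSupport, ?_⟩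
    rw [ψ.tsupport_eq, Real.closedBall_eq_Icc]
    exact Icc_subset_Ioo (by simp only [ψ]; linarith) (by simp only [ψ]; linarith)
  have hp : 0 < ∫ x, ψ x := ψ.integral_pos
  refine ⟨fun x => (∫ x, ψ x)⁻¹ * ψ x, ⟨contDiff_const.mul ht.1, ht.2.1.mul_left, ?_⟩, ?_⟩
  · exact (closure_mono (Function.support_mul_subset_right _ _)).trans ht.2.2
  · rw [integral_const_mul, setIntegral_eq_integral_of_forall_compl_eq_zero, inv_mul_cancel₀ hp.ne']
    intro x hx
    by_contra hn
    exact hx (ht.2.2 (subset_tsupport _ hn))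

/-- A test function with vanishing integral is the derivative of a test function. -/
theorem exists_primitive (h : IsTest a b φ) (hab : a < b) (h0 : ∫ x in Ioo a b, φ x = 0) :
    ∃ ψ, IsTest a b ψ ∧ ∀ x, _root_.deriv ψ x = φ x := by
  obtain ⟨p, q, hap, hpq, hqb, hs⟩ := h.exists_Icc hab
  have hz : ∀ x, x ∉ Icc p q → φ x = 0 := fun x hx => by
    by_contra hn
    exact hx (hs (subset_tsupport _ hn))
  have hd : ∀ x, HasDerivAt (fun x => ∫ s in a..x, φ s) (φ x) x := fun x =>
    intervalIntegral.integral_hasDerivAt_right (h.continuous.intervalIntegrable _ _)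
      (h.continuous.stronglyMeasurableAtFilter _ _) h.continuous.continuousAt
  refine ⟨fun x => ∫ s in a..x, φ s, of_Icc ?_ hap hqb ?_, fun x => (hd x).deriv⟩
  · rw [contDiff_infty_iff_deriv]
    refine ⟨fun x => (hd x).differentiableAt, ?_⟩
    rw [funext fun x => (hd x).deriv]; exact h.1
  · intro x hx
    rw [mem_Icc, not_and_or, not_le, not_le] at hx
    have hab0 : ∫ s in a..b, φ s = 0 := by
      rw [intervalIntegral.integral_of_le hab.le, integral_Ioc_eq_integral_Ioo, h0]
    rcases hx with hx | hx
    · rw [intervalIntegral.integral_congr (g := fun _ => 0), intervalIntegral.integral_zero]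
      intro s hs'
      refine hz s fun hm => ?_
      have : s ≤ max a x := hs'.2
      rcases le_max_iff.1 this with h' | h' <;> linarith [hm.1]
    · have h1 := intervalIntegral.integral_add_adjacent_intervals
        (h.continuous.intervalIntegrable (μ := volume) a x) (h.continuous.intervalIntegrable x b)
      have h2 : ∫ s in x..b, φ s = 0 := by
        rw [intervalIntegral.integral_congr (g := fun _ => 0), intervalIntegral.integral_zero]
        intro s hs'
        refine hz s fun hm => ?_
        have : min x b ≤ s := hs'.1
        rcases min_le_iff.1 this with h' | h' <;> linarith [hm.2]
      linarith

end IsTest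

/-- The du Bois-Reymond lemma: subtracting the primitive of g leaves a function orthogonal to
derivatives of test functions, hence to every test function of zero integral, and such a function is
constant. -/
theorem ae_eq_const_add_integral {a b s₀ : ℝ} {f g : ℝ → ℝ} (hs₀ : s₀ ∈ Ioo a b)
    (hf : LocallyIntegrableOn f (Ioo a b)) (hg : LocallyIntegrableOn g (Ioo a b))
    (H : ∀ φ, IsTest a b φ →
      ∫ s in Ioo a b, f s * deriv φ s = -∫ s in Ioo a b, g s * φ s) :
    ∃ c, ∀ᵐ s ∂volume.restrict (Ioo a b), f s = c + ∫ r in s₀..s, g r := by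
  have hab : a < b := hs₀.1.trans hs₀.2
  have hgi : ∀ p q, p ∈ Ioo a b → q ∈ Ioo a b → IntervalIntegrable g volume p q := by
    intro p q hp hq
    rw [intervalIntegrable_iff]
    refine (hg.integrableOn_compact_subset ?_ isCompact_uIcc).mono_set uIoc_subset_uIcc
    exact (convex_Ioo a b).ordConnected.uIcc_subset hp hq
  set G : ℝ → ℝ := fun s => ∫ r in s₀..s, g r with hG
  have hGloc : LocallyIntegrableOn G (Ioo a b) := by
    have hc : ContinuousOn G (Ioo a b) := by
      intro x hx
      obtain ⟨p, q, hp, -, hq, hK⟩ := exists_Icc_of_compact_subset_Ioo (K := {x, s₀}) hab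
        (Set.Finite.isCompact (by simp)) (by
          intro y hy; rcases hy with rfl | rfl <;> assumption)
      have hxm := hK (mem_insert x _)
      have hsm := hK (mem_insert_of_mem x rfl)
      have hpq : p ≤ q := hxm.1.trans hxm.2
      have hi := hgi ((a + p) / 2) ((q + b) / 2) ⟨by linarith, by linarith⟩
        ⟨by linarith, by linarith⟩
      have := (hi.absolutelyContinuousOnInterval_intervalIntegral (c := s₀) (by
        rw [mem_uIcc]; left; constructor <;> linarith [hsm.1, hsm.2])).continuousOn
      refine (this.continuousAt ?_).continuousWithinAt
      rw [uIcc_of_le (by linarith)]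
      exact Icc_mem_nhds (by linarith [hxm.1]) (by linarith [hxm.2])
    exact hc.locallyIntegrableOn measurableSet_Ioo
  have hparts : ∀ φ, IsTest a b φ →
      ∫ s in Ioo a b, G s * deriv φ s = -∫ s in Ioo a b, g s * φ s := by
    intro φ hφ
    obtain ⟨p, q, hap, hpq, hqb, hsupp⟩ := hφ.exists_Icc hab
    -- The interval (p', q') contains the support of φ and the base point s₀, and has compact
    -- closure in (a, b), so that g is integrable on it.
    set p' := (a + min p s₀) / 2
    set q' := (max q s₀ + b) / 2
    have hap' : a < min p s₀ := lt_min hap hs₀.1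
    have hqb' : max q s₀ < b := max_lt hqb hs₀.2
    have hp1 : p' < p := by have := min_le_left p s₀; simp only [p']; linarith
    have hp2 : p' < s₀ := by have := min_le_right p s₀; simp only [p']; linarith
    have hq1 : q < q' := by have := le_max_left q s₀; simp only [q']; linarith
    have hq2 : s₀ < q' := by have := le_max_right q s₀; simp only [q']; linarith
    have hp3 : a < p' := by simp only [p']; linarith
    have hq3 : q' < b := by simp only [q']; linarith
    have hpq' : p' ≤ q' := by linarith
    have hz : ∀ ψ : ℝ → ℝ, tsupport ψ ⊆ Icc p q → ∀ x, x ∉ Ioo p' q' → ψ x = 0 := by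
      intro ψ hψ x hx
      by_contra hn
      have := hψ (subset_tsupport _ hn)
      exact hx ⟨by linarith [this.1], by linarith [this.2]⟩
    have hi := hgi p' q' ⟨hp3, by linarith⟩ ⟨by linarith, hq3⟩
    have hac : AbsolutelyContinuousOnInterval G p' q' :=
      hi.absolutelyContinuousOnInterval_intervalIntegral (by
        rw [uIcc_of_le hpq']; exact ⟨hp2.le, hq2.le⟩)
    have hφac : AbsolutelyContinuousOnInterval φ p' q' :=
      (hφ.1.of_le (by simp)).contDiffOn.absolutelyContinuousOnInterval
    have hset : ∀ f ψ : ℝ → ℝ, tsupport ψ ⊆ Icc p q →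
        ∫ s in Ioo a b, f s * ψ s = ∫ s in p'..q', f s * ψ s := by
      intro f ψ hψ
      rw [intervalIntegral.integral_of_le hpq', integral_Ioc_eq_integral_Ioo]
      refine setIntegral_eq_of_subset_of_forall_sdiff_eq_zero measurableSet_Ioo
        (Ioo_subset_Ioo hp3.le hq3.le) ?_
      intro x hx
      rw [hz ψ hψ x hx.2, mul_zero]
    have hdsupp : tsupport (deriv φ) ⊆ Icc p q :=
      (closure_minimal support_deriv_subset (isClosed_tsupport φ)).trans hsupp
    rw [hset _ _ hsupp, hset _ _ hdsupp, hac.integral_mul_deriv_eq_deriv_mul hφac,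
      hz φ hsupp p' (by simp), hz φ hsupp q' (by simp)]
    simp only [mul_zero, sub_zero, zero_sub, neg_inj]
    refine intervalIntegral.integral_congr_ae ?_
    filter_upwards [hi.ae_hasDerivAt_integral] with x hx hm
    rw [(hx (uIoc_subset_uIcc hm) s₀ (by
      rw [uIcc_of_le hpq']; exact ⟨hp2.le, hq2.le⟩)).deriv]
  set k : ℝ → ℝ := fun s => f s - G s
  have hk : LocallyIntegrableOn k (Ioo a b) := hf.sub hGloc
  have hk0 : ∀ φ, IsTest a b φ → ∫ s in Ioo a b, k s * deriv φ s = 0 := by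
    intro φ hφ
    have : ∀ s, k s * deriv φ s = f s * deriv φ s - G s * deriv φ s := fun s => by
      simp only [k]; ring
    simp only [this]
    rw [integral_sub (hφ.deriv.integrableOn_mul hf) (hφ.deriv.integrableOn_mul hGloc), H φ hφ,
      hparts φ hφ, sub_self]
  obtain ⟨χ, hχ, hχ1⟩ := IsTest.exists_unit_integral hab
  set c := ∫ s in Ioo a b, k s * χ s
  refine ⟨c, ?_⟩
  have hz : ∀ᵐ s ∂(volume : Measure ℝ), s ∈ Ioo a b → k s - c = 0 := by
    refine isOpen_Ioo.ae_eq_zero_of_integral_contDiff_smul_eq_zero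
      (hk.sub (continuousOn_const.locallyIntegrableOn measurableSet_Ioo)) ?_
    intro φ hφ1 hφ2 hφ3
    have hφ : IsTest a b φ := ⟨hφ1, hφ2, hφ3⟩
    have hsm : ∫ x, φ x • (k x - c) = ∫ x in Ioo a b, φ x • (k x - c) := by
      refine (setIntegral_eq_integral_of_forall_compl_eq_zero fun x hx => ?_).symm
      have : φ x = 0 := by
        by_contra hn
        exact hx (hφ3 (subset_tsupport _ hn))
      simp [this]
    rw [hsm]
    have hone : LocallyIntegrableOn (fun _ : ℝ => (1 : ℝ)) (Ioo a b) :=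
      continuousOn_const.locallyIntegrableOn measurableSet_Ioo
    have hφi : IntegrableOn φ (Ioo a b) := by simpa using hφ.integrableOn_mul hone
    have hχi : IntegrableOn χ (Ioo a b) := by simpa using hχ.integrableOn_mul hone
    set m := ∫ s in Ioo a b, φ s
    -- Subtracting the multiple m of χ, whose integral is 1, removes the mean of φ; the difference
    -- is then the derivative of a test function.
    have hψ : IsTest a b (fun s => φ s - m * χ s) := by
      refine ⟨hφ1.sub (contDiff_const.mul hχ.1), hφ2.sub hχ.2.1.mul_left, ?_⟩
      refine (tsupport_sub φ (fun s => m * χ s)).trans (union_subset hφ3 ?_)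
      exact (closure_mono (Function.support_mul_subset_right _ _)).trans hχ.2.2
    obtain ⟨Ψ, hΨ, hΨd⟩ := hψ.exists_primitive hab (by
      rw [integral_sub hφi (hχi.const_mul m), integral_const_mul, hχ1]; simp [m])
    have h1 := hk0 Ψ hΨ
    simp only [hΨd] at h1
    have h2 : ∀ s, k s * (φ s - m * χ s) = k s * φ s - m * (k s * χ s) := fun s => by ring
    simp only [h2] at h1
    rw [integral_sub (hφ.integrableOn_mul hk) ((hχ.integrableOn_mul hk).const_mul m),
      integral_const_mul] at h1
    have h3 : ∀ s, φ s • (k s - c) = k s * φ s - c * φ s := fun s => by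
      simp only [smul_eq_mul]; ring
    simp only [h3]
    rw [integral_sub (hφ.integrableOn_mul hk) (hφi.const_mul c), integral_const_mul]
    simp only [m, c] at h1 ⊢
    linarith
  rw [ae_restrict_iff' measurableSet_Ioo]
  filter_upwards [hz] with s hs hm
  have := hs hm
  simp only [k, hG] at this
  linarith

end RayleighBenard

namespace RayleighBenard

/-! ### Slicing weak derivatives -/

/-- Compact intervals exhausting `(a, b)`. -/
def exhaust (a b : ℝ) (n : ℕ) : Set ℝ := Icc (a + 1 / (n + 1 : ℝ)) (b - 1 / (n + 1 : ℝ))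

theorem exhaust_subset (a b : ℝ) (n : ℕ) : exhaust a b n ⊆ Ioo a b := by
  have : (0 : ℝ) < 1 / (n + 1 : ℝ) := by positivity
  exact Icc_subset_Ioo (by linarith) (by linarith)

theorem exists_subset_exhaust {a b : ℝ} (hab : a < b) {K : Set ℝ} (hK : IsCompact K)
    (hs : K ⊆ Ioo a b) : ∃ n, K ⊆ exhaust a b n := by
  obtain ⟨p, q, hp, -, hq, hpq⟩ := exists_Icc_of_compact_subset_Ioo hab hK hs
  obtain ⟨n, hn⟩ := exists_nat_one_div_lt (lt_min (sub_pos.2 hp) (sub_pos.2 hq))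
  have h1 := hn.trans_le (min_le_left _ _)
  have h2 := hn.trans_le (min_le_right _ _)
  exact ⟨n, hpq.trans (Icc_subset_Icc (by linarith) (by linarith))⟩

theorem ae_Ioo_of_exhaust {a b : ℝ} (hab : a < b) {p : ℝ → Prop}
    (h : ∀ n, ∀ᵐ x ∂volume.restrict (exhaust a b n), p x) :
    ∀ᵐ x ∂volume.restrict (Ioo a b), p x := by
  refine ae_restrict_of_ae_restrict_of_subset (s := Ioo a b) (t := ⋃ n, exhaust a b n) ?_ ?_
  · intro x hx
    obtain ⟨n, hn⟩ := exists_subset_exhaust hab isCompact_singleton (singleton_subset_iff.2 hx)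
    exact mem_iUnion.2 ⟨n, hn rfl⟩
  · rw [ae_restrict_iUnion_iff]; exact h

theorem locallyIntegrableOn_of_exhaust {a b : ℝ} (hab : a < b) {f : ℝ → ℝ}
    (h : ∀ n, IntegrableOn f (exhaust a b n)) : LocallyIntegrableOn f (Ioo a b) := by
  rw [locallyIntegrableOn_iff isOpen_Ioo.isLocallyClosed]
  intro K hK hc
  obtain ⟨n, hn⟩ := exists_subset_exhaust hab hc hK
  exact (h n).mono_set hn

variable {a b c d : ℝ} {F G : ℝ × ℝ → ℝ}

theorem restrict_prod_volume (s t : Set ℝ) : (volume : Measure (ℝ × ℝ)).restrict (s ×ˢ t) =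
    (volume.restrict s).prod (volume.restrict t) := by
  rw [Measure.prod_restrict, Measure.volume_eq_prod]

theorem integrableOn_exhaust_prod (hF : LocallyIntegrableOn F (Ioo a b ×ˢ Ioo c d)) (n m : ℕ) :
    Integrable F ((volume.restrict (exhaust a b n)).prod (volume.restrict (exhaust c d m))) := by
  rw [← restrict_prod_volume]
  exact hF.integrableOn_compact_subset
    (prod_mono (exhaust_subset _ _ _) (exhaust_subset _ _ _)) (isCompact_Icc.prod isCompact_Icc)

theorem ae_slice_locallyIntegrable (hab : a < b) (hcd : c < d)
    (hF : LocallyIntegrableOn F (Ioo a b ×ˢ Ioo c d)) :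
    ∀ᵐ r ∂volume.restrict (Ioo c d), LocallyIntegrableOn (fun s => F (s, r)) (Ioo a b) := by
  have : ∀ᵐ r ∂volume.restrict (Ioo c d), ∀ n, IntegrableOn (fun s => F (s, r)) (exhaust a b n) := by
    rw [ae_all_iff]
    intro n
    exact ae_Ioo_of_exhaust hcd fun m => (integrableOn_exhaust_prod hF n m).prod_left_ae
  filter_upwards [this] with r hr using locallyIntegrableOn_of_exhaust hab hr

theorem integrable_mul_test {φ : ℝ → ℝ} (hφ : IsTest a b φ)
    (hF : LocallyIntegrableOn F (Ioo a b ×ˢ Ioo c d)) (m : ℕ) :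
    Integrable (fun q : ℝ × ℝ => F q * φ q.1)
      ((volume.restrict (Ioo a b)).prod (volume.restrict (exhaust c d m))) := by
  rw [← restrict_prod_volume]
  have hK : IsCompact (tsupport φ ×ˢ exhaust c d m) := hφ.2.1.isCompact.prod isCompact_Icc
  have h1 : IntegrableOn F (tsupport φ ×ˢ exhaust c d m) :=
    hF.integrableOn_compact_subset (prod_mono hφ.2.2 (exhaust_subset _ _ _)) hK
  have h2 := h1.mul_continuousOn (g' := fun q : ℝ × ℝ => φ q.1)
    (hφ.continuous.comp continuous_fst).continuousOn hK
  refine h2.of_forall_sdiff_eq_zero (measurableSet_Ioo.prod measurableSet_Icc) ?_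
  rintro ⟨x, y⟩ ⟨⟨hx, hy⟩, hn⟩
  have : φ x = 0 := by
    by_contra h0
    exact hn ⟨subset_tsupport _ h0, hy⟩
  simp [this]

theorem integrable_mul_test_mul_test {φ ψ : ℝ → ℝ} (hφ : IsTest a b φ) (hψ : IsTest c d ψ)
    (hF : LocallyIntegrableOn F (Ioo a b ×ˢ Ioo c d)) :
    Integrable (fun q : ℝ × ℝ => F q * (φ q.1 * ψ q.2))
      ((volume.restrict (Ioo a b)).prod (volume.restrict (Ioo c d))) := by
  rw [← restrict_prod_volume]
  have hK : IsCompact (tsupport φ ×ˢ tsupport ψ) := hφ.2.1.isCompact.prod hψ.2.1.isCompact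
  have h1 : IntegrableOn F (tsupport φ ×ˢ tsupport ψ) :=
    hF.integrableOn_compact_subset (prod_mono hφ.2.2 hψ.2.2) hK
  have h2 := h1.mul_continuousOn (g' := fun q : ℝ × ℝ => φ q.1 * ψ q.2)
    ((hφ.continuous.comp continuous_fst).mul (hψ.continuous.comp continuous_snd)).continuousOn hK
  refine h2.of_forall_sdiff_eq_zero (measurableSet_Ioo.prod measurableSet_Ioo) ?_
  rintro ⟨x, y⟩ ⟨-, hn⟩
  by_cases h0 : φ x = 0
  · simp [h0]
  · have : ψ y = 0 := by
      by_contra h1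
      exact hn ⟨subset_tsupport _ h0, subset_tsupport _ h1⟩
    simp [this]

/-- For fixed φ, the integral over the line at height r is a locally integrable function of r.
Testing with products φ ⊗ ψ says that it is orthogonal to every ψ. -/
theorem ae_slice_test (hcd : c < d) (hF : LocallyIntegrableOn F (Ioo a b ×ˢ Ioo c d))
    (hG : LocallyIntegrableOn G (Ioo a b ×ˢ Ioo c d)) {φ : ℝ → ℝ} (hφ : IsTest a b φ)
    (H : ∀ ψ, IsTest c d ψ →
      ∫ q in Ioo a b ×ˢ Ioo c d, F q * (deriv φ q.1 * ψ q.2) =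
        -∫ q in Ioo a b ×ˢ Ioo c d, G q * (φ q.1 * ψ q.2)) :
    ∀ᵐ r ∂volume.restrict (Ioo c d),
      ∫ s in Ioo a b, (F (s, r) * deriv φ s + G (s, r) * φ s) = 0 := by
  have hint : ∀ m, Integrable (fun q : ℝ × ℝ => F q * deriv φ q.1 + G q * φ q.1)
      ((volume.restrict (Ioo a b)).prod (volume.restrict (exhaust c d m))) := fun m =>
    (integrable_mul_test hφ.deriv hF m).add (integrable_mul_test hφ hG m)
  rw [ae_restrict_iff' measurableSet_Ioo]
  refine isOpen_Ioo.ae_eq_zero_of_integral_contDiff_smul_eq_zero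
    (locallyIntegrableOn_of_exhaust hcd fun m => (hint m).integral_prod_right) ?_
  intro ψ h1 h2 h3
  have hψ : IsTest c d ψ := ⟨h1, h2, h3⟩
  have hsm : ∀ k : ℝ → ℝ, ∫ x, ψ x • k x = ∫ x in Ioo c d, ψ x • k x := by
    intro k
    refine (setIntegral_eq_integral_of_forall_compl_eq_zero fun x hx => ?_).symm
    have : ψ x = 0 := by
      by_contra hn
      exact hx (h3 (subset_tsupport _ hn))
    simp [this]
  rw [hsm]
  have hA := integrable_mul_test_mul_test hφ.deriv hψ hF
  have hB := integrable_mul_test_mul_test hφ hψ hG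
  have hH := H ψ hψ
  rw [restrict_prod_volume] at hH
  have hsum : ∫ q, (F q * (deriv φ q.1 * ψ q.2) + G q * (φ q.1 * ψ q.2))
      ∂((volume.restrict (Ioo a b)).prod (volume.restrict (Ioo c d))) = 0 := by
    rw [integral_add hA hB, hH]; ring
  have hAB : Integrable (fun q : ℝ × ℝ => F q * (deriv φ q.1 * ψ q.2) + G q * (φ q.1 * ψ q.2))
      ((volume.restrict (Ioo a b)).prod (volume.restrict (Ioo c d))) := hA.add hB
  rw [integral_prod_symm _ hAB] at hsum
  rw [← hsum]
  refine integral_congr_ae (ae_of_all _ fun r => ?_)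
  simp only [smul_eq_mul, ← integral_const_mul]
  refine integral_congr_ae (ae_of_all _ fun s => ?_)
  simp only []
  ring

/-- The null set of bad lines in `ae_slice_test` depends on φ. It can be chosen uniformly because
the pairs (φ, φ') with support in a fixed compact interval form a separable set for local uniform
convergence, and both sides of the identity are continuous under that convergence. -/
theorem ae_slice_weak (hab : a < b) (hcd : c < d)
    (hF : LocallyIntegrableOn F (Ioo a b ×ˢ Ioo c d))
    (hG : LocallyIntegrableOn G (Ioo a b ×ˢ Ioo c d))
    (H : ∀ φ ψ, IsTest a b φ → IsTest c d ψ →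
      ∫ q in Ioo a b ×ˢ Ioo c d, F q * (deriv φ q.1 * ψ q.2) =
        -∫ q in Ioo a b ×ˢ Ioo c d, G q * (φ q.1 * ψ q.2)) :
    ∀ᵐ r ∂volume.restrict (Ioo c d), ∀ φ, IsTest a b φ →
      ∫ s in Ioo a b, F (s, r) * deriv φ s = -∫ s in Ioo a b, G (s, r) * φ s := by
  -- Recording the derivative as a second component makes convergence in this space C¹ convergence;
  -- the index n fixes a compact set that contains the supports.
  let R : ℕ → Set (C(ℝ, ℝ) × C(ℝ, ℝ)) := fun n =>
    {p | IsTest a b p.1 ∧ (∀ x, p.2 x = deriv p.1 x) ∧ tsupport p.1 ⊆ exhaust a b n}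
  have hD : ∀ n, ∃ D : Set (R n), D.Countable ∧ Dense D := fun n =>
    TopologicalSpace.exists_countable_dense (R n)
  choose D hDc hDd using hD
  have hall : ∀ᵐ r ∂volume.restrict (Ioo c d), ∀ n, ∀ p ∈ D n,
      ∫ s in Ioo a b, (F (s, r) * p.1.2 s + G (s, r) * p.1.1 s) = 0 := by
    rw [ae_all_iff]
    intro n
    rw [ae_ball_iff (hDc n)]
    intro p hp
    filter_upwards [ae_slice_test hcd hF hG p.2.1 fun ψ hψ => H _ ψ p.2.1 hψ] with r hr
    rw [← hr]
    simp only [p.2.2.1]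
  filter_upwards [hall, ae_slice_locallyIntegrable hab hcd hF,
    ae_slice_locallyIntegrable hab hcd hG] with r hr hFr hGr
  intro φ hφ
  obtain ⟨n, hn⟩ := exists_subset_exhaust hab hφ.2.1.isCompact hφ.2.2
  let φ₁ : C(ℝ, ℝ) := ⟨φ, hφ.continuous⟩
  let φ₂ : C(ℝ, ℝ) := ⟨deriv φ, hφ.deriv.continuous⟩
  let P : R n := ⟨(φ₁, φ₂), hφ, fun x => rfl, hn⟩
  obtain ⟨p, hpD, hp⟩ := mem_closure_iff_seq_limit.1 (hDd n P)
  have hp1 : Tendsto (fun k => (p k).1.1) atTop (𝓝 φ₁) :=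
    (continuous_fst.comp continuous_subtype_val).continuousAt.tendsto.comp hp
  have hp2 : Tendsto (fun k => (p k).1.2) atTop (𝓝 φ₂) :=
    (continuous_snd.comp continuous_subtype_val).continuousAt.tendsto.comp hp
  have hlim : ∀ (f : ℝ → ℝ), LocallyIntegrableOn f (Ioo a b) → ∀ (g : ℕ → C(ℝ, ℝ)) (g₀ : C(ℝ, ℝ)),
      Tendsto g atTop (𝓝 g₀) → (∀ k x, x ∉ exhaust a b n → g k x = 0) →
      Tendsto (fun k => ∫ s in Ioo a b, f s * g k s) atTop (𝓝 (∫ s in Ioo a b, f s * g₀ s)) := by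
    intro f hf g g₀ hg hg0
    have hu := (ContinuousMap.tendsto_iff_forall_isCompact_tendstoUniformlyOn.1 hg) _
      (isCompact_Icc : IsCompact (exhaust a b n))
    have hpt : ∀ x, Tendsto (fun k => g k x) atTop (𝓝 (g₀ x)) := fun x =>
      (ContinuousEvalConst.continuous_eval_const x).continuousAt.tendsto.comp hg
    have hfi : IntegrableOn f (exhaust a b n) :=
      hf.integrableOn_compact_subset (exhaust_subset _ _ _) isCompact_Icc
    obtain ⟨C, hC⟩ := (isCompact_Icc : IsCompact (exhaust a b n)).exists_bound_of_continuousOn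
      g₀.continuous.continuousOn
    have hset : ∀ g : C(ℝ, ℝ), (∀ x, x ∉ exhaust a b n → g x = 0) →
        ∫ s in Ioo a b, f s * g s = ∫ s in exhaust a b n, f s * g s := by
      intro g hg
      refine setIntegral_eq_of_subset_of_forall_sdiff_eq_zero measurableSet_Ioo
        (exhaust_subset _ _ _) ?_
      intro x hx
      rw [hg x hx.2, mul_zero]
    have hg00 : ∀ x, x ∉ exhaust a b n → g₀ x = 0 := fun x hx =>
      tendsto_nhds_unique (hpt x) (by simp [hg0 _ x hx])
    simp only [hset _ (hg0 _), hset _ hg00]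
    refine tendsto_integral_filter_of_dominated_convergence (fun s => |f s| * (C + 1)) ?_ ?_
      (hfi.abs.mul_const _) (ae_of_all _ fun s => (hpt s).const_mul _)
    · exact Eventually.of_forall fun k => hfi.1.mul (g k).continuous.aestronglyMeasurable
    · filter_upwards [Metric.tendstoUniformlyOn_iff.1 hu 1 one_pos] with k hk
      filter_upwards [ae_restrict_mem measurableSet_Icc] with s hs
      rw [norm_mul, Real.norm_eq_abs]
      refine mul_le_mul_of_nonneg_left ?_ (abs_nonneg _)
      have h1 := hk s hs
      rw [dist_eq_norm] at h1
      have h2 := hC s hs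
      have h3 := norm_sub_norm_le (g k s) (g₀ s)
      rw [norm_sub_rev] at h3
      linarith
  have hsupp : ∀ k x, x ∉ exhaust a b n → (p k).1.1 x = 0 := by
    intro k x hx
    by_contra hn0
    exact hx ((p k).2.2.2 (subset_tsupport _ hn0))
  have hsupp' : ∀ k x, x ∉ exhaust a b n → (p k).1.2 x = 0 := by
    intro k x hx
    rw [(p k).2.2.1]
    by_contra hn0
    exact hx ((p k).2.2.2 (support_deriv_subset hn0))
  have hl1 := hlim _ hFr _ _ hp2 hsupp'
  have hl2 := hlim _ hGr _ _ hp1 hsupp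
  have hmul : ∀ (f : ℝ → ℝ), LocallyIntegrableOn f (Ioo a b) → ∀ g : C(ℝ, ℝ),
      (∀ x, x ∉ exhaust a b n → g x = 0) → IntegrableOn (fun s => f s * g s) (Ioo a b) := by
    intro f hf g hg
    have h1 : IntegrableOn f (exhaust a b n) :=
      hf.integrableOn_compact_subset (exhaust_subset _ _ _) isCompact_Icc
    refine (h1.mul_continuousOn g.continuous.continuousOn isCompact_Icc).of_forall_sdiff_eq_zero
      measurableSet_Ioo ?_
    intro x hx
    rw [hg x hx.2, mul_zero]
  have hz : ∀ k, ∫ s in Ioo a b, F (s, r) * (p k).1.2 s =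
      -∫ s in Ioo a b, G (s, r) * (p k).1.1 s := by
    intro k
    have h1 := hr n (p k) (hpD k)
    rw [integral_add (hmul _ hFr _ (hsupp' k)) (hmul _ hGr _ (hsupp k))] at h1
    linarith
  simp only [hz] at hl1
  exact tendsto_nhds_unique hl1 hl2.neg

/-- A weak derivative in the first variable is a derivative along almost every line. -/
theorem ae_slice_eq_integral {s₀ : ℝ} (hs₀ : s₀ ∈ Ioo a b) (hcd : c < d)
    (hF : LocallyIntegrableOn F (Ioo a b ×ˢ Ioo c d))
    (hG : LocallyIntegrableOn G (Ioo a b ×ˢ Ioo c d))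
    (H : ∀ φ ψ, IsTest a b φ → IsTest c d ψ →
      ∫ q in Ioo a b ×ˢ Ioo c d, F q * (deriv φ q.1 * ψ q.2) =
        -∫ q in Ioo a b ×ˢ Ioo c d, G q * (φ q.1 * ψ q.2)) :
    ∀ᵐ r ∂volume.restrict (Ioo c d), LocallyIntegrableOn (fun s => G (s, r)) (Ioo a b) ∧
      ∃ α, ∀ᵐ s ∂volume.restrict (Ioo a b), F (s, r) = α + ∫ σ in s₀..s, G (σ, r) := by
  have hab : a < b := hs₀.1.trans hs₀.2
  filter_upwards [ae_slice_weak hab hcd hF hG H, ae_slice_locallyIntegrable hab hcd hF,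
    ae_slice_locallyIntegrable hab hcd hG] with r hr hFr hGr
  exact ⟨hGr, ae_eq_const_add_integral hs₀ hFr hGr hr⟩

end RayleighBenard

namespace RayleighBenard

/-! ### Flattening the strip -/

/-- The shear `(x, z) ↦ (x, h x + z)`, which maps `ℝ × (0, 1)` onto the strip. -/
def shear (h : ℝ → ℝ) (hc : Continuous h) : ℝ × ℝ ≃ₜ ℝ × ℝ where
  toFun q := (q.1, h q.1 + q.2)
  invFun y := (y.1, y.2 - h y.1)
  left_inv q := by simp
  right_inv y := by simp
  continuous_toFun := by fun_prop
  continuous_invFun := by fun_prop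

/-- A function on the strip in the coordinates `x = y₁`, `z = y₂ - h y₁`. -/
def flat (h : ℝ → ℝ) (f : ℝ × ℝ → ℝ) (q : ℝ × ℝ) : ℝ := f (q.1, h q.1 + q.2)

/-- Lebesgue measure on the flattened period cell. -/
noncomputable def cellMeasure (Γ : ℝ) : Measure (ℝ × ℝ) :=
  (volume.restrict (Ioo 0 Γ)).prod (volume.restrict (Ioo 0 1))

instance (Γ : ℝ) : IsFiniteMeasure (cellMeasure Γ) := by
  unfold cellMeasure; infer_instance

theorem IsProfile.continuous {Γ : ℝ} {h : ℝ → ℝ} (H : IsProfile Γ h) : Continuous h :=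
  H.differentiable.continuous

theorem IsProfile.continuous_deriv {Γ : ℝ} {h : ℝ → ℝ} (H : IsProfile Γ h) :
    Continuous (deriv h) := by
  obtain ⟨K, hK⟩ := H.lipschitz_deriv
  exact hK.continuous

section Shear

variable {Γ : ℝ} {h : ℝ → ℝ}

theorem measurePreserving_shear (hc : Continuous h) :
    MeasurePreserving (shear h hc) (volume : Measure (ℝ × ℝ)) volume := by
  rw [Measure.volume_eq_prod]
  refine MeasurePreserving.skew_product (g := fun x z => h x + z) (MeasurePreserving.id _)
    (by fun_prop) (ae_of_all _ fun x => ?_)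
  exact (measurePreserving_add_left volume (h x)).map_eq

theorem shear_apply (hc : Continuous h) (q : ℝ × ℝ) : shear h hc q = (q.1, h q.1 + q.2) := rfl

theorem mem_strip {y : ℝ × ℝ} : y ∈ strip h ↔ h y.1 < y.2 ∧ y.2 < 1 + h y.1 := Iff.rfl

theorem mem_cell {y : ℝ × ℝ} : y ∈ cell Γ h ↔ (0 < y.1 ∧ y.1 < Γ) ∧ y ∈ strip h := Iff.rfl

theorem shear_preimage_strip (hc : Continuous h) : shear h hc ⁻¹' strip h = univ ×ˢ Ioo 0 1 := by
  ext q
  rw [mem_preimage, shear_apply, mem_strip]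
  simp only [mem_prod, mem_univ, true_and, mem_Ioo]
  constructor <;> rintro ⟨h1, h2⟩ <;> constructor <;> linarith

theorem shear_preimage_cell (hc : Continuous h) :
    shear h hc ⁻¹' cell Γ h = Ioo 0 Γ ×ˢ Ioo 0 1 := by
  ext q
  have := shear_preimage_strip hc
  rw [Set.ext_iff] at this
  have h2 := this q
  simp only [mem_preimage, mem_prod, mem_univ, true_and] at h2
  rw [mem_preimage, mem_cell, h2]
  rfl

theorem isOpen_strip (hc : Continuous h) : IsOpen (strip h) := by
  rw [← (shear h hc).isOpen_preimage, shear_preimage_strip]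
  exact isOpen_univ.prod isOpen_Ioo

theorem isOpen_cell (hc : Continuous h) : IsOpen (cell Γ h) := by
  rw [← (shear h hc).isOpen_preimage, shear_preimage_cell]
  exact isOpen_Ioo.prod isOpen_Ioo

theorem measurePreserving_shear_cell (hc : Continuous h) :
    MeasurePreserving (shear h hc) (cellMeasure Γ) (volume.restrict (cell Γ h)) := by
  have := (measurePreserving_shear hc).restrict_preimage (isOpen_cell (Γ := Γ) hc).measurableSet
  rwa [shear_preimage_cell, restrict_prod_volume] at this

theorem setIntegral_strip (hc : Continuous h) (f : ℝ × ℝ → ℝ) :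
    ∫ y in strip h, f y = ∫ q in univ ×ˢ Ioo 0 1, flat h f q := by
  have := (measurePreserving_shear hc).restrict_preimage (isOpen_strip hc).measurableSet
  rw [shear_preimage_strip] at this
  exact (this.integral_comp (shear h hc).measurableEmbedding f).symm

theorem memLp_flat (hc : Continuous h) {f : ℝ × ℝ → ℝ} {p : ℝ≥0∞}
    (hf : MemLp f p (volume.restrict (cell Γ h))) : MemLp (flat h f) p (cellMeasure Γ) :=
  hf.comp_measurePreserving (measurePreserving_shear_cell hc)

theorem ae_flat (hc : Continuous h) {p : ℝ × ℝ → Prop}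
    (hp : ∀ᵐ y ∂volume.restrict (cell Γ h), p y) :
    ∀ᵐ q ∂cellMeasure Γ, p (q.1, h q.1 + q.2) :=
  (measurePreserving_shear_cell hc).quasiMeasurePreserving.ae hp

theorem area_eq (hΓ : 0 < Γ) (hc : Continuous h) : area Γ h = Γ := by
  have h1 := (measurePreserving_shear hc).measure_preimage
    (isOpen_cell (Γ := Γ) hc).measurableSet.nullMeasurableSet
  rw [area, ← h1, shear_preimage_cell, Measure.volume_eq_prod, Measure.prod_prod]
  simp [hΓ.le]

theorem locallyIntegrableOn_flat (hc : Continuous h) {f : ℝ × ℝ → ℝ}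
    (hf : LocallyIntegrableOn f (strip h)) :
    LocallyIntegrableOn (flat h f) (univ ×ˢ Ioo 0 1) := by
  have ho : IsOpen ((univ : Set ℝ) ×ˢ Ioo (0 : ℝ) 1) := isOpen_univ.prod isOpen_Ioo
  rw [locallyIntegrableOn_iff ho.isLocallyClosed]
  intro K hK hKc
  have h1 : IntegrableOn f (shear h hc '' K) := by
    refine hf.integrableOn_compact_subset ?_ (hKc.image (shear h hc).continuous)
    rw [image_subset_iff, shear_preimage_strip]
    exact hK
  rw [← (measurePreserving_shear hc).integrableOn_comp_preimage
    (shear h hc).measurableEmbedding] at h1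
  rwa [(shear h hc).injective.preimage_image] at h1

/-- Smooth profiles converging to a `C^{1,1}` profile together with their derivatives. -/
theorem IsProfile.exists_smooth_approx (H : IsProfile Γ h) (ε : ℝ) (hε : 0 < ε) :
    ∃ k : ℝ → ℝ, ContDiff ℝ ∞ k ∧ (∀ x, |deriv k x - deriv h x| ≤ ε) ∧
      ∀ x, |k x - h x| ≤ ε * |x| := by
  obtain ⟨K, hK⟩ := H.lipschitz_deriv
  -- The derivative of h is approximated uniformly and then integrated from 0, so the error in h
  -- grows at most like ε|x|.
  obtain ⟨η, hη, hd⟩ := hK.uniformContinuous.exists_contDiff_dist_le hε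
  have hder : ∀ x, HasDerivAt (fun x => h 0 + ∫ s in (0 : ℝ)..x, η s) (η x) x := fun x =>
    (intervalIntegral.integral_hasDerivAt_right (hη.continuous.intervalIntegrable _ _)
      (hη.continuous.stronglyMeasurableAtFilter _ _) hη.continuous.continuousAt).const_add _
  refine ⟨fun x => h 0 + ∫ s in (0 : ℝ)..x, η s, ?_, ?_, ?_⟩
  · rw [contDiff_infty_iff_deriv]
    refine ⟨fun x => (hder x).differentiableAt, ?_⟩
    rw [funext fun x => (hder x).deriv]; exact hη
  · intro x
    rw [(hder x).deriv]; exact (hd x).le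
  · intro x
    have h1 : ∫ s in (0 : ℝ)..x, deriv h s = h x - h 0 :=
      intervalIntegral.integral_deriv_eq_sub (fun y _ => H.differentiable y)
        (hK.continuous.intervalIntegrable _ _)
    have h2 : h 0 + (∫ s in (0 : ℝ)..x, η s) - h x = ∫ s in (0 : ℝ)..x, (η s - deriv h s) := by
      rw [intervalIntegral.integral_sub (hη.continuous.intervalIntegrable _ _)
        (hK.continuous.intervalIntegrable _ _), h1]; ring
    rw [h2, ← Real.norm_eq_abs]
    have := intervalIntegral.norm_integral_le_of_norm_le_const (a := (0 : ℝ)) (b := x) (C := ε)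
      (f := fun s => η s - deriv h s) (fun s _ => (hd s).le)
    simpa using this

theorem pderiv_zero_eq {φ : ℝ × ℝ → ℝ} {y : ℝ × ℝ} {d : ℝ} (hφ : DifferentiableAt ℝ φ y)
    (hd : HasDerivAt (fun s => φ (s, y.2)) d y.1) : pderiv 0 φ y = d := by
  have h1 : HasDerivAt (fun s : ℝ => (s, y.2)) ((1 : ℝ), (0 : ℝ)) y.1 :=
    (hasDerivAt_id y.1).prodMk (hasDerivAt_const _ _)
  have h2 : HasFDerivAt φ (fderiv ℝ φ y) ((fun s : ℝ => (s, y.2)) y.1) := hφ.hasFDerivAt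
  exact (h2.comp_hasDerivAt y.1 h1).unique hd

theorem pderiv_one_eq {φ : ℝ × ℝ → ℝ} {y : ℝ × ℝ} {d : ℝ} (hφ : DifferentiableAt ℝ φ y)
    (hd : HasDerivAt (fun s => φ (y.1, s)) d y.2) : pderiv 1 φ y = d := by
  have h1 : HasDerivAt (fun s : ℝ => (y.1, s)) ((0 : ℝ), (1 : ℝ)) y.2 :=
    (hasDerivAt_const _ _).prodMk (hasDerivAt_id y.2)
  have h2 : HasFDerivAt φ (fderiv ℝ φ y) ((fun s : ℝ => (y.1, s)) y.2) := hφ.hasFDerivAt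
  exact (h2.comp_hasDerivAt y.2 h1).unique hd

end Shear

end RayleighBenard

namespace RayleighBenard

/-! ### Weak derivatives in the sheared coordinates -/

section WeakFlat

variable {Γ p q : ℝ} {h k φ ψ : ℝ → ℝ}

/-- Dominated convergence for uniformly bounded test factors supported in a common compact set, on
which f is integrable. -/
theorem tendsto_setIntegral_strip {f : ℝ × ℝ → ℝ} (hf : LocallyIntegrableOn f (strip h))
    (hc : Continuous h) {K : Set (ℝ × ℝ)} (hK : IsCompact K) (hKs : K ⊆ strip h)
    {Ψ : ℕ → ℝ × ℝ → ℝ} {Ψ₀ : ℝ × ℝ → ℝ} {C : ℝ} (hΨ : ∀ n, Continuous (Ψ n))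
    (hb : ∀ n y, |Ψ n y| ≤ C) (h0 : ∀ n y, y ∉ K → Ψ n y = 0)
    (hl : ∀ y, Tendsto (fun n => Ψ n y) atTop (𝓝 (Ψ₀ y))) :
    Tendsto (fun n => ∫ y in strip h, f y * Ψ n y) atTop (𝓝 (∫ y in strip h, f y * Ψ₀ y)) := by
  have hfK : IntegrableOn f K := hf.integrableOn_compact_subset hKs hK
  have hset : ∀ Φ : ℝ × ℝ → ℝ, (∀ y, y ∉ K → Φ y = 0) →
      ∫ y in strip h, f y * Φ y = ∫ y in K, f y * Φ y := by
    intro Φ hΦ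
    refine setIntegral_eq_of_subset_of_forall_sdiff_eq_zero (isOpen_strip hc).measurableSet hKs ?_
    intro y hy
    rw [hΦ y hy.2, mul_zero]
  have h00 : ∀ y, y ∉ K → Ψ₀ y = 0 := fun y hy =>
    tendsto_nhds_unique (hl y) (by simp [h0 _ y hy])
  simp only [hset _ (h0 _), hset _ h00]
  refine tendsto_integral_of_dominated_convergence (fun y => |f y| * C)
    (fun n => hfK.1.mul (hΨ n).aestronglyMeasurable) (hfK.abs.mul_const _) ?_
    (ae_of_all _ fun y => (hl y).const_mul _)
  intro n
  refine ae_of_all _ fun y => ?_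
  rw [norm_mul, Real.norm_eq_abs, Real.norm_eq_abs]
  exact mul_le_mul_of_nonneg_left (hb n y) (abs_nonneg _)

theorem contDiff_sheared (hφ : ContDiff ℝ ∞ φ) (hψ : ContDiff ℝ ∞ ψ) (hk : ContDiff ℝ ∞ k) :
    ContDiff ℝ ∞ (fun y : ℝ × ℝ => φ y.1 * ψ (y.2 - k y.1)) :=
  (hφ.comp contDiff_fst).mul (hψ.comp (contDiff_snd.sub (hk.comp contDiff_fst)))

theorem hasDerivAt_of_smooth (hφ : ContDiff ℝ ∞ φ) (x : ℝ) : HasDerivAt φ (deriv φ x) x :=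
  ((hφ.differentiable (by simp)) x).hasDerivAt

theorem pderiv_one_sheared (hφ : ContDiff ℝ ∞ φ) (hψ : ContDiff ℝ ∞ ψ) (hk : ContDiff ℝ ∞ k)
    (y : ℝ × ℝ) : pderiv 1 (fun y : ℝ × ℝ => φ y.1 * ψ (y.2 - k y.1)) y =
      φ y.1 * deriv ψ (y.2 - k y.1) := by
  refine pderiv_one_eq ((contDiff_sheared hφ hψ hk).differentiable (by simp) y) ?_
  have := (hasDerivAt_of_smooth hψ (y.2 - k y.1)).comp y.2
    ((hasDerivAt_id y.2).sub_const (k y.1))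
  simpa [Function.comp_def] using this.const_mul (φ y.1)

theorem pderiv_zero_sheared (hφ : ContDiff ℝ ∞ φ) (hψ : ContDiff ℝ ∞ ψ) (hk : ContDiff ℝ ∞ k)
    (y : ℝ × ℝ) : pderiv 0 (fun y : ℝ × ℝ => φ y.1 * ψ (y.2 - k y.1)) y =
      deriv φ y.1 * ψ (y.2 - k y.1) - φ y.1 * deriv k y.1 * deriv ψ (y.2 - k y.1) := by
  refine pderiv_zero_eq ((contDiff_sheared hφ hψ hk).differentiable (by simp) y) ?_
  have h1 := (hasDerivAt_of_smooth hψ (y.2 - k y.1)).comp y.1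
    ((hasDerivAt_of_smooth hk y.1).const_sub y.2)
  have h2 : HasDerivAt (fun s => φ s * ψ (y.2 - k s)) _ y.1 :=
    (hasDerivAt_of_smooth hφ y.1).mul h1
  refine h2.congr_deriv ?_
  ring

theorem IsTest.exists_bound (hφ : IsTest p q φ) : ∃ C, 0 ≤ C ∧ ∀ x, |φ x| ≤ C := by
  obtain ⟨C, hC⟩ := hφ.continuous.bounded_above_of_compact_support hφ.2.1
  exact ⟨C, (norm_nonneg _).trans (hC 0), hC⟩

/-- Weak derivatives in the flattened coordinates, tested with products. -/
theorem weak_sheared (H : IsProfile Γ h) {f g₀ g₁ : ℝ × ℝ → ℝ} (w₀ : IsWeakPartial h 0 f g₀)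
    (w₁ : IsWeakPartial h 1 f g₁) (hpq : p < q) (hφ : IsTest p q φ) (hψ : IsTest 0 1 ψ) :
    (∫ y in strip h, f y * (φ y.1 * deriv ψ (y.2 - h y.1)) =
      -∫ y in strip h, g₁ y * (φ y.1 * ψ (y.2 - h y.1))) ∧
    ∫ y in strip h, f y * (deriv φ y.1 * ψ (y.2 - h y.1)) =
      -((∫ y in strip h, g₀ y * (φ y.1 * ψ (y.2 - h y.1))) +
        ∫ y in strip h, g₁ y * (deriv h y.1 * φ y.1 * ψ (y.2 - h y.1))) := by
  have hc := H.continuous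
  obtain ⟨r₁, r₂, hr1, hr, hr2, hψs⟩ := hψ.exists_Icc one_pos
  obtain ⟨x₁, x₂, -, hx, -, hφs⟩ := hφ.exists_Icc hpq
  set R := max |x₁| |x₂|
  have hφz : ∀ x, x ∉ Icc x₁ x₂ → φ x = 0 := fun x hx => by
    by_contra hn; exact hx (hφs (subset_tsupport _ hn))
  have hψz : ∀ x, x ∉ Icc r₁ r₂ → ψ x = 0 := fun x hx => by
    by_contra hn; exact hx (hψs (subset_tsupport _ hn))
  have hψz' : ∀ x, x ∉ Icc r₁ r₂ → deriv ψ x = 0 := fun x hx => by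
    by_contra hn; exact hx (hψs (support_deriv_subset hn))
  have hφz' : ∀ x, x ∉ Icc x₁ x₂ → deriv φ x = 0 := fun x hx => by
    by_contra hn; exact hx (hφs (support_deriv_subset hn))
  -- The function φ(y₁)ψ(y₂ - h(y₁)) is only C^{1,1}, hence not admissible in `IsWeakPartial`. It is
  -- replaced by φ(y₁)ψ(y₂ - k(y₁)) with k smooth and within ε of h over the support of φ. This ε
  -- keeps all these supports in one compact subset K of the strip.
  set ε := min r₁ (1 - r₂) / 2 with hε
  have hεp : 0 < ε := by
    have := lt_min hr1 (sub_pos.2 hr2)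
    simp only [hε]; linarith
  have hε1 : ε + ε ≤ r₁ := by have := min_le_left r₁ (1 - r₂); simp only [hε]; linarith
  have hε2 : r₂ + ε ≤ 1 - ε := by have := min_le_right r₁ (1 - r₂); simp only [hε]; linarith
  have hRx : ∀ x ∈ Icc x₁ x₂, |x| ≤ R := fun x hx => abs_le_max_abs_abs hx.1 hx.2
  have hR0 : 0 ≤ R := (abs_nonneg x₁).trans (le_max_left _ _)
  set K := shear h hc '' (Icc x₁ x₂ ×ˢ Icc ε (1 - ε))
  have hK : IsCompact K := (isCompact_Icc.prod isCompact_Icc).image (shear h hc).continuous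
  have hKs : K ⊆ strip h := by
    rw [image_subset_iff, shear_preimage_strip]
    exact prod_mono (subset_univ _) (Icc_subset_Ioo hεp (by linarith))
  have hmemK : ∀ y : ℝ × ℝ, y.1 ∈ Icc x₁ x₂ → y.2 - h y.1 ∈ Icc ε (1 - ε) → y ∈ K := by
    intro y h1 h2
    exact ⟨(y.1, y.2 - h y.1), ⟨h1, h2⟩, by rw [shear_apply]; simp⟩
  -- The factor R + 1 compensates the growth |x| of the error on the support of φ, and n + 1 makes
  -- the error tend to 0.
  have hk : ∀ n : ℕ, ∃ k : ℝ → ℝ, ContDiff ℝ ∞ k ∧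
      (∀ x, |deriv k x - deriv h x| ≤ ε / ((R + 1) * (n + 1))) ∧
      ∀ x, |k x - h x| ≤ ε / ((R + 1) * (n + 1)) * |x| := fun n =>
    H.exists_smooth_approx _ (by positivity)
  choose k hks hkd hkh using hk
  have hεn : ∀ n : ℕ, ε / ((R + 1) * (n + 1)) ≤ ε / (R + 1) := fun n => by
    refine div_le_div_of_nonneg_left hεp.le (by positivity) ?_
    have : (0 : ℝ) ≤ n := Nat.cast_nonneg n
    nlinarith
  have hkε : ∀ n, ∀ x ∈ Icc x₁ x₂, |k n x - h x| ≤ ε := by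
    intro n x hx
    refine (hkh n x).trans ((mul_le_mul (hεn n) (hRx x hx) (abs_nonneg _) (by positivity)).trans ?_)
    rw [div_mul_eq_mul_div, div_le_iff₀ (by positivity)]
    nlinarith
  have hlim0 : Tendsto (fun n : ℕ => ε / ((R + 1) * ((n : ℝ) + 1))) atTop (𝓝 0) := by
    have h1 := (tendsto_one_div_add_atTop_nhds_zero_nat (𝕜 := ℝ)).const_mul (ε / (R + 1))
    rw [mul_zero] at h1
    refine h1.congr fun n => ?_
    field_simp
  have hkl : ∀ x, Tendsto (fun n => k n x) atTop (𝓝 (h x)) := by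
    intro x
    rw [tendsto_iff_dist_tendsto_zero]
    refine squeeze_zero (fun _ => dist_nonneg) (fun n => hkh n x) ?_
    simpa using hlim0.mul_const |x|
  have hkdl : ∀ x, Tendsto (fun n => deriv (k n) x) atTop (𝓝 (deriv h x)) := by
    intro x
    rw [tendsto_iff_dist_tendsto_zero]
    exact squeeze_zero (fun _ => dist_nonneg) (fun n => hkd n x) hlim0
  have hzero : ∀ (c χ : ℝ → ℝ), (∀ x, x ∉ Icc x₁ x₂ → c x = 0) → (∀ x, x ∉ Icc r₁ r₂ → χ x = 0) →
      ∀ n y, y ∉ K → c y.1 * χ (y.2 - k n y.1) = 0 := by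
    intro c χ hc0 hχ0 n y hy
    by_cases h1 : y.1 ∈ Icc x₁ x₂
    · rw [hχ0, mul_zero]
      intro h2
      have h3 := abs_le.1 (hkε n y.1 h1)
      exact hy (hmemK y h1 ⟨by linarith [h2.1, h3.1, h3.2], by linarith [h2.2, h3.1, h3.2]⟩)
    · rw [hc0 _ h1, zero_mul]
  obtain ⟨Cφ, hCφ, hφb⟩ := hφ.exists_bound
  obtain ⟨Cφ', hCφ', hφb'⟩ := hφ.deriv.exists_bound
  obtain ⟨Cψ, hCψ, hψb⟩ := hψ.exists_bound
  obtain ⟨Cψ', hCψ', hψb'⟩ := hψ.deriv.exists_bound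
  have hψd : Continuous (deriv ψ) := hψ.deriv.continuous
  have hφd : Continuous (deriv φ) := hφ.deriv.continuous
  have hψc := hψ.continuous
  have hφc := hφ.continuous
  have hkc : ∀ n, Continuous (k n) := fun n => (hks n).continuous
  have hkdc : ∀ n, Continuous (deriv (k n)) := fun n =>
    (contDiff_infty_iff_deriv.1 (hks n)).2.continuous
  have htest : ∀ n, ∀ c : ℝ → ℝ, ContDiff ℝ ∞ c → (∀ x, x ∉ Icc x₁ x₂ → c x = 0) →
      HasCompactSupport (fun y : ℝ × ℝ => c y.1 * ψ (y.2 - k n y.1)) ∧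
      tsupport (fun y : ℝ × ℝ => c y.1 * ψ (y.2 - k n y.1)) ⊆ strip h := by
    intro n c hcs hc0
    have hsub : tsupport (fun y : ℝ × ℝ => c y.1 * ψ (y.2 - k n y.1)) ⊆ K := by
      refine closure_minimal (fun y hy => ?_) hK.isClosed
      by_contra hn
      exact hy (hzero c ψ hc0 hψz n y hn)
    exact ⟨HasCompactSupport.of_support_subset_isCompact hK ((subset_tsupport _).trans hsub),
      hsub.trans hKs⟩
  have hvert : ∀ n, ∀ c : ℝ → ℝ, ContDiff ℝ ∞ c → (∀ x, x ∉ Icc x₁ x₂ → c x = 0) →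
      ∫ y in strip h, f y * (c y.1 * deriv ψ (y.2 - k n y.1)) =
        -∫ y in strip h, g₁ y * (c y.1 * ψ (y.2 - k n y.1)) := by
    intro n c hcs hc0
    have := w₁.byParts _ (contDiff_sheared hcs hψ.1 (hks n)) (htest n c hcs hc0).1
      (htest n c hcs hc0).2
    simpa only [pderiv_one_sheared hcs hψ.1 (hks n)] using this
  have L : ∀ (g : ℝ × ℝ → ℝ), LocallyIntegrableOn g (strip h) → ∀ c χ : ℝ → ℝ,
      Continuous c → Continuous χ → (∀ x, x ∉ Icc x₁ x₂ → c x = 0) →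
      (∀ x, x ∉ Icc r₁ r₂ → χ x = 0) → ∀ C C', (∀ x, |c x| ≤ C) → (∀ x, |χ x| ≤ C') →
      Tendsto (fun n => ∫ y in strip h, g y * (c y.1 * χ (y.2 - k n y.1))) atTop
        (𝓝 (∫ y in strip h, g y * (c y.1 * χ (y.2 - h y.1)))) := by
    intro g hg c χ hcc hχc hc0 hχ0 C C' hC hC'
    refine tendsto_setIntegral_strip hg hc hK hKs (C := C * C') (fun n => ?_) (fun n y => ?_)
      (hzero c χ hc0 hχ0) (fun y => ?_)
    · have := hkc n
      fun_prop
    · rw [abs_mul]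
      exact mul_le_mul (hC _) (hC' _) (abs_nonneg _) ((abs_nonneg _).trans (hC y.1))
    · exact ((hχc.tendsto _).comp ((hkl y.1).const_sub y.2)).const_mul _
  have Lh : Tendsto (fun n => ∫ y in strip h, g₁ y * (deriv (k n) y.1 * φ y.1 * ψ (y.2 - k n y.1)))
      atTop (𝓝 (∫ y in strip h, g₁ y * (deriv h y.1 * φ y.1 * ψ (y.2 - h y.1)))) := by
    obtain ⟨D, hD⟩ := (isCompact_Icc (a := x₁) (b := x₂)).exists_bound_of_continuousOn
      H.continuous_deriv.continuousOn
    refine tendsto_setIntegral_strip w₁.locInt_deriv hc hK hKs (C := (|D| + ε) * Cφ * Cψ)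
      (fun n => ?_) (fun n y => ?_)
      (fun n => hzero (fun x => deriv (k n) x * φ x) ψ (fun x hx => by simp [hφz x hx]) hψz n)
      (fun y => ?_)
    · have := hkc n
      have := hkdc n
      fun_prop
    · rw [abs_mul, abs_mul]
      refine mul_le_mul ?_ (hψb _) (abs_nonneg _) (by positivity)
      by_cases hm : y.1 ∈ Icc x₁ x₂
      · refine mul_le_mul ?_ (hφb _) (abs_nonneg _) (by positivity)
        have h1 := (hkd n y.1).trans (hεn n)
        have h2 := hD y.1 hm
        have h3 := abs_sub_abs_le_abs_sub (deriv (k n) y.1) (deriv h y.1)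
        have h4 : ε / (R + 1) ≤ ε := div_le_self hεp.le (by linarith)
        rw [Real.norm_eq_abs] at h2
        linarith [le_abs_self D]
      · rw [hφz _ hm]; simp; positivity
    · exact ((hkdl y.1).mul_const _).mul ((hψc.tendsto _).comp ((hkl y.1).const_sub y.2))
  constructor
  · have h1 := L f w₁.locInt φ (deriv ψ) hφc hψd hφz hψz' Cφ Cψ' hφb hψb'
    have h2 := L g₁ w₁.locInt_deriv φ ψ hφc hψc hφz hψz Cφ Cψ hφb hψb
    simp only [hvert _ φ hφ.1 hφz] at h1
    exact tendsto_nhds_unique h1 h2.neg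
  · have h1 := L f w₁.locInt (deriv φ) ψ hφd hψc hφz' hψz Cφ' Cψ hφb' hψb
    have h2 := L g₀ w₀.locInt_deriv φ ψ hφc hψc hφz hψz Cφ Cψ hφb hψb
    have hint : ∀ n, ∀ c χ : ℝ → ℝ, Continuous c → Continuous χ →
        (∀ x, x ∉ Icc x₁ x₂ → c x = 0) → (∀ x, x ∉ Icc r₁ r₂ → χ x = 0) →
        IntegrableOn (fun y => f y * (c y.1 * χ (y.2 - k n y.1))) (strip h) := by
      intro n c χ hcc hχc hc0 hχ0
      have hfK : IntegrableOn f K := w₁.locInt.integrableOn_compact_subset hKs hK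
      have := hkc n
      refine (hfK.mul_continuousOn (g' := fun y : ℝ × ℝ => c y.1 * χ (y.2 - k n y.1))
        (by fun_prop) hK).of_forall_sdiff_eq_zero (isOpen_strip hc).measurableSet ?_
      intro y hy
      rw [hzero c χ hc0 hχ0 n y hy.2, mul_zero]
    have key : ∀ n, ∫ y in strip h, f y * (deriv φ y.1 * ψ (y.2 - k n y.1)) =
        -((∫ y in strip h, g₀ y * (φ y.1 * ψ (y.2 - k n y.1))) +
          ∫ y in strip h, g₁ y * (deriv (k n) y.1 * φ y.1 * ψ (y.2 - k n y.1))) := by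
      intro n
      have e1 := w₀.byParts _ (contDiff_sheared hφ.1 hψ.1 (hks n)) (htest n φ hφ.1 hφz).1
        (htest n φ hφ.1 hφz).2
      have hcs : ContDiff ℝ ∞ (fun x => deriv (k n) x * φ x) :=
        (contDiff_infty_iff_deriv.1 (hks n)).2.mul hφ.1
      have hc0 : ∀ x, x ∉ Icc x₁ x₂ → deriv (k n) x * φ x = 0 := fun x hx => by simp [hφz x hx]
      -- The chain rule for ∂₁ produces a term with ψ'. It is a vertical derivative with horizontal
      -- factor k'φ, so the vertical identity turns it into an integral against g₁.
      have e2 := hvert n _ hcs hc0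
      simp only [pderiv_zero_sheared hφ.1 hψ.1 (hks n)] at e1
      have hA := hint n (deriv φ) ψ hφd hψc hφz' hψz
      have hB := hint n (fun x => deriv (k n) x * φ x) (deriv ψ) hcs.continuous hψd hc0 hψz'
      have e3 : ∀ y : ℝ × ℝ, f y * (deriv φ y.1 * ψ (y.2 - k n y.1) -
          φ y.1 * deriv (k n) y.1 * deriv ψ (y.2 - k n y.1)) =
          f y * (deriv φ y.1 * ψ (y.2 - k n y.1)) -
          f y * (deriv (k n) y.1 * φ y.1 * deriv ψ (y.2 - k n y.1)) := fun y => by ring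
      simp only [e3] at e1
      rw [integral_sub hA hB] at e1
      linarith
    simp only [key] at h1
    exact tendsto_nhds_unique h1 (h2.add Lh).neg

end WeakFlat

end RayleighBenard

namespace RayleighBenard

/-! ### Derivatives along the lines of the flattened cell -/

/-- `G` is the vertical derivative of `F` along almost every line, and `bt`, `tp` are the boundary
values of `F` at `z = 0` and `z = 1`. -/
def HasDz (Γ : ℝ) (F G : ℝ × ℝ → ℝ) (bt tp : ℝ → ℝ) : Prop :=
  ∀ᵐ x ∂volume.restrict (Ioo 0 Γ), ACRep 0 1 (fun z => F (x, z)) (fun z => G (x, z)) (bt x) (tp x)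

/-- `G` is the horizontal derivative of the periodic function `F` along almost every line. -/
def HasDx (Γ : ℝ) (F G : ℝ × ℝ → ℝ) : Prop :=
  ∀ᵐ z ∂volume.restrict (Ioo 0 1), ∃ c, ACRep 0 Γ (fun x => F (x, z)) (fun x => G (x, z)) c c

section Lines

variable {Γ : ℝ} {h : ℝ → ℝ} {f g₀ g₁ : ℝ × ℝ → ℝ}

theorem trace_bot_eq {x α β : ℝ} {g : ℝ → ℝ} (H : ACRep 0 1 (fun z => flat h f (x, z)) g α β) :
    trace h .bot f x = α := by
  refine Tendsto.limUnder_eq (H.tendsto_average.congr fun δ => ?_)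
  simp [flat, Wall.height, Wall.sign]

theorem trace_top_eq {x α β : ℝ} {g : ℝ → ℝ} (H : ACRep 0 1 (fun z => flat h f (x, z)) g α β) :
    trace h .top f x = β := by
  refine Tendsto.limUnder_eq (H.tendsto_average_right.congr fun δ => ?_)
  congr 1
  refine intervalIntegral.integral_congr fun z _ => ?_
  simp only [flat, Wall.height, Wall.sign]
  congr 2
  ring

theorem locallyIntegrableOn_swap {F : ℝ × ℝ → ℝ} {s t : Set ℝ} (hs : IsOpen s) (ht : IsOpen t)
    (hF : LocallyIntegrableOn F (s ×ˢ t)) :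
    LocallyIntegrableOn (fun q => F q.swap) (t ×ˢ s) := by
  rw [locallyIntegrableOn_iff (ht.prod hs).isLocallyClosed]
  intro K hK hKc
  have h1 : IntegrableOn F (Prod.swap '' K) := by
    refine hF.integrableOn_compact_subset ?_ (hKc.image continuous_swap)
    rintro _ ⟨q, hq, rfl⟩
    exact ⟨(hK hq).2, (hK hq).1⟩
  have hmp : MeasurePreserving (Prod.swap : ℝ × ℝ → ℝ × ℝ) volume volume := by
    rw [Measure.volume_eq_prod]; exact Measure.measurePreserving_swap
  rw [← hmp.integrableOn_comp_preimage MeasurableEquiv.prodComm.measurableEmbedding,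
    Prod.swap_injective.preimage_image] at h1
  exact h1

theorem setIntegral_swap (F : ℝ × ℝ → ℝ) (s t : Set ℝ) :
    ∫ q in t ×ˢ s, F q.swap = ∫ q in s ×ˢ t, F q := by
  have hmp : MeasurePreserving (Prod.swap : ℝ × ℝ → ℝ × ℝ) volume volume := by
    rw [Measure.volume_eq_prod]; exact Measure.measurePreserving_swap
  rw [← hmp.setIntegral_preimage_emb MeasurableEquiv.prodComm.measurableEmbedding]
  congr 2
  ext q
  simp

theorem setIntegral_strip_test (hc : Continuous h) {p q : ℝ} {φ χ : ℝ → ℝ} (hφ : IsTest p q φ)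
    (f : ℝ × ℝ → ℝ) :
    ∫ y in strip h, f y * (φ y.1 * χ (y.2 - h y.1)) =
      ∫ r in Ioo p q ×ˢ Ioo 0 1, flat h f r * (φ r.1 * χ r.2) := by
  rw [setIntegral_strip hc]
  have : ∀ r : ℝ × ℝ, flat h (fun y => f y * (φ y.1 * χ (y.2 - h y.1))) r =
      flat h f r * (φ r.1 * χ r.2) := fun r => by simp [flat]
  simp only [this]
  refine setIntegral_eq_of_subset_of_forall_sdiff_eq_zero
    (MeasurableSet.univ.prod measurableSet_Ioo) (prod_mono (subset_univ _) le_rfl) ?_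
  rintro ⟨x, z⟩ ⟨⟨-, hz⟩, hn⟩
  have : φ x = 0 := by
    by_contra h0
    exact hn ⟨hφ.2.2 (subset_tsupport _ h0), hz⟩
  simp [this]

/-- A field with square-integrable weak derivatives has traces, and its vertical derivative is a
derivative along vertical lines. -/
theorem hasDz_of_weak (hΓ : 0 < Γ) (H : IsProfile Γ h) (w₀ : IsWeakPartial h 0 f g₀)
    (w₁ : IsWeakPartial h 1 f g₁) (hg : MemLp g₁ 2 (volume.restrict (cell Γ h))) :
    HasDz Γ (flat h f) (flat h g₁) (trace h .bot f) (trace h .top f) := by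
  have hc := H.continuous
  have hsub : Ioo 0 Γ ×ˢ Ioo (0 : ℝ) 1 ⊆ (univ : Set ℝ) ×ˢ Ioo (0 : ℝ) 1 :=
    prod_mono (subset_univ _) le_rfl
  have hF := locallyIntegrableOn_swap isOpen_Ioo isOpen_Ioo
    ((locallyIntegrableOn_flat hc w₁.locInt).mono_set hsub)
  have hG := locallyIntegrableOn_swap isOpen_Ioo isOpen_Ioo
    ((locallyIntegrableOn_flat hc w₁.locInt_deriv).mono_set hsub)
  have key := ae_slice_eq_integral (s₀ := 1 / 2) (by norm_num) hΓ hF hG (by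
    intro φ ψ hφ hψ
    have h1 := (weak_sheared H w₀ w₁ hΓ hψ hφ).1
    rw [setIntegral_strip_test hc hψ, setIntegral_strip_test hc hψ,
      ← setIntegral_swap (fun r => flat h f r * (ψ r.1 * deriv φ r.2)),
      ← setIntegral_swap (fun r => flat h g₁ r * (ψ r.1 * φ r.2))] at h1
    simpa only [Prod.fst_swap, Prod.snd_swap, mul_comm (ψ _)] using h1)
  have hgi : Integrable (flat h g₁) (cellMeasure Γ) :=
    (memLp_flat hc hg).integrable (by norm_num)
  filter_upwards [key, hgi.prod_right_ae] with x hx hxi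
  obtain ⟨-, α, hα⟩ := hx
  simp only [Prod.swap_prod_mk] at hα
  -- The slicing lemma gives only local integrability in (0, 1), whence the interior base point 1/2.
  -- Square integrability of g₁ over the cell makes it integrable up to both walls, so the base
  -- point moves to 0 and the boundary values exist.
  have hii : IntervalIntegrable (fun z => flat h g₁ (x, z)) volume 0 1 :=
    (intervalIntegrable_iff_integrableOn_Ioo_of_le zero_le_one).2 hxi
  have hac := ACRep.of_integral (f := fun z => flat h f (x, z))
    (α := α - ∫ z in (0 : ℝ)..(1 / 2), flat h g₁ (x, z)) one_pos hii (by
      filter_upwards [hα, ae_restrict_mem measurableSet_Ioo] with z hz hm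
      rw [hz]
      have hm1 : (1 / 2 : ℝ) ∈ uIcc (0 : ℝ) 1 := by rw [uIcc_of_le zero_le_one]; norm_num
      have hm2 : z ∈ uIcc (0 : ℝ) 1 := by
        rw [uIcc_of_le zero_le_one]; exact Ioo_subset_Icc_self hm
      rw [← intervalIntegral.integral_add_adjacent_intervals
        (hii.mono_set (uIcc_subset_uIcc left_mem_uIcc hm1))
        (hii.mono_set (uIcc_subset_uIcc hm1 hm2))]
      ring)
  rw [trace_bot_eq hac, trace_top_eq hac]
  exact hac

theorem flat_add_period (H : IsProfile Γ h) (f : ℝ × ℝ → ℝ) (q : ℝ × ℝ) :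
    flat h f (q.1 + Γ, q.2) = flat h (fun y => f (y.1 + Γ, y.2)) q := by
  simp [flat, H.periodic q.1]

/-- A periodic field with weak derivatives is differentiable along almost every curve parallel to
the walls. -/
theorem hasDx_of_weak (hΓ : 0 < Γ) (H : IsProfile Γ h) (w₀ : IsWeakPartial h 0 f g₀)
    (w₁ : IsWeakPartial h 1 f g₁)
    (hper : ∀ᵐ y ∂volume.restrict (strip h), f (y.1 + Γ, y.2) = f y) :
    HasDx Γ (flat h f) (fun q => flat h g₀ q + deriv h q.1 * flat h g₁ q) := by
  have hc := H.continuous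
  have hd := H.continuous_deriv
  have hsub : Ioo (-Γ) (2 * Γ) ×ˢ Ioo (0 : ℝ) 1 ⊆ (univ : Set ℝ) ×ˢ Ioo (0 : ℝ) 1 :=
    prod_mono (subset_univ _) le_rfl
  have ho : IsOpen (Ioo (-Γ) (2 * Γ) ×ˢ Ioo (0 : ℝ) 1) := isOpen_Ioo.prod isOpen_Ioo
  have hF := (locallyIntegrableOn_flat hc w₁.locInt).mono_set hsub
  have hG0 := (locallyIntegrableOn_flat hc w₀.locInt_deriv).mono_set hsub
  have hG1 := (locallyIntegrableOn_flat hc w₁.locInt_deriv).mono_set hsub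
  have hG1' : LocallyIntegrableOn (fun q : ℝ × ℝ => deriv h q.1 * flat h g₁ q)
      (Ioo (-Γ) (2 * Γ) ×ˢ Ioo (0 : ℝ) 1) :=
    hG1.continuousOn_mul (hd.comp continuous_fst).continuousOn ho.isLocallyClosed
  -- An interval longer than one period makes 0 and Γ interior points, where local integrability
  -- suffices.
  have key := ae_slice_eq_integral (s₀ := 0) (a := -Γ) (b := 2 * Γ) ⟨by linarith, by linarith⟩
    one_pos hF (hG0.add hG1') (by
    intro φ ψ hφ hψ
    have h1 := (weak_sheared H w₀ w₁ (by linarith) hφ hψ).2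
    have h2 := setIntegral_strip_test (χ := ψ) hc hφ (fun y => deriv h y.1 * g₁ y)
    have h3 : ∫ y in strip h, g₁ y * (deriv h y.1 * φ y.1 * ψ (y.2 - h y.1)) =
        ∫ y in strip h, deriv h y.1 * g₁ y * (φ y.1 * ψ (y.2 - h y.1)) := by
      congr 1; ext y; ring
    rw [h3, h2, setIntegral_strip_test hc hφ.deriv, setIntegral_strip_test hc hφ] at h1
    rw [h1]
    have hA := integrable_mul_test_mul_test hφ hψ hG0
    have hB := integrable_mul_test_mul_test hφ hψ hG1'
    rw [← restrict_prod_volume] at hA hB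
    have e : ∀ q : ℝ × ℝ, (flat h g₀ + fun q : ℝ × ℝ => deriv h q.1 * flat h g₁ q) q *
        (φ q.1 * ψ q.2) = flat h g₀ q * (φ q.1 * ψ q.2) +
          deriv h q.1 * flat h g₁ q * (φ q.1 * ψ q.2) := fun q => by
      simp only [Pi.add_apply]; ring
    simp only [e]
    rw [integral_add hA hB]
    rfl)
  have hperf : ∀ᵐ q ∂(volume.restrict (Ioo (0 : ℝ) Γ)).prod (volume.restrict (Ioo (0 : ℝ) 1)),
      flat h f (q.1 + Γ, q.2) = flat h f q := by
    have h1 := (measurePreserving_shear hc).restrict_preimage (isOpen_strip hc).measurableSet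
    rw [shear_preimage_strip] at h1
    have h2 := h1.quasiMeasurePreserving.ae hper
    rw [← restrict_prod_volume]
    refine ae_restrict_of_ae_restrict_of_subset (prod_mono (subset_univ _) le_rfl) ?_
    filter_upwards [h2] with q hq
    rw [flat_add_period H]; exact hq
  have hperz : ∀ᵐ z ∂volume.restrict (Ioo (0 : ℝ) 1), ∀ᵐ x ∂volume.restrict (Ioo (0 : ℝ) Γ),
      flat h f (x + Γ, z) = flat h f (x, z) := by
    have h1 := (Measure.measurePreserving_swap (μ := volume.restrict (Ioo (0 : ℝ) 1))
      (ν := volume.restrict (Ioo (0 : ℝ) Γ))).quasiMeasurePreserving.ae hperf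
    exact Measure.ae_ae_of_ae_prod h1
  filter_upwards [key, hperz] with z hz hpz
  obtain ⟨hGl, α, hα⟩ := hz
  set G : ℝ → ℝ := fun x => flat h g₀ (x, z) + deriv h x * flat h g₁ (x, z) with hGdef
  have hGl' : LocallyIntegrableOn G (Ioo (-Γ) (2 * Γ)) := hGl
  have hα' : ∀ᵐ s ∂volume.restrict (Ioo (-Γ) (2 * Γ)), flat h f (s, z) =
    α + ∫ σ in (0 : ℝ)..s, G σ := hα
  have hint : ∀ r, Γ ≤ r → r < 2 * Γ → IntervalIntegrable G volume 0 r := by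
    intro r hr1 hr2
    rw [intervalIntegrable_iff]
    refine (hGl'.integrableOn_compact_subset ?_ (isCompact_uIcc (a := (0 : ℝ)) (b := r))).mono_set
      uIoc_subset_uIcc
    rw [uIcc_of_le (by linarith)]
    exact Icc_subset_Ioo (by linarith) hr2
  have hac := ACRep.of_integral (f := fun x => flat h f (x, z)) (α := α) hΓ
    (hint Γ le_rfl (by linarith))
    (ae_restrict_of_ae_restrict_of_subset (Ioo_subset_Ioo (by linarith) (by linarith)) hα')
  have hI : ContinuousOn (fun x => ∫ σ in (0 : ℝ)..x, G σ) (Ico 0 (2 * Γ)) := by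
    intro x hx
    set r := max Γ ((x + 2 * Γ) / 2)
    have hr1 : Γ ≤ r := le_max_left _ _
    have hr2 : r < 2 * Γ := max_lt (by linarith) (by linarith [hx.2])
    have hxr : x < r := lt_of_lt_of_le (by linarith [hx.2]) (le_max_right _ _)
    have := ((hint r hr1 hr2).absolutelyContinuousOnInterval_intervalIntegral
      left_mem_uIcc).continuousOn
    rw [uIcc_of_le (by linarith)] at this
    refine (this x ⟨hx.1, hxr.le⟩).mono_of_mem_nhdsWithin ?_
    filter_upwards [self_mem_nhdsWithin, mem_nhdsWithin_of_mem_nhds (Iio_mem_nhds hxr)]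
      with y h1 h2 using ⟨h1.1, le_of_lt h2⟩
  -- Periodicity holds almost everywhere on the line, and continuity of the primitive extends it to
  -- x = 0. There it says that G has zero integral over a period, so the two end values agree.
  have hIeq : EqOn (fun x => ∫ σ in (0 : ℝ)..(x + Γ), G σ) (fun x => ∫ σ in (0 : ℝ)..x, G σ)
      (Ico 0 Γ) := by
    refine Measure.eqOn_of_ae_eq (μ := volume) ?_ ?_ (hI.mono (Ico_subset_Ico_right (by linarith)))
      (by rw [interior_Ico, closure_Ioo hΓ.ne]; exact Ico_subset_Icc_self)
    · rw [← restrict_Ioo_eq_restrict_Ico]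
      have ht : ∀ᵐ x ∂volume.restrict (Ioo 0 Γ), flat h f (x + Γ, z) =
          α + ∫ σ in (0 : ℝ)..(x + Γ), G σ := by
        rw [ae_restrict_iff' measurableSet_Ioo] at hα' ⊢
        have := (measurePreserving_add_right (volume : Measure ℝ) Γ).quasiMeasurePreserving.ae hα'
        filter_upwards [this] with x hx hm
        exact hx ⟨by linarith [hm.1], by linarith [hm.2]⟩
      filter_upwards [ht, hpz, ae_restrict_of_ae_restrict_of_subset
        (Ioo_subset_Ioo (by linarith) (by linarith)) hα'] with x h1 h2 h3
      rw [h2, h3] at h1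
      linarith
    · refine hI.comp (by fun_prop) ?_
      intro x hx
      exact ⟨by linarith [hx.1], by linarith [hx.2]⟩
  have h0 := hIeq (left_mem_Ico.2 hΓ)
  simp only [zero_add, intervalIntegral.integral_same] at h0
  rw [h0, add_zero] at hac
  exact ⟨α, hac⟩

/-- Weak derivatives of periodic functions are periodic. -/
theorem IsWeakPartial.periodic {i : Fin 2} {g : ℝ × ℝ → ℝ} (H : IsProfile Γ h)
    (w : IsWeakPartial h i f g) (hf : HPeriodic Γ f) :
    ∀ᵐ y ∂volume.restrict (strip h), g (y.1 + Γ, y.2) = g y := by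
  have hc := H.continuous
  have hst := isOpen_strip hc
  have hτ : ∀ y : ℝ × ℝ, (y.1 + Γ, y.2) = y + (Γ, 0) := fun y => by ext <;> simp
  have hmem : ∀ y, y + (Γ, 0) ∈ strip h ↔ y ∈ strip h := fun y => by
    rw [← hτ, mem_strip, mem_strip]; simp [H.periodic y.1]
  have hpre : (fun y : ℝ × ℝ => y + (Γ, 0)) ⁻¹' strip h = strip h := by ext y; exact hmem y
  have hmp : MeasurePreserving (fun y : ℝ × ℝ => y + (Γ, 0)) (volume.restrict (strip h))
      (volume.restrict (strip h)) := by
    have := (measurePreserving_add_right (volume : Measure (ℝ × ℝ)) (Γ, 0)).restrict_preimage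
      hst.measurableSet
    rwa [hpre] at this
  have hemb : MeasurableEmbedding (fun y : ℝ × ℝ => y + (Γ, 0)) :=
    (Homeomorph.addRight ((Γ, 0) : ℝ × ℝ)).measurableEmbedding
  have hgt : LocallyIntegrableOn (fun y => g (y + (Γ, 0))) (strip h) := by
    rw [locallyIntegrableOn_iff hst.isLocallyClosed]
    intro K hK hKc
    have h1 : IntegrableOn g ((fun y => y + (Γ, 0)) '' K) := by
      refine w.locInt_deriv.integrableOn_compact_subset ?_ (hKc.image (by fun_prop))
      rintro _ ⟨y, hy, rfl⟩
      exact (hmem y).2 (hK hy)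
    rw [← (measurePreserving_add_right (volume : Measure (ℝ × ℝ)) (Γ, 0)).integrableOn_comp_preimage
      hemb, hemb.injective.preimage_image] at h1
    exact h1
  rw [ae_restrict_iff' hst.measurableSet]
  have hz : ∀ᵐ y ∂(volume : Measure (ℝ × ℝ)), y ∈ strip h → g (y + (Γ, 0)) - g y = 0 := by
    refine hst.ae_eq_zero_of_integral_contDiff_smul_eq_zero (hgt.sub w.locInt_deriv) ?_
    intro φ hφ hφc hφs
    have hsm : ∫ y, φ y • (g (y + (Γ, 0)) - g y) =
        ∫ y in strip h, φ y • (g (y + (Γ, 0)) - g y) := by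
      refine (setIntegral_eq_integral_of_forall_compl_eq_zero fun y hy => ?_).symm
      have : φ y = 0 := by
        by_contra hn
        exact hy (hφs (subset_tsupport _ hn))
      simp [this]
    have hint : ∀ k : ℝ × ℝ → ℝ, LocallyIntegrableOn k (strip h) →
        IntegrableOn (fun y => k y * φ y) (strip h) := by
      intro k hk
      refine ((hk.integrableOn_compact_subset hφs hφc).mul_continuousOn
        hφ.continuous.continuousOn hφc).of_forall_sdiff_eq_zero hst.measurableSet ?_
      intro y hy
      have : φ y = 0 := by
        by_contra hn
        exact hy.2 (subset_tsupport _ hn)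
      simp [this]
    have e : ∀ y, φ y • (g (y + (Γ, 0)) - g y) = g (y + (Γ, 0)) * φ y - g y * φ y := fun y => by
      simp only [smul_eq_mul]; ring
    rw [hsm]
    simp only [e]
    rw [integral_sub (hint _ hgt) (hint _ w.locInt_deriv)]
    -- Testing with the translate of φ and changing variables gives the identity for the translate
    -- of g, because f is periodic.
    set φ' : ℝ × ℝ → ℝ := fun y => φ (y - (Γ, 0))
    have hφ'c : HasCompactSupport φ' :=
      hφc.comp_homeomorph (Homeomorph.subRight ((Γ, 0) : ℝ × ℝ))
    have hts : tsupport φ' ⊆ strip h := by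
      have h1 : tsupport φ' = (Homeomorph.subRight ((Γ, 0) : ℝ × ℝ)) ⁻¹' tsupport φ :=
        tsupport_comp_eq_preimage φ (Homeomorph.subRight ((Γ, 0) : ℝ × ℝ))
      rw [h1]
      intro y hy
      have := (hmem (y - (Γ, 0))).2 (hφs hy)
      simpa using this
    have h1 := w.byParts φ' (hφ.comp (contDiff_id.sub contDiff_const)) hφ'c hts
    have h2 := w.byParts φ hφ hφc hφs
    rw [← hmp.integral_comp hemb (fun y => f y * pderiv i φ' y),
      ← hmp.integral_comp hemb (fun y => g y * φ' y)] at h1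
    have hpd : ∀ y, pderiv i φ' (y + (Γ, 0)) = pderiv i φ y := by
      intro y
      simp only [pderiv, φ']
      rw [fderiv_comp_sub]; simp
    have hff : ∀ y, f (y + (Γ, 0)) = f y := fun y => by rw [← hτ]; exact hf y
    simp only [hpd, hff, φ', add_sub_cancel_right] at h1
    linarith
  filter_upwards [hz] with y hy hm
  rw [hτ]; linarith [hy hm]

end Lines

end RayleighBenard

namespace RayleighBenard

/-! ### Calculus on the flattened cell -/

section General

variable {X : Type*} [MeasurableSpace X] {μ : Measure X} {c f g : X → ℝ}

theorem memLp_bdd_mul (hc : AEStronglyMeasurable c μ) {C : ℝ} (hb : ∀ᵐ q ∂μ, |c q| ≤ C)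
    (hf : MemLp f 2 μ) : MemLp (fun q => c q * f q) 2 μ :=
  hf.mul' (memLp_top_of_bound hc C hb)

theorem integrable_mul_of_memLp (hf : MemLp f 2 μ) (hg : MemLp g 2 μ) :
    Integrable (fun q => f q * g q) μ :=
  hf.integrable_mul hg

end General

theorem ae_ae_of_ae_cell {Γ : ℝ} {p : ℝ × ℝ → Prop} (hp : ∀ᵐ q ∂cellMeasure Γ, p q) :
    ∀ᵐ x ∂volume.restrict (Ioo 0 Γ), ∀ᵐ z ∂volume.restrict (Ioo 0 1), p (x, z) :=
  Measure.ae_ae_of_ae_prod hp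

theorem ae_ae_of_ae_cell' {Γ : ℝ} {p : ℝ × ℝ → Prop} (hp : ∀ᵐ q ∂cellMeasure Γ, p q) :
    ∀ᵐ z ∂volume.restrict (Ioo 0 1), ∀ᵐ x ∂volume.restrict (Ioo 0 Γ), p (x, z) := by
  have h1 := (Measure.measurePreserving_swap (μ := volume.restrict (Ioo (0 : ℝ) 1))
    (ν := volume.restrict (Ioo (0 : ℝ) Γ))).quasiMeasurePreserving.ae hp
  exact Measure.ae_ae_of_ae_prod h1

/-- Passing from almost every slice to the product measure needs a measurable set; measurable
representatives of both sides supply it. -/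
theorem ae_prod_le_of_ae_ae_le {X Y : Type*} [MeasurableSpace X] [MeasurableSpace Y]
    {μ : Measure X} {ν : Measure Y} [SFinite μ] [SFinite ν] {k l : X × Y → ℝ}
    (hk : AEMeasurable k (μ.prod ν)) (hl : AEMeasurable l (μ.prod ν))
    (H : ∀ᵐ x ∂μ, ∀ᵐ y ∂ν, k (x, y) ≤ l (x, y)) : ∀ᵐ q ∂μ.prod ν, k q ≤ l q := by
  have h1 : ∀ᵐ q ∂μ.prod ν, hk.mk k q ≤ hl.mk l q := by
    rw [Measure.ae_prod_iff_ae_ae (measurableSet_le hk.measurable_mk hl.measurable_mk)]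
    filter_upwards [H, Measure.ae_ae_of_ae_prod hk.ae_eq_mk, Measure.ae_ae_of_ae_prod hl.ae_eq_mk]
      with x h1 h2 h3
    filter_upwards [h1, h2, h3] with y h1 h2 h3
    rwa [← h2, ← h3]
  filter_upwards [h1, hk.ae_eq_mk, hl.ae_eq_mk] with q h1 h2 h3
  rwa [h2, h3]

theorem ae_cell_le_of_ae_ae_le {Γ : ℝ} {k l : ℝ × ℝ → ℝ} (hk : AEMeasurable k (cellMeasure Γ))
    (hl : AEMeasurable l (cellMeasure Γ)) (H : ∀ᵐ z ∂volume.restrict (Ioo (0 : ℝ) 1),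
      ∀ᵐ x ∂volume.restrict (Ioo 0 Γ), k (x, z) ≤ l (x, z)) :
    ∀ᵐ q ∂cellMeasure Γ, k q ≤ l q := by
  have hs := Measure.measurePreserving_swap (μ := volume.restrict (Ioo (0 : ℝ) 1))
    (ν := volume.restrict (Ioo (0 : ℝ) Γ))
  have hs' := Measure.measurePreserving_swap (μ := volume.restrict (Ioo (0 : ℝ) Γ))
    (ν := volume.restrict (Ioo (0 : ℝ) 1))
  have h1 := ae_prod_le_of_ae_ae_le (k := k ∘ Prod.swap) (l := l ∘ Prod.swap)
    (AEMeasurable.comp_quasiMeasurePreserving hk hs.quasiMeasurePreserving)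
    (AEMeasurable.comp_quasiMeasurePreserving hl hs.quasiMeasurePreserving) H
  exact hs'.quasiMeasurePreserving.ae h1

theorem ae_cell_fst {Γ : ℝ} {p : ℝ → Prop} (hp : ∀ᵐ x ∂volume.restrict (Ioo 0 Γ), p x) :
    ∀ᵐ q ∂cellMeasure Γ, p q.1 :=
  Measure.quasiMeasurePreserving_fst.ae hp

theorem ae_cell_mem (Γ : ℝ) : ∀ᵐ q ∂cellMeasure Γ, q.1 ∈ Ioo 0 Γ ∧ q.2 ∈ Ioo (0 : ℝ) 1 := by
  rw [cellMeasure, ← restrict_prod_volume]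
  exact ae_restrict_mem (measurableSet_Ioo.prod measurableSet_Ioo)

section Lines

variable {Γ : ℝ} {F G F' G' : ℝ × ℝ → ℝ} {bt tp bt' tp' : ℝ → ℝ}

namespace HasDz

theorem congr_trace (H : HasDz Γ F G bt tp) (hb : ∀ᵐ x ∂volume.restrict (Ioo 0 Γ), bt x = bt' x)
    (ht : ∀ᵐ x ∂volume.restrict (Ioo 0 Γ), tp x = tp' x) : HasDz Γ F G bt' tp' := by
  filter_upwards [H, hb, ht] with x h1 h2 h3
  rwa [← h2, ← h3]

theorem add (H : HasDz Γ F G bt tp) (H' : HasDz Γ F' G' bt' tp') :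
    HasDz Γ (fun q => F q + F' q) (fun q => G q + G' q) (fun x => bt x + bt' x)
      (fun x => tp x + tp' x) := by
  filter_upwards [H, H'] with x h1 h2 using h1.add h2

theorem sub (H : HasDz Γ F G bt tp) (H' : HasDz Γ F' G' bt' tp') :
    HasDz Γ (fun q => F q - F' q) (fun q => G q - G' q) (fun x => bt x - bt' x)
      (fun x => tp x - tp' x) := by
  filter_upwards [H, H'] with x h1 h2 using h1.sub h2

theorem mul (H : HasDz Γ F G bt tp) (H' : HasDz Γ F' G' bt' tp') :
    HasDz Γ (fun q => F q * F' q) (fun q => G q * F' q + F q * G' q) (fun x => bt x * bt' x)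
      (fun x => tp x * tp' x) := by
  filter_upwards [H, H'] with x h1 h2 using h1.mul h2

theorem fst_mul (H : HasDz Γ F G bt tp) (c : ℝ → ℝ) :
    HasDz Γ (fun q => c q.1 * F q) (fun q => c q.1 * G q) (fun x => c x * bt x)
      (fun x => c x * tp x) := by
  filter_upwards [H] with x h1 using h1.const_mul (c x)

theorem comp {Φ Φ' : ℝ → ℝ} {K : NNReal} (H : HasDz Γ F G bt tp) (hL : LipschitzWith K Φ)
    (hΦ : ∀ s, HasDerivAt Φ (Φ' s) s) :
    HasDz Γ (fun q => Φ (F q)) (fun q => Φ' (F q) * G q) (fun x => Φ (bt x))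
      (fun x => Φ (tp x)) := by
  filter_upwards [H] with x h1 using h1.comp hL hΦ

theorem integrableOn_trace (H : HasDz Γ F G bt tp) (hG : Integrable G (cellMeasure Γ)) :
    IntegrableOn (fun x => tp x - bt x) (Ioo 0 Γ) := by
  refine hG.integral_prod_left.congr ?_
  filter_upwards [H] with x hx using hx.setIntegral_eq

theorem integral_eq (H : HasDz Γ F G bt tp) (hG : Integrable G (cellMeasure Γ)) :
    ∫ q, G q ∂cellMeasure Γ = ∫ x in Ioo 0 Γ, (tp x - bt x) := by
  rw [cellMeasure, integral_prod _ hG]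
  refine integral_congr_ae ?_
  filter_upwards [H] with x hx using hx.setIntegral_eq

end HasDz

namespace HasDx

theorem congr (H : HasDx Γ F G) (hF : ∀ᵐ q ∂cellMeasure Γ, F' q = F q)
    (hG : ∀ᵐ q ∂cellMeasure Γ, G' q = G q) : HasDx Γ F' G' := by
  filter_upwards [H, ae_ae_of_ae_cell' hF, ae_ae_of_ae_cell' hG] with x h1 h2 h3
  exact h1.imp fun _ h => h.congr h2 h3

theorem add (H : HasDx Γ F G) (H' : HasDx Γ F' G') :
    HasDx Γ (fun q => F q + F' q) (fun q => G q + G' q) := by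
  filter_upwards [H, H'] with x h1 h2
  obtain ⟨c, h1⟩ := h1
  obtain ⟨c', h2⟩ := h2
  exact ⟨_, h1.add h2⟩

theorem mul (H : HasDx Γ F G) (H' : HasDx Γ F' G') :
    HasDx Γ (fun q => F q * F' q) (fun q => G q * F' q + F q * G' q) := by
  filter_upwards [H, H'] with x h1 h2
  obtain ⟨c, h1⟩ := h1
  obtain ⟨c', h2⟩ := h2
  exact ⟨_, h1.mul h2⟩

theorem comp {Φ Φ' : ℝ → ℝ} {K : NNReal} (H : HasDx Γ F G) (hL : LipschitzWith K Φ)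
    (hΦ : ∀ s, HasDerivAt Φ (Φ' s) s) :
    HasDx Γ (fun q => Φ (F q)) (fun q => Φ' (F q) * G q) := by
  filter_upwards [H] with x h1
  obtain ⟨c, h1⟩ := h1
  exact ⟨_, h1.comp hL hΦ⟩

theorem of_fst {f g : ℝ → ℝ} {K : NNReal} (hΓ : 0 < Γ) (hL : LipschitzWith K f)
    (hp : f 0 = f Γ) (hd : ∀ᵐ x ∂volume.restrict (Ioo 0 Γ), HasDerivAt f (g x) x) :
    HasDx Γ (fun q => f q.1) (fun q => g q.1) := by
  refine ae_of_all _ fun z => ⟨f 0, ?_⟩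
  have := ACRep.of_lipschitz hΓ hL hd
  rwa [← hp] at this

theorem of_snd (hΓ : 0 < Γ) (f : ℝ → ℝ) : HasDx Γ (fun q => f q.2) (fun _ => 0) :=
  ae_of_all _ fun z => ⟨f z, ACRep.const hΓ (f z)⟩

theorem snd_mul (hΓ : 0 < Γ) (H : HasDx Γ F G) (f : ℝ → ℝ) :
    HasDx Γ (fun q => f q.2 * F q) (fun q => f q.2 * G q) :=
  ((of_snd hΓ f).mul H).congr (by simp) (by simp)

theorem integral_eq_zero (H : HasDx Γ F G) (hG : Integrable G (cellMeasure Γ)) :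
    ∫ q, G q ∂cellMeasure Γ = 0 := by
  rw [cellMeasure, integral_prod_symm _ hG]
  refine integral_eq_zero_of_ae ?_
  filter_upwards [H] with z hz
  obtain ⟨c, hc⟩ := hz
  rw [hc.setIntegral_eq, sub_self]; rfl

end HasDx

end Lines

/-! ### Fields with square-integrable gradient: products, Green's formula, boundedness -/

/-- A periodic function on the flattened cell with square-integrable gradient `(g₀, g₁)` in the
original coordinates, and boundary values `bt`, `tp`. -/
structure H1 (Γ : ℝ) (h : ℝ → ℝ) (f g₀ g₁ : ℝ × ℝ → ℝ) (bt tp : ℝ → ℝ) : Prop where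
  mem : MemLp f 2 (cellMeasure Γ)
  mem₀ : MemLp g₀ 2 (cellMeasure Γ)
  mem₁ : MemLp g₁ 2 (cellMeasure Γ)
  dx : HasDx Γ f (fun q => g₀ q + deriv h q.1 * g₁ q)
  dz : HasDz Γ f g₁ bt tp

section H1

variable {Γ : ℝ} {h : ℝ → ℝ}

theorem IsProfile.exists_deriv_bound (H : IsProfile Γ h) :
    ∃ D, ∀ᵐ q ∂cellMeasure Γ, |deriv h q.1| ≤ D := by
  obtain ⟨D, hD⟩ := (isCompact_Icc (a := (0 : ℝ)) (b := Γ)).exists_bound_of_continuousOn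
    H.continuous_deriv.continuousOn
  refine ⟨D, ?_⟩
  filter_upwards [ae_cell_mem Γ] with q hq using hD q.1 (Ioo_subset_Icc_self hq.1)

theorem IsProfile.memLp_deriv_mul (H : IsProfile Γ h) {f : ℝ × ℝ → ℝ}
    (hf : MemLp f 2 (cellMeasure Γ)) : MemLp (fun q => deriv h q.1 * f q) 2 (cellMeasure Γ) := by
  obtain ⟨D, hD⟩ := H.exists_deriv_bound
  exact memLp_bdd_mul (H.continuous_deriv.comp continuous_fst).aestronglyMeasurable hD hf

variable {f f₀ f₁ g₀ g₁ g₀₀ g₁₀ g₀₁ g₁₁ φ φ₀ φ₁ : ℝ × ℝ → ℝ}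
  {bf tf b₀ t₀ b₁ t₁ bφ tφ : ℝ → ℝ}

theorem H1.congr_trace {bt tp : ℝ → ℝ} (H : H1 Γ h f f₀ f₁ bf tf)
    (hb : ∀ᵐ x ∂volume.restrict (Ioo 0 Γ), bf x = bt x)
    (ht : ∀ᵐ x ∂volume.restrict (Ioo 0 Γ), tf x = tp x) : H1 Γ h f f₀ f₁ bt tp :=
  ⟨H.mem, H.mem₀, H.mem₁, H.dx, H.dz.congr_trace hb ht⟩

theorem H1.comp {Φ Φ' : ℝ → ℝ} {K : NNReal} (H : H1 Γ h f f₀ f₁ bf tf) (hL : LipschitzWith K Φ)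
    (hΦ : ∀ s, HasDerivAt Φ (Φ' s) s) (hc : Continuous Φ') :
    H1 Γ h (fun q => Φ (f q)) (fun q => Φ' (f q) * f₀ q) (fun q => Φ' (f q) * f₁ q)
      (fun x => Φ (bf x)) (fun x => Φ (tf x)) := by
  have hm : AEStronglyMeasurable (fun q => Φ' (f q)) (cellMeasure Γ) :=
    hc.comp_aestronglyMeasurable H.mem.1
  have hb : ∀ᵐ q ∂cellMeasure Γ, |Φ' (f q)| ≤ K := ae_of_all _ fun q => by
    rw [← (hΦ (f q)).deriv]; exact norm_deriv_le_of_lipschitz hL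
  have h1 : MemLp (fun q => |Φ 0| + K * |f q|) 2 (cellMeasure Γ) :=
    MemLp.add (memLp_const |Φ 0|) (MemLp.const_mul (MemLp.abs H.mem) (K : ℝ))
  have h2 : MemLp (fun q => Φ (f q)) 2 (cellMeasure Γ) := by
    refine h1.mono' (hL.continuous.comp_aestronglyMeasurable H.mem.1) (ae_of_all _ fun q => ?_)
    have h2 := hL.dist_le_mul (f q) 0
    rw [Real.dist_eq, Real.dist_eq, sub_zero] at h2
    have h3 := abs_sub_abs_le_abs_sub (Φ (f q)) (Φ 0)
    rw [Real.norm_eq_abs]; linarith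
  have h3 := H.dx.comp hL hΦ
  refine ⟨h2, memLp_bdd_mul hm hb H.mem₀, memLp_bdd_mul hm hb H.mem₁, ?_, H.dz.comp hL hΦ⟩
  refine h3.congr (ae_of_all _ fun q => rfl) (ae_of_all _ fun q => ?_)
  ring

theorem H1.mul {C C' : ℝ} (H : H1 Γ h f f₀ f₁ bf tf) (H' : H1 Γ h φ φ₀ φ₁ bφ tφ)
    (hf : ∀ᵐ q ∂cellMeasure Γ, |f q| ≤ C) (hφ : ∀ᵐ q ∂cellMeasure Γ, |φ q| ≤ C') :
    H1 Γ h (fun q => f q * φ q) (fun q => f₀ q * φ q + f q * φ₀ q)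
      (fun q => f₁ q * φ q + f q * φ₁ q) (fun x => bf x * bφ x) (fun x => tf x * tφ x) := by
  have h1 : ∀ k : ℝ × ℝ → ℝ, MemLp k 2 (cellMeasure Γ) →
      MemLp (fun q => k q * φ q) 2 (cellMeasure Γ) := fun k hk => by
    simpa only [mul_comm] using memLp_bdd_mul H'.mem.1 hφ hk
  refine ⟨h1 f H.mem, (h1 _ H.mem₀).add (memLp_bdd_mul H.mem.1 hf H'.mem₀),
    (h1 _ H.mem₁).add (memLp_bdd_mul H.mem.1 hf H'.mem₁),
    (H.dx.mul H'.dx).congr (by simp) (ae_of_all _ fun q => by ring), H.dz.mul H'.dz⟩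

/-- Green's formula. -/
theorem H1.green (hp : IsProfile Γ h) (H₀ : H1 Γ h g₀ g₀₀ g₁₀ b₀ t₀) (H₁ : H1 Γ h g₁ g₀₁ g₁₁ b₁ t₁)
    (H : H1 Γ h φ φ₀ φ₁ bφ tφ) :
    IntegrableOn (fun x => (t₁ x - deriv h x * t₀ x) * tφ x - (b₁ x - deriv h x * b₀ x) * bφ x)
      (Ioo 0 Γ) ∧
    (∫ q, (g₀₀ q + g₁₁ q) * φ q ∂cellMeasure Γ) +
      ∫ q, (g₀ q * φ₀ q + g₁ q * φ₁ q) ∂cellMeasure Γ =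
    ∫ x in Ioo 0 Γ, ((t₁ x - deriv h x * t₀ x) * tφ x - (b₁ x - deriv h x * b₀ x) * bφ x) := by
  have hx := H₀.dx.mul H.dx
  -- In flattened coordinates the divergence of (g₀, g₁) is ∂ₓg₀ + ∂_z(g₁ - h'g₀). The x-part
  -- integrates to zero by periodicity, and the z-part leaves the wall values of g₁ - h'g₀, the
  -- unnormalised normal component.
  have hz := (H₁.dz.sub (H₀.dz.fst_mul (deriv h))).mul H.dz
  have m : ∀ {k l : ℝ × ℝ → ℝ}, MemLp k 2 (cellMeasure Γ) → MemLp l 2 (cellMeasure Γ) →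
    Integrable (fun q => k q * l q) (cellMeasure Γ) := fun hk hl => integrable_mul_of_memLp hk hl
  have ix := (m (H₀.mem₀.add (hp.memLp_deriv_mul H₀.mem₁)) H.mem).add
    (m H₀.mem (H.mem₀.add (hp.memLp_deriv_mul H.mem₁)))
  have iz := (m (H₁.mem₁.sub (hp.memLp_deriv_mul H₀.mem₁)) H.mem).add
    (m (H₁.mem.sub (hp.memLp_deriv_mul H₀.mem)) H.mem₁)
  refine ⟨hz.integrableOn_trace iz, ?_⟩
  have e0 := integral_add (m (H₀.mem₀.add H₁.mem₁) H.mem)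
    ((m H₀.mem H.mem₀).add (m H₁.mem H.mem₁))
  have e1 := hz.integral_eq iz
  have e2 := hx.integral_eq_zero ix
  have e3 := integral_add ix iz
  simp only [Pi.add_apply, Pi.sub_apply] at e0 e3
  rw [e2, zero_add, e1] at e3
  rw [← e0, ← e3]
  refine integral_congr_ae (ae_of_all _ fun q => ?_)
  ring

/-- A divergence-free field tangent to the walls is orthogonal to gradients. -/
theorem H1.advection {u v u₀ u₁ v₀ v₁ : ℝ × ℝ → ℝ} {bu tu bv tv : ℝ → ℝ} (hp : IsProfile Γ h)
    (Hu : H1 Γ h u u₀ u₁ bu tu) (Hv : H1 Γ h v v₀ v₁ bv tv)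
    (hdiv : ∀ᵐ q ∂cellMeasure Γ, u₀ q + v₁ q = 0)
    (hb : ∀ᵐ x ∂volume.restrict (Ioo 0 Γ), bv x - deriv h x * bu x = 0)
    (ht : ∀ᵐ x ∂volume.restrict (Ioo 0 Γ), tv x - deriv h x * tu x = 0)
    (H : H1 Γ h f f₀ f₁ bf tf) : ∫ q, (u q * f₀ q + v q * f₁ q) ∂cellMeasure Γ = 0 := by
  have hx := Hu.dx.mul H.dx
  have hz := (Hv.dz.sub (Hu.dz.fst_mul (deriv h))).mul H.dz
  have m : ∀ {k l : ℝ × ℝ → ℝ}, MemLp k 2 (cellMeasure Γ) → MemLp l 2 (cellMeasure Γ) →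
    Integrable (fun q => k q * l q) (cellMeasure Γ) := fun hk hl => integrable_mul_of_memLp hk hl
  have ix := (m (Hu.mem₀.add (hp.memLp_deriv_mul Hu.mem₁)) H.mem).add
    (m Hu.mem (H.mem₀.add (hp.memLp_deriv_mul H.mem₁)))
  have iz := (m (Hv.mem₁.sub (hp.memLp_deriv_mul Hu.mem₁)) H.mem).add
    (m (Hv.mem.sub (hp.memLp_deriv_mul Hu.mem)) H.mem₁)
  have h0 : ∫ x in Ioo 0 Γ, ((tv x - deriv h x * tu x) * tf x - (bv x - deriv h x * bu x) * bf x)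
      = 0 := by
    refine integral_eq_zero_of_ae ?_
    filter_upwards [hb, ht] with x h1 h2
    simp [h1, h2]
  have e1 := (hz.integral_eq iz).trans h0
  have e2 := hx.integral_eq_zero ix
  have e3 := integral_add ix iz
  simp only [Pi.add_apply, Pi.sub_apply] at e3
  rw [e2, e1, add_zero] at e3
  rw [← e3]
  refine integral_congr_ae ?_
  filter_upwards [hdiv] with q hq
  have : v₁ q = - u₀ q := by linarith
  rw [this]; ring

/-- Functions with `H²` regularity are bounded. -/
theorem H1.exists_bound (hp : IsProfile Γ h) (H : H1 Γ h f g₀ g₁ bf tf)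
    (H₀ : H1 Γ h g₀ g₀₀ g₁₀ b₀ t₀) (H₁ : H1 Γ h g₁ g₀₁ g₁₁ b₁ t₁) :
    ∃ C, ∀ᵐ q ∂cellMeasure Γ, |f q| ≤ C := by
  -- The one-dimensional embedding is used twice. In z it dominates f and ∂ₓf by integrable
  -- functions of x alone; in x it then bounds f by integrals that no longer depend on z.
  have key : ∀ {k l : ℝ × ℝ → ℝ} {b t : ℝ → ℝ}, MemLp k 2 (cellMeasure Γ) →
      MemLp l 2 (cellMeasure Γ) → HasDz Γ k l b t → ∃ B : ℝ → ℝ, IntegrableOn B (Ioo 0 Γ) ∧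
        ∀ᵐ q ∂cellMeasure Γ, |k q| ≤ B q.1 := by
    intro k l b t hk hl hd
    have ik : Integrable (fun q => |k q|) (cellMeasure Γ) := (hk.integrable (by norm_num)).abs
    have il : Integrable (fun q => |l q|) (cellMeasure Γ) := (hl.integrable (by norm_num)).abs
    have iB : IntegrableOn (fun x => (∫ z in Ioo (0 : ℝ) 1, |k (x, z)|) +
        ∫ z in Ioo (0 : ℝ) 1, |l (x, z)|) (Ioo 0 Γ) :=
      ik.integral_prod_left.add il.integral_prod_left
    refine ⟨_, iB, ?_⟩
    refine ae_prod_le_of_ae_ae_le ik.aemeasurable (iB.aemeasurable.comp_quasiMeasurePreserving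
      Measure.quasiMeasurePreserving_fst) ?_
    filter_upwards [hd] with x hx
    filter_upwards [hx.abs_le_of_integral] with z hz
    simpa using hz
  have hdx := H₀.dz.add (H₁.dz.fst_mul (deriv h))
  obtain ⟨B, hB, hBf⟩ := key H.mem H.mem₁ H.dz
  obtain ⟨B', hB', hBf'⟩ := key (H₀.mem.add (hp.memLp_deriv_mul H₁.mem))
    (H₀.mem₁.add (hp.memLp_deriv_mul H₁.mem₁)) hdx
  refine ⟨(Γ - 0)⁻¹ * (∫ x in Ioo 0 Γ, B x) + ∫ x in Ioo 0 Γ, B' x, ?_⟩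
  refine ae_cell_le_of_ae_ae_le H.mem.abs.1.aemeasurable aemeasurable_const ?_
  have i1 : Integrable f (cellMeasure Γ) := H.mem.integrable (by norm_num)
  have i2 : Integrable (fun q => g₀ q + deriv h q.1 * g₁ q) (cellMeasure Γ) :=
    (H₀.mem.add (hp.memLp_deriv_mul H₁.mem)).integrable (by norm_num)
  filter_upwards [H.dx, ae_ae_of_ae_cell' hBf, ae_ae_of_ae_cell' hBf', i1.prod_left_ae,
    i2.prod_left_ae] with z hz h1 h2 i1 i2
  obtain ⟨c, hc⟩ := hz
  have e1 := integral_mono_ae i1.abs hB h1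
  have e2 := integral_mono_ae i2.abs hB' h2
  filter_upwards [hc.abs_le_of_integral] with x hx
  have hΓ : 0 < Γ := hc.1
  refine hx.trans (add_le_add (mul_le_mul_of_nonneg_left e1 (by simp [hΓ.le])) e2)

end H1

end RayleighBenard

namespace RayleighBenard

/-! ### Cut-off functions and tangential derivatives at the walls -/

/-- The cut-off `(1 - z/δ)₊` of the layer `0 < z < δ`. -/
noncomputable def cutoff (δ z : ℝ) : ℝ := max (1 - z / δ) 0

/-- The derivative of `cutoff δ`. -/
noncomputable def cutoff' (δ z : ℝ) : ℝ := if z < δ then -δ⁻¹ else 0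

section Cutoff

variable {δ : ℝ}

theorem cutoff_nonneg (δ z : ℝ) : 0 ≤ cutoff δ z := le_max_right _ _

theorem cutoff_le_one (hδ : 0 < δ) {z : ℝ} (hz : 0 ≤ z) : cutoff δ z ≤ 1 :=
  max_le (by have := div_nonneg hz hδ.le; linarith) zero_le_one

theorem cutoff_zero (δ : ℝ) : cutoff δ 0 = 1 := by simp [cutoff]

theorem cutoff_eq_zero (hδ : 0 < δ) {z : ℝ} (hz : δ ≤ z) : cutoff δ z = 0 :=
  max_eq_right (by rw [sub_nonpos, le_div_iff₀ hδ]; linarith)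

theorem cutoff_lipschitz (hδ : 0 < δ) : LipschitzWith (Real.toNNReal δ⁻¹) (cutoff δ) := by
  have h1 : LipschitzWith (Real.toNNReal δ⁻¹) (fun z : ℝ => 1 - z / δ) := by
    refine LipschitzWith.of_dist_le_mul fun x y => ?_
    rw [Real.dist_eq, Real.dist_eq, Real.coe_toNNReal _ (inv_nonneg.2 hδ.le),
      show 1 - x / δ - (1 - y / δ) = δ⁻¹ * (y - x) by ring, abs_mul, abs_of_pos (inv_pos.2 hδ),
      abs_sub_comm]
  exact h1.max_const 0

theorem cutoff_continuous (hδ : 0 < δ) : Continuous (cutoff δ) := (cutoff_lipschitz hδ).continuous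

theorem cutoff_hasDerivAt (hδ : 0 < δ) {z : ℝ} (hz : z ≠ δ) :
    HasDerivAt (cutoff δ) (cutoff' δ z) z := by
  rcases lt_or_gt_of_ne hz with h | h
  · have h1 : HasDerivAt (fun z : ℝ => 1 - z / δ) (-δ⁻¹) z := by
      have := ((hasDerivAt_id' z).div_const δ).const_sub 1
      simpa using this
    rw [cutoff', if_pos h]
    refine h1.congr_of_eventuallyEq ?_
    filter_upwards [Iio_mem_nhds h] with y hy
    exact max_eq_left (by rw [sub_nonneg, div_le_one hδ]; exact le_of_lt hy)
  · rw [cutoff', if_neg h.le.not_gt]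
    refine (hasDerivAt_const z (0 : ℝ)).congr_of_eventuallyEq ?_
    filter_upwards [Ioi_mem_nhds h] with y hy using cutoff_eq_zero hδ (le_of_lt hy)

theorem ae_ne_restrict (c : ℝ) (s : Set ℝ) : ∀ᵐ z ∂volume.restrict s, z ≠ c :=
  ae_restrict_of_ae (by simp [ae_iff, measure_singleton])

theorem cutoff_ae_hasDerivAt (hδ : 0 < δ) (s : Set ℝ) :
    ∀ᵐ z ∂volume.restrict s, HasDerivAt (cutoff δ) (cutoff' δ z) z := by
  filter_upwards [ae_ne_restrict δ s] with z hz using cutoff_hasDerivAt hδ hz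

theorem measurable_cutoff' (δ : ℝ) : Measurable (cutoff' δ) :=
  Measurable.ite measurableSet_Iio measurable_const measurable_const

theorem abs_cutoff'_le (hδ : 0 < δ) (z : ℝ) : |cutoff' δ z| ≤ δ⁻¹ := by
  rw [cutoff']
  split_ifs
  · rw [abs_neg, abs_of_pos (inv_pos.2 hδ)]
  · simp [hδ.le]

end Cutoff

/-! ### Functions of z, and tangential derivatives of traces -/

section Vertical

variable {Γ : ℝ} {h : ℝ → ℝ}

theorem HasDz.of_snd {c c' : ℝ → ℝ} {K : NNReal} (hL : LipschitzWith K c)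
    (hd : ∀ᵐ z ∂volume.restrict (Ioo (0 : ℝ) 1), HasDerivAt c (c' z) z) :
    HasDz Γ (fun q => c q.2) (fun q => c' q.2) (fun _ => c 0) (fun _ => c 1) :=
  ae_of_all _ fun _ => ACRep.of_lipschitz one_pos hL hd

theorem memLp_two_of_bound {f : ℝ × ℝ → ℝ} (hf : AEStronglyMeasurable f (cellMeasure Γ)) (C : ℝ)
    (hb : ∀ᵐ q ∂cellMeasure Γ, |f q| ≤ C) : MemLp f 2 (cellMeasure Γ) :=
  MemLp.of_bound hf C hb

/-- Functions of `z = y₂ - h y₁`. -/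
theorem H1.of_snd (hΓ : 0 < Γ) (hp : IsProfile Γ h) {c c' : ℝ → ℝ} {K : NNReal} {M : ℝ}
    (hL : LipschitzWith K c) (hm : Measurable c') (hM : ∀ z, |c' z| ≤ M)
    (hd : ∀ᵐ z ∂volume.restrict (Ioo (0 : ℝ) 1), HasDerivAt c (c' z) z) :
    H1 Γ h (fun q => c q.2) (fun q => - (deriv h q.1 * c' q.2)) (fun q => c' q.2)
      (fun _ => c 0) (fun _ => c 1) := by
  have h1 : MemLp (fun q : ℝ × ℝ => c' q.2) 2 (cellMeasure Γ) :=
    memLp_two_of_bound (hm.comp measurable_snd).aestronglyMeasurable M (ae_of_all _ fun q => hM _)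
  have h2 := hL.continuous
  obtain ⟨C, hC⟩ := (isCompact_Icc (a := (0 : ℝ)) (b := 1)).exists_bound_of_continuousOn
    h2.continuousOn
  refine ⟨memLp_two_of_bound (h2.comp continuous_snd).aestronglyMeasurable C ?_,
    (hp.memLp_deriv_mul h1).neg, h1, ?_, HasDz.of_snd hL hd⟩
  · filter_upwards [ae_cell_mem Γ] with q hq using hC q.2 (Ioo_subset_Icc_self hq.2)
  · exact (HasDx.of_snd hΓ c).congr (by simp) (by simp)

/-- Integrating the z-derivative controls only the difference of the two traces; a factor equal to 1
at the bottom and 0 at the top isolates one of them. -/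
theorem HasDz.integrableOn_bot {F G : ℝ × ℝ → ℝ} {bt tp : ℝ → ℝ} (H : HasDz Γ F G bt tp)
    (hF : Integrable F (cellMeasure Γ)) (hG : Integrable G (cellMeasure Γ)) :
    IntegrableOn bt (Ioo 0 Γ) := by
  have h1 := H.mul (HasDz.of_snd (c := cutoff 1) (cutoff_lipschitz one_pos)
    (cutoff_ae_hasDerivAt one_pos _))
  have hb : ∀ᵐ q ∂cellMeasure Γ, ‖cutoff 1 q.2‖ ≤ 1 := by
    filter_upwards [ae_cell_mem Γ] with q hq
    rw [Real.norm_eq_abs, abs_of_nonneg (cutoff_nonneg _ _)]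
    exact cutoff_le_one one_pos hq.2.1.le
  have i1 := hG.mul_bdd
    ((cutoff_continuous one_pos).comp continuous_snd).aestronglyMeasurable hb
  have i2 := hF.mul_bdd (c := (1 : ℝ)⁻¹) ((measurable_cutoff' 1).comp measurable_snd).aestronglyMeasurable
    (ae_of_all _ fun q => abs_cutoff'_le one_pos q.2)
  have h2 := h1.integrableOn_trace (i1.add i2)
  simpa [cutoff_zero, cutoff_eq_zero] using h2.neg

variable {F Fx Fz Fxz : ℝ × ℝ → ℝ} {bt tp d e : ℝ → ℝ}

/-- The identity behind `∂ₓ` commuting with the trace, tested with `φ(x) c(z)`. -/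
theorem trace_commute (hΓ : 0 < Γ) (hx : HasDx Γ F Fx) (hz : HasDz Γ F Fz bt tp) (hxz : HasDz Γ Fx Fxz d e)
    (iF : Integrable F (cellMeasure Γ)) (iFx : Integrable Fx (cellMeasure Γ))
    (iFz : Integrable Fz (cellMeasure Γ)) (iFxz : Integrable Fxz (cellMeasure Γ))
    {φ c c' : ℝ → ℝ} (hφ : IsTest 0 Γ φ) {K : NNReal} {M : ℝ} (hL : LipschitzWith K c)
    (hm : Measurable c') (hM : ∀ z, |c' z| ≤ M)
    (hd : ∀ᵐ z ∂volume.restrict (Ioo (0 : ℝ) 1), HasDerivAt c (c' z) z) :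
    ∫ q, c q.2 * (Fxz q * φ q.1 + Fz q * deriv φ q.1) ∂cellMeasure Γ =
      (∫ x in Ioo 0 Γ, (e x * c 1 - d x * c 0) * φ x) +
        ∫ x in Ioo 0 Γ, (tp x * c 1 - bt x * c 0) * deriv φ x := by
  have hc := hL.continuous
  obtain ⟨C, hC⟩ := (isCompact_Icc (a := (0 : ℝ)) (b := 1)).exists_bound_of_continuousOn
    hc.continuousOn
  have hcb : ∀ᵐ q ∂cellMeasure Γ, ‖c q.2‖ ≤ C := by
    filter_upwards [ae_cell_mem Γ] with q hq using hC q.2 (Ioo_subset_Icc_self hq.2)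
  obtain ⟨Cφ, -, hCφ⟩ := hφ.exists_bound
  obtain ⟨Cφ', -, hCφ'⟩ := hφ.deriv.exists_bound
  have mc : ∀ {f : ℝ × ℝ → ℝ}, Integrable f (cellMeasure Γ) →
      Integrable (fun q => f q * c q.2) (cellMeasure Γ) := fun hf =>
    hf.mul_bdd (hc.comp continuous_snd).aestronglyMeasurable hcb
  have mc' : ∀ {f : ℝ × ℝ → ℝ}, Integrable f (cellMeasure Γ) →
      Integrable (fun q => f q * c' q.2) (cellMeasure Γ) := fun hf =>
    hf.mul_bdd (hm.comp measurable_snd).aestronglyMeasurable (ae_of_all _ fun q => hM q.2)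
  have mφ : ∀ {f : ℝ × ℝ → ℝ}, Integrable f (cellMeasure Γ) →
      Integrable (fun q => φ q.1 * f q) (cellMeasure Γ) := fun hf =>
    hf.bdd_mul (hφ.continuous.comp continuous_fst).aestronglyMeasurable
      (ae_of_all _ fun q => hCφ q.1)
  have mφ' : ∀ {f : ℝ × ℝ → ℝ}, Integrable f (cellMeasure Γ) →
      Integrable (fun q => deriv φ q.1 * f q) (cellMeasure Γ) := fun hf =>
    hf.bdd_mul (hφ.deriv.continuous.comp continuous_fst).aestronglyMeasurable
      (ae_of_all _ fun q => hCφ' q.1)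
  have hφ0 : ∀ x, x ∉ Ioo 0 Γ → φ x = 0 := fun x hx => by
    by_contra hn; exact hx (hφ.2.2 (subset_tsupport _ hn))
  obtain ⟨Kφ, hKφ⟩ := hφ.1.lipschitzWith_of_hasCompactSupport hφ.2.1 (by simp)
  have A := (hxz.fst_mul φ).mul (HasDz.of_snd (Γ := Γ) hL hd)
  have B := (hz.fst_mul (deriv φ)).mul (HasDz.of_snd (Γ := Γ) hL hd)
  -- `A` and `B` integrate ∂_z(φ Fx c) and ∂_z(φ' F c). The terms with c' add up to c' ∂ₓ(φF), whose
  -- integral vanishes by `D`.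
  have D := HasDx.snd_mul hΓ ((HasDx.of_fst (g := deriv φ) hΓ hKφ (by
    rw [hφ0 0 (by simp), hφ0 Γ (by simp)]) (ae_of_all _ hφ.hasDerivAt)).mul hx) c'
  have iA := (mc (mφ iFxz)).add (mc' (mφ iFx))
  have iB := (mc (mφ' iFz)).add (mc' (mφ' iF))
  have iD : Integrable (fun q => c' q.2 * (deriv φ q.1 * F q + φ q.1 * Fx q)) (cellMeasure Γ) := by
    refine (mc' ((mφ' iF).add (mφ iFx))).congr (ae_of_all _ fun q => ?_)
    simp only [Pi.add_apply]; ring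
  have eA := A.integral_eq iA
  have eB := B.integral_eq iB
  have eD := D.integral_eq_zero iD
  have eAB := integral_add iA iB
  have eABD := integral_sub (iA.add iB) iD
  simp only [Pi.add_apply] at eAB eABD
  rw [eD, eAB, eA, eB, sub_zero] at eABD
  refine Eq.trans (Eq.trans (integral_congr_ae (ae_of_all _ fun q => ?_)) eABD) ?_
  · ring
  · congr 1 <;> refine integral_congr_ae (ae_of_all _ fun x => ?_) <;> ring

theorem ae_eq_zero_of_test {d : ℝ → ℝ} (hd : IntegrableOn d (Ioo 0 Γ))
    (H : ∀ φ, IsTest 0 Γ φ → ∫ x in Ioo 0 Γ, d x * φ x = 0) :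
    ∀ᵐ x ∂volume.restrict (Ioo 0 Γ), d x = 0 := by
  rw [ae_restrict_iff' measurableSet_Ioo]
  refine isOpen_Ioo.ae_eq_zero_of_integral_contDiff_smul_eq_zero hd.locallyIntegrableOn ?_
  intro φ h1 h2 h3
  rw [← H φ ⟨h1, h2, h3⟩, ← setIntegral_eq_integral_of_forall_compl_eq_zero (s := Ioo 0 Γ)]
  · refine integral_congr_ae (ae_of_all _ fun x => ?_)
    simp [mul_comm]
  · intro x hx
    have : φ x = 0 := by
      by_contra hn
      exact hx (h3 (subset_tsupport _ hn))
    simp [this]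

theorem integral_deriv_test (hΓ : 0 < Γ) {φ : ℝ → ℝ} (hφ : IsTest 0 Γ φ) :
    ∫ x in Ioo 0 Γ, deriv φ x = 0 := by
  have hφ0 : ∀ x, x ∉ Ioo 0 Γ → φ x = 0 := fun x hx => by
    by_contra hn; exact hx (hφ.2.2 (subset_tsupport _ hn))
  rw [← integral_Ioc_eq_integral_Ioo, ← intervalIntegral.integral_of_le hΓ.le,
    intervalIntegral.integral_deriv_eq_sub (fun x _ => (hφ.hasDerivAt x).differentiableAt)
      (hφ.deriv.continuous.intervalIntegrable _ _), hφ0 0 (by simp), hφ0 Γ (by simp), sub_zero]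

/-- The layers shrink to a null set, so dominated convergence applies. -/
theorem tendsto_integral_cutoff {G : ℝ × ℝ → ℝ} (hG : Integrable G (cellMeasure Γ)) {r : ℝ → ℝ}
    (hr : Measurable r) (hr0 : ∀ z ∈ Ioo (0 : ℝ) 1, 0 < r z) :
    Tendsto (fun n : ℕ => ∫ q, cutoff (1 / (n + 1)) (r q.2) * G q ∂cellMeasure Γ) atTop (𝓝 0) := by
  have h0 : (0 : ℝ) = ∫ q, (0 : ℝ) ∂cellMeasure Γ := by simp
  rw [h0]
  have hpos : ∀ n : ℕ, (0 : ℝ) < 1 / (n + 1) := fun n => by positivity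
  refine tendsto_integral_of_dominated_convergence (fun q => |G q|) (fun n => ?_) hG.abs
    (fun n => ?_) ?_
  · exact (((cutoff_continuous (hpos n)).measurable.comp
      (hr.comp measurable_snd)).aestronglyMeasurable).mul hG.1
  · filter_upwards [ae_cell_mem Γ] with q hq
    rw [norm_mul, Real.norm_eq_abs, abs_of_nonneg (cutoff_nonneg _ _), Real.norm_eq_abs]
    exact mul_le_of_le_one_left (abs_nonneg _) (cutoff_le_one (hpos n) (hr0 _ hq.2).le)
  · filter_upwards [ae_cell_mem Γ] with q hq
    obtain ⟨N, hN⟩ := exists_nat_one_div_lt (hr0 _ hq.2)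
    refine tendsto_const_nhds.congr' ?_
    filter_upwards [eventually_ge_atTop N] with n hn
    have : (1 : ℝ) / (n + 1) ≤ 1 / (N + 1) :=
      one_div_le_one_div_of_le (by positivity) (by simpa using hn)
    rw [cutoff_eq_zero (hpos n) (by linarith), zero_mul]

/-- If `F` is constant on the bottom wall, its tangential derivative vanishes there. -/
theorem tangential_bot (hΓ : 0 < Γ) (hx : HasDx Γ F Fx) {k : ℝ}
    (hz : HasDz Γ F Fz (fun _ => k) tp)
    (hxz : HasDz Γ Fx Fxz d e) (iF : Integrable F (cellMeasure Γ))
    (iFx : Integrable Fx (cellMeasure Γ)) (iFz : Integrable Fz (cellMeasure Γ))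
    (iFxz : Integrable Fxz (cellMeasure Γ)) : ∀ᵐ x ∂volume.restrict (Ioo 0 Γ), d x = 0 := by
  refine ae_eq_zero_of_test (hxz.integrableOn_bot iFx iFxz) fun φ hφ => ?_
  obtain ⟨Cφ, -, hCφ⟩ := hφ.exists_bound
  obtain ⟨Cφ', -, hCφ'⟩ := hφ.deriv.exists_bound
  have iG : Integrable (fun q => Fxz q * φ q.1 + Fz q * deriv φ q.1) (cellMeasure Γ) :=
    (iFxz.mul_bdd (hφ.continuous.comp continuous_fst).aestronglyMeasurable
      (ae_of_all _ fun q => hCφ q.1)).add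
    (iFz.mul_bdd (hφ.deriv.continuous.comp continuous_fst).aestronglyMeasurable
      (ae_of_all _ fun q => hCφ' q.1))
  have hl := tendsto_integral_cutoff iG measurable_id fun z hz => hz.1
  have hpos : ∀ n : ℕ, (0 : ℝ) < 1 / (n + 1) := fun n => by positivity
  -- The boundary side does not depend on the width of the cut-off: the term with the constant k
  -- vanishes because φ' has zero integral. Letting the width tend to 0 therefore forces it to be 0.
  have he : ∀ n : ℕ, ∫ q, cutoff (1 / (n + 1)) q.2 * (Fxz q * φ q.1 + Fz q * deriv φ q.1)
      ∂cellMeasure Γ = -∫ x in Ioo 0 Γ, d x * φ x := by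
    intro n
    rw [trace_commute hΓ hx hz hxz iF iFx iFz iFxz hφ (cutoff_lipschitz (hpos n))
      (measurable_cutoff' _) (abs_cutoff'_le (hpos n)) (cutoff_ae_hasDerivAt (hpos n) _)]
    have h1 : cutoff (1 / ((n : ℝ) + 1)) 1 = 0 := cutoff_eq_zero (hpos n) (by
      rw [div_le_one (by positivity)]; simp)
    simp only [h1, cutoff_zero, mul_zero, mul_one, zero_sub, neg_mul, integral_neg,
      integral_const_mul, integral_deriv_test hΓ hφ, neg_zero, add_zero]
  simp only [id, he] at hl
  have := tendsto_nhds_unique hl tendsto_const_nhds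
  linarith

/-- If `F` is constant on the top wall, its tangential derivative vanishes there. -/
theorem tangential_top (hΓ : 0 < Γ) (hx : HasDx Γ F Fx) {k : ℝ}
    (hz : HasDz Γ F Fz bt (fun _ => k))
    (hxz : HasDz Γ Fx Fxz d e) (iF : Integrable F (cellMeasure Γ))
    (iFx : Integrable Fx (cellMeasure Γ)) (iFz : Integrable Fz (cellMeasure Γ))
    (iFxz : Integrable Fxz (cellMeasure Γ)) : ∀ᵐ x ∂volume.restrict (Ioo 0 Γ), e x = 0 := by
  have reflectDx : ∀ {A B : ℝ × ℝ → ℝ}, HasDx Γ A B →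
      HasDx Γ (fun q => A (q.1, 1 - q.2)) (fun q => B (q.1, 1 - q.2)) := by
    intro A B H
    exact measurePreserving_one_sub.quasiMeasurePreserving.ae H
  have reflectDz : ∀ {A B : ℝ × ℝ → ℝ} {a b : ℝ → ℝ}, HasDz Γ A B a b →
      HasDz Γ (fun q => A (q.1, 1 - q.2)) (fun q => -B (q.1, 1 - q.2)) b a := by
    intro A B a b H
    filter_upwards [H] with x hx using hx.reflect
  have reflectInt : ∀ {A : ℝ × ℝ → ℝ}, Integrable A (cellMeasure Γ) →
      Integrable (fun q => A (q.1, 1 - q.2)) (cellMeasure Γ) := by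
    intro A H
    exact (((MeasurePreserving.id (volume.restrict (Ioo 0 Γ))).prod
      measurePreserving_one_sub).integrable_comp H.1).2 H
  exact tangential_bot hΓ (reflectDx hx) (reflectDz hz) (reflectDz hxz) (reflectInt iF)
    (reflectInt iFx) (reflectInt iFz).neg (reflectInt iFxz).neg

end Vertical

end RayleighBenard

namespace RayleighBenard

/-! ### The heat equation at a fixed time -/

section Profile

variable {Γ : ℝ} {h : ℝ → ℝ}

theorem IsProfile.periodic_deriv (hp : IsProfile Γ h) : Function.Periodic (deriv h) Γ := by
  intro x
  have h1 : (fun y => h (y + Γ)) = h := funext hp.periodic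
  rw [← deriv_comp_add_const, h1]

theorem IsProfile.exists_lipschitz (hΓ : 0 < Γ) (hp : IsProfile Γ h) :
    ∃ K, LipschitzWith K h := by
  obtain ⟨D, hD⟩ := (isCompact_Icc (a := (0 : ℝ)) (b := Γ)).exists_bound_of_continuousOn
    hp.continuous_deriv.continuousOn
  refine ⟨Real.toNNReal D, lipschitzWith_of_nnnorm_deriv_le hp.differentiable fun x => ?_⟩
  obtain ⟨y, hy, he⟩ := hp.periodic_deriv.exists_mem_Ico₀ hΓ x
  rw [he, ← NNReal.coe_le_coe, coe_nnnorm]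
  exact (hD y (Ico_subset_Icc_self hy)).trans (Real.le_coe_toNNReal D)

theorem IsProfile.hasDx_deriv (hΓ : 0 < Γ) (hp : IsProfile Γ h) :
    HasDx Γ (fun q => deriv h q.1) (fun q => deriv (deriv h) q.1) := by
  obtain ⟨K, hK⟩ := hp.lipschitz_deriv
  refine HasDx.of_fst hΓ hK (by simpa using (hp.periodic_deriv 0).symm) ?_
  refine ae_restrict_of_ae ?_
  filter_upwards [hK.ae_differentiableAt] with x hx using hx.hasDerivAt

/-- The height `y₂ - h 0` as a function on the flattened cell. -/
theorem H1.height (hΓ : 0 < Γ) (hp : IsProfile Γ h) :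
    H1 Γ h (fun q => h q.1 - h 0 + q.2) (fun _ => 0) (fun _ => 1) (fun x => h x - h 0)
      (fun x => h x - h 0 + 1) := by
  obtain ⟨K, hK⟩ := hp.exists_lipschitz hΓ
  have hc := hp.continuous
  obtain ⟨C, hC⟩ := ((isCompact_Icc (a := (0 : ℝ)) (b := Γ)).prod
    (isCompact_Icc (a := (0 : ℝ)) (b := 1))).exists_bound_of_continuousOn
    (f := fun q : ℝ × ℝ => h q.1 - h 0 + q.2) (by fun_prop)
  refine ⟨memLp_two_of_bound (by fun_prop) C ?_, by simp, memLp_const 1, ?_, ?_⟩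
  · filter_upwards [ae_cell_mem Γ] with q hq
    exact hC q ⟨Ioo_subset_Icc_self hq.1, Ioo_subset_Icc_self hq.2⟩
  · have h1 := HasDx.of_fst (f := fun x => h x - h 0) (g := deriv h) (K := K) hΓ (by
      refine LipschitzWith.of_dist_le_mul fun x y => ?_
      simpa using hK.dist_le_mul x y) (by
        have := hp.periodic 0
        simp only [zero_add] at this
        simp [this])
      (ae_of_all _ fun x => (hp.differentiable x).hasDerivAt.sub_const _)
    exact (h1.add (HasDx.of_snd hΓ fun z => z)).congr (by simp) (by simp)
  · refine ae_of_all _ fun x => ?_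
    have := (ACRep.const one_pos (h x - h 0)).add (ACRep.id one_pos)
    simpa using this

end Profile

/-- The temperature `T`, its derivatives, and the velocity `(u, v)` at a fixed time, on the
flattened cell; `b₀, t₀, b₁, t₁` are the traces of the temperature gradient. -/
structure HeatSlice (Γ : ℝ) (h : ℝ → ℝ) (T T₀ T₁ T₀₀ T₁₀ T₀₁ T₁₁ Tt u u₀ u₁ v v₀ v₁ : ℝ × ℝ → ℝ)
    (b₀ t₀ b₁ t₁ bu tu bv tv : ℝ → ℝ) : Prop where
  hT : H1 Γ h T T₀ T₁ (fun _ => 1) (fun _ => 0)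
  hT₀ : H1 Γ h T₀ T₀₀ T₁₀ b₀ t₀
  hT₁ : H1 Γ h T₁ T₀₁ T₁₁ b₁ t₁
  hTt : MemLp Tt 2 (cellMeasure Γ)
  hu : H1 Γ h u u₀ u₁ bu tu
  hv : H1 Γ h v v₀ v₁ bv tv
  div : ∀ᵐ q ∂cellMeasure Γ, u₀ q + v₁ q = 0
  bot : ∀ᵐ x ∂volume.restrict (Ioo 0 Γ), bv x - deriv h x * bu x = 0
  top : ∀ᵐ x ∂volume.restrict (Ioo 0 Γ), tv x - deriv h x * tu x = 0
  heat : ∀ᵐ q ∂cellMeasure Γ, Tt q + (u q * T₀ q + v q * T₁ q) - (T₀₀ q + T₁₁ q) = 0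

namespace HeatSlice

variable {Γ : ℝ} {h : ℝ → ℝ} {T T₀ T₁ T₀₀ T₁₀ T₀₁ T₁₁ Tt u u₀ u₁ v v₀ v₁ : ℝ × ℝ → ℝ}
  {b₀ t₀ b₁ t₁ bu tu bv tv : ℝ → ℝ}
  {φ φ₀ φ₁ : ℝ × ℝ → ℝ} {bφ tφ : ℝ → ℝ}

/-- The heat equation tested with a bounded function. -/
theorem test (hp : IsProfile Γ h)
    (S : HeatSlice Γ h T T₀ T₁ T₀₀ T₁₀ T₀₁ T₁₁ Tt u u₀ u₁ v v₀ v₁ b₀ t₀ b₁ t₁ bu tu bv tv)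
    (H : H1 Γ h φ φ₀ φ₁ bφ tφ) {C : ℝ} (hb : ∀ᵐ q ∂cellMeasure Γ, |φ q| ≤ C) :
    (∫ q, Tt q * φ q ∂cellMeasure Γ) + (∫ q, (u q * T₀ q + v q * T₁ q) * φ q ∂cellMeasure Γ) +
      ∫ q, (T₀ q * φ₀ q + T₁ q * φ₁ q) ∂cellMeasure Γ =
    ∫ x in Ioo 0 Γ, ((t₁ x - deriv h x * t₀ x) * tφ x - (b₁ x - deriv h x * b₀ x) * bφ x) := by
  rw [← (H1.green hp S.hT₀ S.hT₁ H).2]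
  congr 1
  have i1 := integrable_mul_of_memLp S.hTt H.mem
  have i2 : Integrable (fun q => (u q * T₀ q + v q * T₁ q) * φ q) (cellMeasure Γ) :=
    ((integrable_mul_of_memLp S.hu.mem S.hT₀.mem).add
      (integrable_mul_of_memLp S.hv.mem S.hT₁.mem)).mul_bdd H.mem.1 hb
  rw [← integral_add i1 i2]
  refine integral_congr_ae ?_
  filter_upwards [S.heat] with q hq
  have : T₀₀ q + T₁₁ q = Tt q + (u q * T₀ q + v q * T₁ q) := by linarith
  rw [this]; ring

theorem advection_zero (hp : IsProfile Γ h)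
    (S : HeatSlice Γ h T T₀ T₁ T₀₀ T₁₀ T₀₁ T₁₁ Tt u u₀ u₁ v v₀ v₁ b₀ t₀ b₁ t₁ bu tu bv tv)
    (H : H1 Γ h φ φ₀ φ₁ bφ tφ) : ∫ q, (u q * φ₀ q + v q * φ₁ q) ∂cellMeasure Γ = 0 :=
  H1.advection hp S.hu S.hv S.div S.bot S.top H

/-- Testing with an increasing function of the temperature that vanishes at the walls. -/
theorem integral_mul_comp_nonpos (hp : IsProfile Γ h)
    (S : HeatSlice Γ h T T₀ T₁ T₀₀ T₁₀ T₀₁ T₁₁ Tt u u₀ u₁ v v₀ v₁ b₀ t₀ b₁ t₁ bu tu bv tv)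
    {Φ Φ' Ψ : ℝ → ℝ} {K K' : NNReal} {C : ℝ} (hL : LipschitzWith K Φ)
    (hΦ : ∀ s, HasDerivAt Φ (Φ' s) s) (hc : Continuous Φ') (hpos : ∀ s, 0 ≤ Φ' s)
    (hC : ∀ s, |Φ s| ≤ C) (hΨL : LipschitzWith K' Ψ) (hΨ : ∀ s, HasDerivAt Ψ (Φ s) s)
    (h0 : Φ 0 = 0) (h1 : Φ 1 = 0) : ∫ q, Tt q * Φ (T q) ∂cellMeasure Γ ≤ 0 := by
  have e := S.test hp (S.hT.comp hL hΦ hc) (ae_of_all _ fun q => hC (T q))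
  -- Since Ψ is a primitive of Φ, the advection term u·∇T Φ(T) equals u·∇Ψ(T) and integrates to
  -- zero.
  have e2 := S.advection_zero hp (S.hT.comp hΨL hΨ hL.continuous)
  have e3 : ∫ q, (u q * T₀ q + v q * T₁ q) * Φ (T q) ∂cellMeasure Γ = 0 := by
    rw [← e2]
    refine integral_congr_ae (ae_of_all _ fun q => ?_)
    ring
  have e4 : 0 ≤ ∫ q, (T₀ q * (Φ' (T q) * T₀ q) + T₁ q * (Φ' (T q) * T₁ q)) ∂cellMeasure Γ := by
    refine integral_nonneg fun q => ?_
    have := hpos (T q)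
    have h2 : T₀ q * (Φ' (T q) * T₀ q) + T₁ q * (Φ' (T q) * T₁ q) =
      Φ' (T q) * (T₀ q ^ 2 + T₁ q ^ 2) := by ring
    simp only [h2]
    positivity
  simp only [h0, h1, mul_zero, sub_zero, integral_zero] at e
  linarith

/-- The heat flux through the bottom wall. -/
theorem integrableOn_flux (hΓ : 0 < Γ) (hp : IsProfile Γ h)
    (S : HeatSlice Γ h T T₀ T₁ T₀₀ T₁₀ T₀₁ T₁₁ Tt u u₀ u₁ v v₀ v₁ b₀ t₀ b₁ t₁ bu tu bv tv) :
    IntegrableOn (fun x => deriv h x * b₀ x - b₁ x) (Ioo 0 Γ) ∧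
    ∫ x in Ioo 0 Γ, (deriv h x * b₀ x - b₁ x) =
      (∫ q, (T₀₀ q + T₁₁ q) * cutoff 1 q.2 ∂cellMeasure Γ) +
      ∫ q, (T₀ q * -(deriv h q.1 * cutoff' 1 q.2) + T₁ q * cutoff' 1 q.2) ∂cellMeasure Γ := by
  have H := H1.green hp S.hT₀ S.hT₁ (H1.of_snd hΓ hp (cutoff_lipschitz one_pos)
    (measurable_cutoff' 1) (abs_cutoff'_le one_pos) (cutoff_ae_hasDerivAt one_pos _))
  have h1 : cutoff 1 1 = 0 := cutoff_eq_zero one_pos le_rfl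
  simp only [h1, cutoff_zero, mul_zero, mul_one, zero_sub, neg_sub] at H
  exact ⟨H.1, H.2.symm⟩

/-- The field u is orthogonal to the gradient of Tφ. The bounds on T and φ keep this product in the
class where that applies. -/
theorem advection_parts (hT01 : ∀ᵐ q ∂cellMeasure Γ, 0 ≤ T q ∧ T q ≤ 1)
    (hp : IsProfile Γ h)
    (S : HeatSlice Γ h T T₀ T₁ T₀₀ T₁₀ T₀₁ T₁₁ Tt u u₀ u₁ v v₀ v₁ b₀ t₀ b₁ t₁ bu tu bv tv)
    (H : H1 Γ h φ φ₀ φ₁ bφ tφ) {C : ℝ} (hb : ∀ᵐ q ∂cellMeasure Γ, |φ q| ≤ C) :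
    ∫ q, (u q * T₀ q + v q * T₁ q) * φ q ∂cellMeasure Γ =
      -∫ q, T q * (u q * φ₀ q + v q * φ₁ q) ∂cellMeasure Γ := by
  have hTb : ∀ᵐ q ∂cellMeasure Γ, |T q| ≤ 1 := by
    filter_upwards [hT01] with q hq
    rw [abs_of_nonneg hq.1]; exact hq.2
  have e := S.advection_zero hp (S.hT.mul H hTb hb)
  have i2 : Integrable (fun q => (u q * T₀ q + v q * T₁ q) * φ q) (cellMeasure Γ) :=
    ((integrable_mul_of_memLp S.hu.mem S.hT₀.mem).add
      (integrable_mul_of_memLp S.hv.mem S.hT₁.mem)).mul_bdd H.mem.1 hb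
  have i3 : Integrable (fun q => T q * (u q * φ₀ q + v q * φ₁ q)) (cellMeasure Γ) :=
    ((integrable_mul_of_memLp S.hu.mem H.mem₀).add
      (integrable_mul_of_memLp S.hv.mem H.mem₁)).bdd_mul S.hT.mem.1 hTb
  rw [eq_neg_iff_add_eq_zero, ← integral_add i2 i3, ← e]
  refine integral_congr_ae (ae_of_all _ fun q => ?_)
  ring

/-- Taking φ = T in `advection_parts` shows that the advection term equals its own negative. The
boundary term is the bottom flux alone, because T is 1 there and 0 at the top. -/
theorem energy (hT01 : ∀ᵐ q ∂cellMeasure Γ, 0 ≤ T q ∧ T q ≤ 1)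
    (hp : IsProfile Γ h)
    (S : HeatSlice Γ h T T₀ T₁ T₀₀ T₁₀ T₀₁ T₁₁ Tt u u₀ u₁ v v₀ v₁ b₀ t₀ b₁ t₁ bu tu bv tv) :
    (∫ q, Tt q * T q ∂cellMeasure Γ) + ∫ q, (T₀ q ^ 2 + T₁ q ^ 2) ∂cellMeasure Γ =
      ∫ x in Ioo 0 Γ, (deriv h x * b₀ x - b₁ x) := by
  have hTb : ∀ᵐ q ∂cellMeasure Γ, |T q| ≤ 1 := by
    filter_upwards [hT01] with q hq
    rw [abs_of_nonneg hq.1]; exact hq.2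
  have e := S.test hp S.hT hTb
  have e2 := S.advection_parts hT01 hp S.hT hTb
  have e3 : ∫ q, T q * (u q * T₀ q + v q * T₁ q) ∂cellMeasure Γ =
      ∫ q, (u q * T₀ q + v q * T₁ q) * T q ∂cellMeasure Γ := by
    refine integral_congr_ae (ae_of_all _ fun q => ?_)
    ring
  rw [e3] at e2
  have e4 : ∫ q, (u q * T₀ q + v q * T₁ q) * T q ∂cellMeasure Γ = 0 := by linarith
  rw [e4] at e
  simp only [mul_zero, mul_one, zero_sub, neg_sub, add_zero] at e
  simpa only [sq] using e

/-- T attains its maximum on the bottom wall and its minimum on the top wall, so ∂₂T ≤ 0 on both.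
Since T is constant on each wall, ∂₁T = -h'∂₂T there, and the flux ∂₂T - h'∂₁T is (1 + h'²)∂₂T. -/
theorem flux_signs (hT01 : ∀ᵐ q ∂cellMeasure Γ, 0 ≤ T q ∧ T q ≤ 1)
    (hΓ : 0 < Γ) (hp : IsProfile Γ h)
    (S : HeatSlice Γ h T T₀ T₁ T₀₀ T₁₀ T₀₁ T₁₁ Tt u u₀ u₁ v v₀ v₁ b₀ t₀ b₁ t₁ bu tu bv tv) :
    ∀ᵐ x ∂volume.restrict (Ioo 0 Γ),
      b₁ x - deriv h x * b₀ x ≤ 0 ∧ t₁ x - deriv h x * t₀ x ≤ 0 := by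
  have hxz := S.hT₀.dz.add (S.hT₁.dz.fst_mul (deriv h))
  have i1 : Integrable T (cellMeasure Γ) := S.hT.mem.integrable (by norm_num)
  have i2 : Integrable T₁ (cellMeasure Γ) := S.hT₁.mem.integrable (by norm_num)
  have i3 : Integrable (fun q => T₀ q + deriv h q.1 * T₁ q) (cellMeasure Γ) :=
    (S.hT₀.mem.add (hp.memLp_deriv_mul S.hT₁.mem)).integrable (by norm_num)
  have i4 : Integrable (fun q => T₁₀ q + deriv h q.1 * T₁₁ q) (cellMeasure Γ) :=
    (S.hT₀.mem₁.add (hp.memLp_deriv_mul S.hT₁.mem₁)).integrable (by norm_num)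
  filter_upwards [tangential_bot hΓ S.hT.dx S.hT.dz hxz i1 i3 i2 i4,
    tangential_top hΓ S.hT.dx S.hT.dz hxz i1 i3 i2 i4, S.hT.dz, S.hT₁.dz,
    ae_ae_of_ae_cell hT01] with x hb ht hz hz1 h01
  have hb1 : b₁ x ≤ 0 := hz.deriv_left_nonpos hz1 (by
    filter_upwards [h01] with z hz using hz.2)
  have ht1 : t₁ x ≤ 0 := by
    have h1 := hz.neg.reflect
    have h2 := hz1.neg.reflect
    simp only [neg_neg] at h1 h2
    have h3 := h1.deriv_left_nonpos (hz1.reflect) ?_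
    · exact h3
    · have hmp := measurePreserving_one_sub.quasiMeasurePreserving.ae h01
      filter_upwards [hmp] with z hz
      simpa using hz.1
  have hb0 : b₀ x = - (deriv h x * b₁ x) := by linarith
  have ht0 : t₀ x = - (deriv h x * t₁ x) := by linarith
  constructor
  · rw [hb0]; nlinarith [sq_nonneg (deriv h x)]
  · rw [ht0]; nlinarith [sq_nonneg (deriv h x)]

/-- The work of buoyancy is controlled by the heat flux. -/
theorem buoyancy_le (hT01 : ∀ᵐ q ∂cellMeasure Γ, 0 ≤ T q ∧ T q ≤ 1)
    (hΓ : 0 < Γ) (hp : IsProfile Γ h)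
    (S : HeatSlice Γ h T T₀ T₁ T₀₀ T₁₀ T₀₁ T₁₁ Tt u u₀ u₁ v v₀ v₁ b₀ t₀ b₁ t₁ bu tu bv tv)
    {M : ℝ} (hM : ∀ x ∈ Ioo 0 Γ, |h x - h 0| ≤ M) :
    ∫ q, T q * v q ∂cellMeasure Γ ≤
      (∫ q, Tt q * (h q.1 - h 0 + q.2 - (1 + M)) ∂cellMeasure Γ) +
        (1 + 2 * M) * ∫ x in Ioo 0 Γ, (deriv h x * b₀ x - b₁ x) := by
  have H := H1.height hΓ hp
  have hb : ∀ᵐ q ∂cellMeasure Γ, |h q.1 - h 0 + q.2| ≤ M + 1 := by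
    filter_upwards [ae_cell_mem Γ] with q hq
    have h1 := hM q.1 hq.1
    have h2 := abs_add_le (h q.1 - h 0) q.2
    rw [abs_of_pos hq.2.1] at h2
    linarith [hq.2.2]
  have e := S.test hp H hb
  have e1 := S.advection_parts hT01 hp H hb
  have Hone : H1 Γ h (fun _ => 1) (fun _ => 0) (fun _ => 0) (fun _ => 1) (fun _ => 1) := by
    have := H1.of_snd (c := fun _ => 1) (c' := fun _ => 0) (K := 0) (M := 0) hΓ hp
      (LipschitzWith.const 1) measurable_const (by simp) (by simp [hasDerivAt_const])
    simpa using this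
  -- Testing with 1 expresses the top flux by the bottom flux and the time derivative of the heat
  -- content.
  have e2 := S.test hp Hone (C := 1) (by simp)
  have e3 := S.advection_zero hp S.hT
  have hTz : ∫ q, T₁ q ∂cellMeasure Γ = -Γ := by
    rw [S.hT.dz.integral_eq (S.hT.mem₁.integrable (by norm_num))]
    simp [hΓ.le]
  simp only [mul_zero, mul_one, zero_add, add_zero, integral_zero] at e e1 e2
  rw [e1, hTz] at e
  rw [e3, add_zero] at e2
  have g1 := S.integrableOn_flux hΓ hp
  have gi := (H1.green hp S.hT₀ S.hT₁ H).1
  have gi1 := (H1.green hp S.hT₀ S.hT₁ Hone).1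
  simp only [mul_one] at gi1
  have gt : IntegrableOn (fun x => t₁ x - deriv h x * t₀ x) (Ioo 0 Γ) := by
    refine (gi1.sub g1.1).congr (ae_of_all _ fun x => ?_)
    simp only [Pi.sub_apply]
    ring
  have gtn : Integrable (fun x => (1 + M) * -(t₁ x - deriv h x * t₀ x))
      (volume.restrict (Ioo 0 Γ)) := gt.neg.const_mul _
  -- Both fluxes have a sign, so the wall heights may be replaced by their bounds 1 + M and M. The
  -- remaining term ∫ ∂₂T = -Γ also has a favourable sign and is dropped at the end.
  have key : -(∫ x in Ioo 0 Γ, ((t₁ x - deriv h x * t₀ x) * (h x - h 0 + 1) -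
      (b₁ x - deriv h x * b₀ x) * (h x - h 0))) ≤
      (1 + M) * (-∫ x in Ioo 0 Γ, (t₁ x - deriv h x * t₀ x)) +
        M * ∫ x in Ioo 0 Γ, (deriv h x * b₀ x - b₁ x) := by
    rw [← integral_neg, ← integral_neg, ← integral_const_mul, ← integral_const_mul,
      ← integral_add gtn (g1.1.const_mul _)]
    refine integral_mono_ae gi.neg (gtn.add (g1.1.const_mul _)) ?_
    filter_upwards [S.flux_signs hT01 hΓ hp, ae_restrict_mem measurableSet_Ioo] with x hx hm
    have h1 := abs_le.1 (hM x hm)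
    nlinarith [hx.1, hx.2, h1.1, h1.2]
  have ex : ∫ x in Ioo 0 Γ, ((t₁ x - deriv h x * t₀ x) - (b₁ x - deriv h x * b₀ x)) =
      (∫ x in Ioo 0 Γ, (t₁ x - deriv h x * t₀ x)) + ∫ x in Ioo 0 Γ, (deriv h x * b₀ x - b₁ x) := by
    rw [← integral_add gt g1.1]
    refine integral_congr_ae (ae_of_all _ fun x => ?_)
    ring
  rw [ex] at e2
  have eT : ∫ q, Tt q * (h q.1 - h 0 + q.2 - (1 + M)) ∂cellMeasure Γ =
      (∫ q, Tt q * (h q.1 - h 0 + q.2) ∂cellMeasure Γ) - (1 + M) * ∫ q, Tt q ∂cellMeasure Γ := by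
    rw [← integral_const_mul, ← integral_sub (integrable_mul_of_memLp S.hTt H.mem)
      ((S.hTt.integrable (by norm_num)).const_mul _)]
    refine integral_congr_ae (ae_of_all _ fun q => ?_)
    ring
  rw [eT, e2]
  linarith

end HeatSlice

end RayleighBenard

namespace RayleighBenard

/-! ### The heat flux through a boundary layer -/

theorem cutoff'_nonpos {δ : ℝ} (hδ : 0 < δ) (z : ℝ) : cutoff' δ z ≤ 0 := by
  rw [cutoff']
  split_ifs
  · exact neg_nonpos.2 (inv_pos.2 hδ).le
  · exact le_rfl

theorem integrableOn_cutoff' {δ : ℝ} (hδ : 0 < δ) : IntegrableOn (cutoff' δ) (Ioo 0 1) :=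
  (ACRep.of_lipschitz one_pos (cutoff_lipschitz hδ) (cutoff_ae_hasDerivAt hδ _)).integrableOn

theorem setIntegral_cutoff' {δ : ℝ} (hδ : 0 < δ) (h1 : δ ≤ 1) :
    ∫ z in Ioo (0 : ℝ) 1, cutoff' δ z = -1 := by
  rw [(ACRep.of_lipschitz one_pos (cutoff_lipschitz hδ) (cutoff_ae_hasDerivAt hδ _)).setIntegral_eq,
    cutoff_zero, cutoff_eq_zero hδ h1, zero_sub]

theorem setIntegral_cutoff'_mul {δ : ℝ} (h1 : δ ≤ 1) (f : ℝ → ℝ) :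
    ∫ z in Ioo (0 : ℝ) 1, cutoff' δ z * f z = -δ⁻¹ * ∫ z in Ioo 0 δ, f z := by
  rw [← integral_const_mul, setIntegral_eq_of_subset_of_forall_sdiff_eq_zero (s := Ioo 0 δ)
    (f := fun z => cutoff' δ z * f z) measurableSet_Ioo (Ioo_subset_Ioo_right h1)]
  · refine setIntegral_congr_fun measurableSet_Ioo fun z hz => ?_
    simp only [cutoff', if_pos hz.2]
  · rintro z ⟨hz, hn⟩
    have : ¬ z < δ := fun hlt => hn ⟨hz.1, hlt⟩
    simp [cutoff', this]

namespace HeatSlice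

variable {Γ : ℝ} {h : ℝ → ℝ} {T T₀ T₁ T₀₀ T₁₀ T₀₁ T₁₁ Tt u u₀ u₁ v v₀ v₁ : ℝ × ℝ → ℝ}
  {b₀ t₀ b₁ t₁ bu tu bv tv : ℝ → ℝ} {δ : ℝ}

theorem ae_integrable_sq {g : ℝ × ℝ → ℝ} (hg : MemLp g 2 (cellMeasure Γ)) :
    ∀ᵐ x ∂volume.restrict (Ioo 0 Γ), IntegrableOn (fun z => g (x, z) ^ 2) (Ioo 0 1) :=
  Integrable.prod_right_ae hg.integrable_sq

/-- The convective flux through the layer `z < δ`. -/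
theorem layer_convection_le
    (S : HeatSlice Γ h T T₀ T₁ T₀₀ T₁₀ T₀₁ T₁₁ Tt u u₀ u₁ v v₀ v₁ b₀ t₀ b₁ t₁ bu tu bv tv)
    (hp : IsProfile Γ h) (hδ : 0 < δ) (hδ1 : δ ≤ 1) {l : ℝ} (hl : 0 < l) :
    ∫ q, cutoff' δ q.2 * ((1 - T q) * (v q - deriv h q.1 * u q)) ∂cellMeasure Γ ≤
      δ / 2 * (l * (∫ q, T₁ q ^ 2 ∂cellMeasure Γ) +
        l⁻¹ * ∫ q, (v₁ q - deriv h q.1 * u₁ q) ^ 2 ∂cellMeasure Γ) := by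
  have hw := (S.hv.dz.sub (S.hu.dz.fst_mul (deriv h))).congr_trace (bt' := fun _ => 0)
    (tp' := fun _ => 0) S.bot S.top
  have mw : MemLp (fun q => v q - deriv h q.1 * u q) 2 (cellMeasure Γ) :=
    S.hv.mem.sub (hp.memLp_deriv_mul S.hu.mem)
  have mw1 : MemLp (fun q => v₁ q - deriv h q.1 * u₁ q) 2 (cellMeasure Γ) :=
    S.hv.mem₁.sub (hp.memLp_deriv_mul S.hu.mem₁)
  have m1 : MemLp (fun q => 1 - T q) 2 (cellMeasure Γ) := (memLp_const 1).sub S.hT.mem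
  have iL : Integrable (fun q => cutoff' δ q.2 * ((1 - T q) * (v q - deriv h q.1 * u q)))
      (cellMeasure Γ) :=
    (integrable_mul_of_memLp m1 mw).bdd_mul
      ((measurable_cutoff' δ).comp measurable_snd).aestronglyMeasurable
      (ae_of_all _ fun q => abs_cutoff'_le hδ q.2)
  have iA := S.hT.mem₁.integrable_sq
  have iB := mw1.integrable_sq
  rw [cellMeasure, integral_prod _ iL, integral_prod _ iA, integral_prod _ iB,
    ← integral_const_mul, ← integral_const_mul,
    ← integral_add (iA.integral_prod_left.const_mul l) (iB.integral_prod_left.const_mul l⁻¹),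
    ← integral_const_mul]
  refine integral_mono_ae iL.integral_prod_left
    (((iA.integral_prod_left.const_mul l).add (iB.integral_prod_left.const_mul l⁻¹)).const_mul
      (δ / 2)) ?_
  filter_upwards [S.hT.dz, hw, ae_integrable_sq S.hT.mem₁, ae_integrable_sq mw1,
    iL.prod_right_ae] with x h1 h2 h3 h4 h5
  set A := ∫ z in Ioo (0 : ℝ) 1, T₁ (x, z) ^ 2
  set B := ∫ z in Ioo (0 : ℝ) 1, (v₁ (x, z) - deriv h x * u₁ (x, z)) ^ 2
  -- The weight has integral -1, so the constant becomes an integral against the same weight and the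
  -- comparison is pointwise in z.
  have hc : δ / 2 * (l * A + l⁻¹ * B) =
      ∫ z in Ioo (0 : ℝ) 1, cutoff' δ z * -(δ / 2 * (l * A + l⁻¹ * B)) := by
    rw [integral_mul_const, setIntegral_cutoff' hδ hδ1]; ring
  rw [hc]
  refine integral_mono_ae h5 ((integrableOn_cutoff' hδ).mul_const _) ?_
  filter_upwards [h1.sq_sub_le h3, h2.sq_sub_le h4, ae_restrict_mem measurableSet_Ioo]
    with z e1 e2 hz
  simp only [sub_zero] at e1 e2
  by_cases hzd : z < δ
  · refine mul_le_mul_of_nonpos_left ?_ (cutoff'_nonpos hδ z)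
    set a := T (x, z) - 1 with ha
    set w := v (x, z) - deriv h x * u (x, z)
    have hA : 0 ≤ A := integral_nonneg fun _ => sq_nonneg _
    have hB : 0 ≤ B := integral_nonneg fun _ => sq_nonneg _
    have e3 : a ^ 2 ≤ δ * A := e1.trans (mul_le_mul_of_nonneg_right hzd.le hA)
    have e4 : w ^ 2 ≤ δ * B := e2.trans (mul_le_mul_of_nonneg_right hzd.le hB)
    have e5 : 1 - T (x, z) = -a := by rw [ha]; ring
    rw [e5]
    have e6 : l * a ^ 2 ≤ l * (δ * A) := mul_le_mul_of_nonneg_left e3 hl.le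
    have e7 : l⁻¹ * w ^ 2 ≤ l⁻¹ * (δ * B) := mul_le_mul_of_nonneg_left e4 (inv_pos.2 hl).le
    -- Young's inequality with weight l, applied to the product of T - 1 and u₂ - h'u₁, both of
    -- which vanish at z = 0.
    have e8 : 0 ≤ l * (a - l⁻¹ * w) ^ 2 := by positivity
    have e9 : l * (a - l⁻¹ * w) ^ 2 = l * a ^ 2 - 2 * (a * w) + l⁻¹ * w ^ 2 := by
      field_simp
      ring
    linarith
  · simp [cutoff', hzd]

/-- The conductive flux through the layer `z < δ`. -/
theorem layer_conduction_le
    (S : HeatSlice Γ h T T₀ T₁ T₀₀ T₁₀ T₀₁ T₁₁ Tt u u₀ u₁ v v₀ v₁ b₀ t₀ b₁ t₁ bu tu bv tv)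
    (hΓ : 0 < Γ) (hp : IsProfile Γ h) (hT01 : ∀ᵐ q ∂cellMeasure Γ, 0 ≤ T q ∧ T q ≤ 1)
    (hδ : 0 < δ) (hδ1 : δ ≤ 1) {D M : ℝ}
    (hD : ∀ᵐ x ∂volume.restrict (Ioo 0 Γ), |deriv h x| ≤ D)
    (hM : ∀ᵐ x ∂volume.restrict (Ioo 0 Γ), |deriv (deriv h) x| ≤ M) :
    ∫ q, cutoff' δ q.2 * (T₁ q - deriv h q.1 * T₀ q) ∂cellMeasure Γ ≤
      (1 + D ^ 2) * Γ / δ + M * Γ := by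
  have mc : AEStronglyMeasurable (fun q : ℝ × ℝ => cutoff' δ q.2) (cellMeasure Γ) :=
    ((measurable_cutoff' δ).comp measurable_snd).aestronglyMeasurable
  have bc : ∀ᵐ q ∂cellMeasure Γ, ‖cutoff' δ q.2‖ ≤ δ⁻¹ :=
    ae_of_all _ fun q => abs_cutoff'_le hδ q.2
  have mT1 : MemLp (fun q => (1 + deriv h q.1 ^ 2) * T₁ q) 2 (cellMeasure Γ) := by
    have := S.hT.mem₁.add (hp.memLp_deriv_mul (hp.memLp_deriv_mul S.hT.mem₁))
    refine this.ae_eq (ae_of_all _ fun q => ?_)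
    simp only [Pi.add_apply]
    ring
  have mTx : MemLp (fun q => deriv h q.1 * (T₀ q + deriv h q.1 * T₁ q)) 2 (cellMeasure Γ) :=
    hp.memLp_deriv_mul (S.hT.mem₀.add (hp.memLp_deriv_mul S.hT.mem₁))
  have mTh : MemLp (fun q => deriv (deriv h) q.1 * T q) 2 (cellMeasure Γ) :=
    memLp_bdd_mul ((measurable_deriv (deriv h)).comp measurable_fst).aestronglyMeasurable
      (ae_cell_fst hM) S.hT.mem
  have i1 : Integrable (fun q => cutoff' δ q.2 * ((1 + deriv h q.1 ^ 2) * T₁ q)) (cellMeasure Γ) :=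
    (mT1.integrable (by norm_num)).bdd_mul mc bc
  have i2 : Integrable (fun q => cutoff' δ q.2 * (deriv h q.1 * (T₀ q + deriv h q.1 * T₁ q)))
      (cellMeasure Γ) := (mTx.integrable (by norm_num)).bdd_mul mc bc
  have i3 : Integrable (fun q => cutoff' δ q.2 * (deriv (deriv h) q.1 * T q)) (cellMeasure Γ) :=
    (mTh.integrable (by norm_num)).bdd_mul mc bc
  -- The flux is split as (1 + h'²)∂_z T - h'∂ₓT. In the second part the x-derivative is moved onto
  -- h', producing h''T, which 0 ≤ T ≤ 1 controls without any gradient of T.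
  have e1 : ∫ q, cutoff' δ q.2 * (T₁ q - deriv h q.1 * T₀ q) ∂cellMeasure Γ =
      (∫ q, cutoff' δ q.2 * ((1 + deriv h q.1 ^ 2) * T₁ q) ∂cellMeasure Γ) -
      ∫ q, cutoff' δ q.2 * (deriv h q.1 * (T₀ q + deriv h q.1 * T₁ q)) ∂cellMeasure Γ := by
    rw [← integral_sub i1 i2]
    refine integral_congr_ae (ae_of_all _ fun q => ?_)
    ring
  have hx := (((hp.hasDx_deriv hΓ).mul S.hT.dx).snd_mul hΓ (cutoff' δ)).integral_eq_zero
    ((i3.add i2).congr (ae_of_all _ fun q => by simp only [Pi.add_apply]; ring))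
  have e2 : ∫ q, cutoff' δ q.2 * (deriv h q.1 * (T₀ q + deriv h q.1 * T₁ q)) ∂cellMeasure Γ =
      -∫ q, cutoff' δ q.2 * (deriv (deriv h) q.1 * T q) ∂cellMeasure Γ := by
    rw [eq_neg_iff_add_eq_zero, add_comm, ← integral_add i3 i2, ← hx]
    refine integral_congr_ae (ae_of_all _ fun q => ?_)
    ring
  have e3 : ∫ q, cutoff' δ q.2 * (deriv (deriv h) q.1 * T q) ∂cellMeasure Γ ≤ M * Γ := by
    have ic : Integrable (fun q : ℝ × ℝ => cutoff' δ q.2 * -M) (cellMeasure Γ) :=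
      (integrable_const (-M)).bdd_mul mc bc
    have e4 : ∫ q : ℝ × ℝ, cutoff' δ q.2 * -M ∂cellMeasure Γ = M * Γ := by
      rw [cellMeasure, integral_prod _ ic]
      simp only [integral_mul_const, setIntegral_cutoff' hδ hδ1]
      simp [hΓ.le, mul_comm]
    rw [← e4]
    refine integral_mono_ae i3 ic ?_
    filter_upwards [hT01, ae_cell_fst hM] with q h1 h2
    refine mul_le_mul_of_nonpos_left ?_ (cutoff'_nonpos hδ _)
    have h3 := abs_le.1 h2
    nlinarith [h1.1, h1.2, h3.1, h3.2]
  have e5 : ∫ q, cutoff' δ q.2 * ((1 + deriv h q.1 ^ 2) * T₁ q) ∂cellMeasure Γ ≤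
      (1 + D ^ 2) * Γ / δ := by
    have e6 : (1 + D ^ 2) * Γ / δ = ∫ x in Ioo 0 Γ, (1 + D ^ 2) / δ := by
      simp [hΓ.le]; ring
    rw [cellMeasure, integral_prod _ i1, e6]
    refine integral_mono_ae i1.integral_prod_left (integrable_const _) ?_
    filter_upwards [S.hT.dz, hD, ae_ae_of_ae_cell hT01] with x h1 h2 h3
    -- Here γ is the temperature at z = δ; the temperature drop across the layer is 1 - γ ≤ 1.
    obtain ⟨γ, hγ⟩ := h1.mono_right hδ hδ1
    have hγ0 : 0 ≤ γ := hγ.right_nonneg_of_nonneg (by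
      filter_upwards [ae_restrict_of_ae_restrict_of_subset (Ioo_subset_Ioo_right hδ1) h3]
        with z hz using hz.1)
    have e7 : ∫ z in Ioo (0 : ℝ) 1, cutoff' δ z * ((1 + deriv h x ^ 2) * T₁ (x, z)) =
        (1 + deriv h x ^ 2) * (δ⁻¹ * (1 - γ)) := by
      rw [setIntegral_cutoff'_mul hδ1, integral_const_mul, hγ.setIntegral_eq]; ring
    rw [e7, div_eq_mul_inv]
    have e8 : deriv h x ^ 2 ≤ D ^ 2 := sq_le_sq' (by linarith [(abs_le.1 h2).1]) (abs_le.1 h2).2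
    calc (1 + deriv h x ^ 2) * (δ⁻¹ * (1 - γ)) ≤ (1 + deriv h x ^ 2) * δ⁻¹ :=
          mul_le_mul_of_nonneg_left
            (mul_le_of_le_one_right (inv_pos.2 hδ).le (by linarith)) (by positivity)
      _ ≤ (1 + D ^ 2) * δ⁻¹ := mul_le_mul_of_nonneg_right (by linarith) (inv_pos.2 hδ).le
  rw [e1, e2]
  linarith

/-- The test function is the cut-off, which equals 1 at the bottom and 0 at the top, so exactly the
bottom flux appears on the boundary. The heat balance then splits it into the convective and
conductive fluxes through the layer. -/
theorem flux_le
    (S : HeatSlice Γ h T T₀ T₁ T₀₀ T₁₀ T₀₁ T₁₁ Tt u u₀ u₁ v v₀ v₁ b₀ t₀ b₁ t₁ bu tu bv tv)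
    (hΓ : 0 < Γ) (hp : IsProfile Γ h) (hT01 : ∀ᵐ q ∂cellMeasure Γ, 0 ≤ T q ∧ T q ≤ 1)
    (hδ : 0 < δ) (hδ1 : δ ≤ 1) {l : ℝ} (hl : 0 < l) {D M : ℝ}
    (hD : ∀ᵐ x ∂volume.restrict (Ioo 0 Γ), |deriv h x| ≤ D)
    (hM : ∀ᵐ x ∂volume.restrict (Ioo 0 Γ), |deriv (deriv h) x| ≤ M) :
    ∫ x in Ioo 0 Γ, (deriv h x * b₀ x - b₁ x) ≤
      (∫ q, Tt q * cutoff δ q.2 ∂cellMeasure Γ) +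
      δ / 2 * (l * (∫ q, T₁ q ^ 2 ∂cellMeasure Γ) +
        l⁻¹ * ∫ q, (v₁ q - deriv h q.1 * u₁ q) ^ 2 ∂cellMeasure Γ) +
      ((1 + D ^ 2) * Γ / δ + M * Γ) := by
  have H := H1.of_snd hΓ hp (cutoff_lipschitz hδ) (measurable_cutoff' δ) (abs_cutoff'_le hδ)
    (cutoff_ae_hasDerivAt hδ _)
  have hb : ∀ᵐ q ∂cellMeasure Γ, |cutoff δ q.2| ≤ 1 := by
    filter_upwards [ae_cell_mem Γ] with q hq
    rw [abs_of_nonneg (cutoff_nonneg _ _)]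
    exact cutoff_le_one hδ hq.2.1.le
  have e := S.test hp H hb
  have e1 := S.advection_parts hT01 hp H hb
  have e2 := S.advection_zero hp H
  have hTb : ∀ᵐ q ∂cellMeasure Γ, ‖T q‖ ≤ 1 := by
    filter_upwards [hT01] with q hq
    rw [Real.norm_eq_abs, abs_of_nonneg hq.1]; exact hq.2
  have i1 : Integrable (fun q => u q * -(deriv h q.1 * cutoff' δ q.2) + v q * cutoff' δ q.2)
      (cellMeasure Γ) :=
    (integrable_mul_of_memLp S.hu.mem H.mem₀).add (integrable_mul_of_memLp S.hv.mem H.mem₁)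
  have i2 := i1.bdd_mul S.hT.mem.1 hTb
  -- Since u is orthogonal to the gradient of the cut-off, -T may be replaced by 1 - T, which
  -- vanishes at the bottom wall.
  have e3 : -∫ q, T q * (u q * -(deriv h q.1 * cutoff' δ q.2) + v q * cutoff' δ q.2)
      ∂cellMeasure Γ =
      ∫ q, cutoff' δ q.2 * ((1 - T q) * (v q - deriv h q.1 * u q)) ∂cellMeasure Γ := by
    have e4 := integral_sub i1 i2
    rw [e2, zero_sub] at e4
    rw [← e4]
    refine integral_congr_ae (ae_of_all _ fun q => ?_)
    ring
  have e5 : ∫ q, (T₀ q * -(deriv h q.1 * cutoff' δ q.2) + T₁ q * cutoff' δ q.2) ∂cellMeasure Γ =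
      ∫ q, cutoff' δ q.2 * (T₁ q - deriv h q.1 * T₀ q) ∂cellMeasure Γ := by
    refine integral_congr_ae (ae_of_all _ fun q => ?_)
    ring
  rw [e1, e3, e5] at e
  simp only [cutoff_zero, cutoff_eq_zero hδ hδ1, mul_zero, mul_one, zero_sub, neg_sub] at e
  rw [← e]
  have := S.layer_convection_le hp hδ hδ1 hl
  have := S.layer_conduction_le hΓ hp hT01 hδ hδ1 hD hM
  linarith

end HeatSlice

end RayleighBenard

namespace RayleighBenard

/-! ### The momentum equation at a fixed time -/

/-- A periodic function on the flattened cell with square-integrable first and second derivatives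
and the boundary values of the function and of its gradient. -/
structure H2 (Γ : ℝ) (h : ℝ → ℝ) (f f₀ f₁ f₀₀ f₁₀ f₀₁ f₁₁ : ℝ × ℝ → ℝ)
    (bf tf b₀ t₀ b₁ t₁ : ℝ → ℝ) : Prop where
  val : H1 Γ h f f₀ f₁ bf tf
  grad₀ : H1 Γ h f₀ f₀₀ f₁₀ b₀ t₀
  grad₁ : H1 Γ h f₁ f₀₁ f₁₁ b₁ t₁

/-- For k ≥ 0 only the bottom coefficient can have the wrong sign. Its excess e = L(k - 2a) is at
most m/4 with m = min(1, √a). If e > 0, then k itself is large, and the top coefficient is at least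
2m² + e. This compensates the loss at the bottom once t and b are tied together by ½(t - b)². -/
theorem wall_coercive_of_nonneg {k a a' L b t : ℝ} (hL : 1 ≤ L) (ha : 0 ≤ a) (ha' : 0 ≤ a')
    (hk : 0 ≤ k) (hka : |k| ≤ 2 * a + 1 / (4 * L) * min 1 (Real.sqrt a)) :
    -(L ^ 3 * ((2 * a' + k) * t ^ 2 + (2 * a - k) * b ^ 2)) ≤ 1 / 2 * (L ^ 2 * (t - b) ^ 2) := by
  have hL0 : 0 < L := by linarith
  rw [abs_of_nonneg hk] at hka
  set m := min 1 (Real.sqrt a)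
  have hm0 : 0 ≤ m := le_min zero_le_one (Real.sqrt_nonneg a)
  have hm1 : m ≤ 1 := min_le_left _ _
  have hma : m ^ 2 ≤ a := by
    rw [← Real.sq_sqrt ha]
    exact pow_le_pow_left₀ hm0 (min_le_right _ _) 2
  have hp : L ^ 3 = L ^ 2 * L := by ring
  have hb2 := sq_nonneg b
  have ht2 := sq_nonneg t
  suffices h : -(L * ((2 * a' + k) * t ^ 2 + (2 * a - k) * b ^ 2)) ≤ 1 / 2 * (t - b) ^ 2 by
    have := mul_le_mul_of_nonneg_left h (sq_nonneg L)
    rw [hp]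
    linarith
  set e := L * (k - 2 * a) with he
  rcases le_total e 0 with h0 | h0
  · have h1 : 0 ≤ L * (2 * a' + k) * t ^ 2 := by positivity
    have h2 : e * b ^ 2 ≤ 0 := mul_nonpos_of_nonpos_of_nonneg h0 hb2
    have h3 := sq_nonneg (t - b)
    have h4 : -(L * ((2 * a' + k) * t ^ 2 + (2 * a - k) * b ^ 2)) =
      -(L * (2 * a' + k) * t ^ 2) + e * b ^ 2 := by rw [he]; ring
    linarith
  · have hem : e ≤ m / 4 := by
      have h1 : L * (k - 2 * a) ≤ L * (1 / (4 * L) * m) :=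
        mul_le_mul_of_nonneg_left (by linarith) hL0.le
      have h2 : L * (1 / (4 * L) * m) = m / 4 := by field_simp
      linarith
    have h1 : (2 * m ^ 2 + e) * t ^ 2 ≤ L * (2 * a' + k) * t ^ 2 := by
      refine mul_le_mul_of_nonneg_right ?_ ht2
      have h2 : a ≤ L * a := le_mul_of_one_le_left ha hL
      have h3 : 0 ≤ L * a' := by positivity
      have h4 : L * (2 * a' + k) = 2 * (L * a') + 2 * (L * a) + e := by rw [he]; ring
      linarith
    have h2 : 0 ≤ 1 / 2 * (t - b) ^ 2 + (2 * m ^ 2 + e) * t ^ 2 - e * b ^ 2 := by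
      -- Completing the square in t leaves the coefficient m² - 2m²e - e² of b²; it is nonnegative
      -- because e ≤ m/4 ≤ 1/4.
      have hc : 0 < 1 / 2 + (2 * m ^ 2 + e) := by positivity
      have h3 : (1 / 2 + (2 * m ^ 2 + e)) *
          (1 / 2 * (t - b) ^ 2 + (2 * m ^ 2 + e) * t ^ 2 - e * b ^ 2) =
          ((1 / 2 + (2 * m ^ 2 + e)) * t - b / 2) ^ 2 +
            (m ^ 2 - 2 * m ^ 2 * e - e ^ 2) * b ^ 2 := by ring
      have h4 : 0 ≤ m ^ 2 - 2 * m ^ 2 * e - e ^ 2 := by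
        have h5 : m ^ 2 * e ≤ m ^ 2 * (1 / 4) :=
          mul_le_mul_of_nonneg_left (by linarith) (sq_nonneg m)
        have h6 : e ^ 2 ≤ (m / 4) ^ 2 := pow_le_pow_left₀ h0 hem 2
        nlinarith [sq_nonneg m]
      refine nonneg_of_mul_nonneg_right ?_ hc
      rw [h3]
      positivity
    have h4 : -(L * ((2 * a' + k) * t ^ 2 + (2 * a - k) * b ^ 2)) =
      -(L * (2 * a' + k) * t ^ 2) + e * b ^ 2 := by rw [he]; ring
    linarith

/-- The boundary dissipation on opposite points of the two walls is controlled by the difference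
of the wall velocities. -/
theorem wall_coercive {k a a' L b t : ℝ} (hL : 1 ≤ L) (ha : 0 ≤ a) (ha' : 0 ≤ a')
    (hka : |k| ≤ 2 * a + 1 / (4 * L) * min 1 (Real.sqrt a))
    (hka' : |k| ≤ 2 * a' + 1 / (4 * L) * min 1 (Real.sqrt a')) :
    -(L ^ 3 * ((2 * a' + k) * t ^ 2 + (2 * a - k) * b ^ 2)) ≤ 1 / 2 * (L ^ 2 * (t - b) ^ 2) := by
  rcases le_total 0 k with h0 | h0
  · exact wall_coercive_of_nonneg hL ha ha' h0 hka
  · have := wall_coercive_of_nonneg (k := -k) (b := t) (t := b) hL ha' ha (by linarith)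
      (by rwa [abs_neg])
    have h1 : (2 * a' + k) * t ^ 2 + (2 * a - k) * b ^ 2 =
      (2 * a + -k) * b ^ 2 + (2 * a' - -k) * t ^ 2 := by ring
    have h2 : (t - b) ^ 2 = (b - t) ^ 2 := by ring
    rwa [h1, h2]

section Momentum

variable {Γ : ℝ} {h : ℝ → ℝ}
  {u u₀ u₁ u₀₀ u₁₀ u₀₁ u₁₁ ut v v₀ v₁ v₀₀ v₁₀ v₀₁ v₁₁ vt p p₀ p₁ T : ℝ × ℝ → ℝ}
  {bu tu bu₀ tu₀ bu₁ tu₁ bv tv bv₀ tv₀ bv₁ tv₁ bp tp : ℝ → ℝ}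

/-- One component of the momentum equation tested with that component. -/
theorem H2.energy {f f₀ f₁ f₀₀ f₁₀ f₀₁ f₁₁ ft P F : ℝ × ℝ → ℝ} {bf tf b₀ t₀ b₁ t₁ : ℝ → ℝ} {c : ℝ}
    (hp : IsProfile Γ h) (Hu : H1 Γ h u u₀ u₁ bu tu) (Hv : H1 Γ h v v₀ v₁ bv tv)
    (hdiv : ∀ᵐ q ∂cellMeasure Γ, u₀ q + v₁ q = 0)
    (hb : ∀ᵐ x ∂volume.restrict (Ioo 0 Γ), bv x - deriv h x * bu x = 0)
    (ht : ∀ᵐ x ∂volume.restrict (Ioo 0 Γ), tv x - deriv h x * tu x = 0)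
    (H : H2 Γ h f f₀ f₁ f₀₀ f₁₀ f₀₁ f₁₁ bf tf b₀ t₀ b₁ t₁)
    (hft : MemLp ft 2 (cellMeasure Γ)) (hP : MemLp P 2 (cellMeasure Γ))
    (hF : MemLp F 2 (cellMeasure Γ))
    (he : ∀ᵐ q ∂cellMeasure Γ,
      c * (ft q + (u q * f₀ q + v q * f₁ q)) - (f₀₀ q + f₁₁ q) + P q = F q) :
    c * (∫ q, ft q * f q ∂cellMeasure Γ) + (∫ q, P q * f q ∂cellMeasure Γ) +
      ∫ q, (f₀ q ^ 2 + f₁ q ^ 2) ∂cellMeasure Γ =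
    (∫ q, F q * f q ∂cellMeasure Γ) +
      ∫ x in Ioo 0 Γ, ((t₁ x - deriv h x * t₀ x) * tf x - (b₁ x - deriv h x * b₀ x) * bf x) := by
  -- No maximum principle is available for the velocity; H² regularity at the fixed time gives the
  -- bound that makes f² an admissible function for `H1.advection`.
  obtain ⟨C, hC⟩ := H.val.exists_bound hp H.grad₀ H.grad₁
  rw [← (H1.green hp H.grad₀ H.grad₁ H.val).2]
  have e1 := H1.advection hp Hu Hv hdiv hb ht (H.val.mul H.val hC hC)
  have i1 : Integrable (fun q => (u q * f₀ q + v q * f₁ q) * f q) (cellMeasure Γ) :=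
    ((integrable_mul_of_memLp Hu.mem H.val.mem₀).add
      (integrable_mul_of_memLp Hv.mem H.val.mem₁)).mul_bdd H.val.mem.1 hC
  have e2 : ∫ q, (u q * f₀ q + v q * f₁ q) * f q ∂cellMeasure Γ = 0 := by
    have : ∫ q, (u q * (f₀ q * f q + f q * f₀ q) + v q * (f₁ q * f q + f q * f₁ q)) ∂cellMeasure Γ =
        2 * ∫ q, (u q * f₀ q + v q * f₁ q) * f q ∂cellMeasure Γ := by
      rw [← integral_const_mul]
      refine integral_congr_ae (ae_of_all _ fun q => ?_)
      ring
    linarith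
  have i2 := integrable_mul_of_memLp hft H.val.mem
  have i3 := integrable_mul_of_memLp hP H.val.mem
  have i4 := integrable_mul_of_memLp hF H.val.mem
  have i5 : Integrable (fun q => c * (ft q * f q) + c * ((u q * f₀ q + v q * f₁ q) * f q))
    (cellMeasure Γ) := (i2.const_mul c).add (i1.const_mul c)
  have i6 : Integrable (fun q => c * (ft q * f q) + c * ((u q * f₀ q + v q * f₁ q) * f q) +
    P q * f q) (cellMeasure Γ) := i5.add i3
  have e3 : ∫ q, (f₀₀ q + f₁₁ q) * f q ∂cellMeasure Γ =
      c * (∫ q, ft q * f q ∂cellMeasure Γ) + (∫ q, P q * f q ∂cellMeasure Γ) -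
        ∫ q, F q * f q ∂cellMeasure Γ := by
    have e4 : c * (∫ q, ft q * f q ∂cellMeasure Γ) =
        c * (∫ q, ft q * f q ∂cellMeasure Γ) +
          c * ∫ q, (u q * f₀ q + v q * f₁ q) * f q ∂cellMeasure Γ := by rw [e2]; ring
    rw [e4, ← integral_const_mul, ← integral_const_mul,
      ← integral_add (i2.const_mul c) (i1.const_mul c), ← integral_add i5 i3, ← integral_sub i6 i4]
    refine integral_congr_ae ?_
    filter_upwards [he] with q hq
    have : f₀₀ q + f₁₁ q = c * (ft q + (u q * f₀ q + v q * f₁ q)) + P q - F q := by linarith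
    rw [this]; ring
  simp only [sq]
  rw [e3]
  ring

/-- Differentiating `u · n = 0` along the walls. -/
theorem tangential_wall (hΓ : 0 < Γ) (hp : IsProfile Γ h)
    (Hu : H2 Γ h u u₀ u₁ u₀₀ u₁₀ u₀₁ u₁₁ bu tu bu₀ tu₀ bu₁ tu₁)
    (Hv : H2 Γ h v v₀ v₁ v₀₀ v₁₀ v₀₁ v₁₁ bv tv bv₀ tv₀ bv₁ tv₁)
    (hb : ∀ᵐ x ∂volume.restrict (Ioo 0 Γ), bv x - deriv h x * bu x = 0)
    (ht : ∀ᵐ x ∂volume.restrict (Ioo 0 Γ), tv x - deriv h x * tu x = 0)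
    {M : ℝ} (hM : ∀ᵐ x ∂volume.restrict (Ioo 0 Γ), |deriv (deriv h) x| ≤ M) :
    (∀ᵐ x ∂volume.restrict (Ioo 0 Γ), bv₀ x + deriv h x * bv₁ x -
      (deriv (deriv h) x * bu x + deriv h x * (bu₀ x + deriv h x * bu₁ x)) = 0) ∧
    ∀ᵐ x ∂volume.restrict (Ioo 0 Γ), tv₀ x + deriv h x * tv₁ x -
      (deriv (deriv h) x * tu x + deriv h x * (tu₀ x + deriv h x * tu₁ x)) = 0 := by
  have dx : HasDx Γ (fun q => v q - deriv h q.1 * u q)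
      (fun q => v₀ q + deriv h q.1 * v₁ q -
        (deriv (deriv h) q.1 * u q + deriv h q.1 * (u₀ q + deriv h q.1 * u₁ q))) :=
    (Hv.val.dx.add (((hp.hasDx_deriv hΓ).mul Hu.val.dx).snd_mul hΓ fun _ => -1)).congr
      (ae_of_all _ fun q => by ring) (ae_of_all _ fun q => by ring)
  have dz := (Hv.val.dz.sub (Hu.val.dz.fst_mul (deriv h))).congr_trace (bt' := fun _ => 0)
    (tp' := fun _ => 0) hb ht
  have dxz := (Hv.grad₀.dz.add (Hv.grad₁.dz.fst_mul (deriv h))).sub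
    ((Hu.val.dz.fst_mul (deriv (deriv h))).add
      ((Hu.grad₀.dz.add (Hu.grad₁.dz.fst_mul (deriv h))).fst_mul (deriv h)))
  have m2 : ∀ {k : ℝ × ℝ → ℝ}, MemLp k 2 (cellMeasure Γ) →
      MemLp (fun q => deriv (deriv h) q.1 * k q) 2 (cellMeasure Γ) := fun hk =>
    memLp_bdd_mul ((measurable_deriv (deriv h)).comp measurable_fst).aestronglyMeasurable
      (ae_cell_fst hM) hk
  have mk : ∀ {a b c d e : ℝ × ℝ → ℝ}, MemLp a 2 (cellMeasure Γ) → MemLp b 2 (cellMeasure Γ) →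
      MemLp c 2 (cellMeasure Γ) → MemLp d 2 (cellMeasure Γ) → MemLp e 2 (cellMeasure Γ) →
      Integrable (fun q => a q + deriv h q.1 * b q -
        (deriv (deriv h) q.1 * c q + deriv h q.1 * (d q + deriv h q.1 * e q))) (cellMeasure Γ) := by
    intro a b c d e ha hb hc hd he
    have h1 : MemLp (fun q => a q + deriv h q.1 * b q) 2 (cellMeasure Γ) :=
      MemLp.add ha (hp.memLp_deriv_mul hb)
    have h2 : MemLp (fun q => d q + deriv h q.1 * e q) 2 (cellMeasure Γ) :=
      MemLp.add hd (hp.memLp_deriv_mul he)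
    have h3 : MemLp (fun q => deriv (deriv h) q.1 * c q + deriv h q.1 * (d q + deriv h q.1 * e q))
      2 (cellMeasure Γ) := MemLp.add (m2 hc) (hp.memLp_deriv_mul h2)
    exact (h1.sub h3).integrable (by norm_num)
  have iF : Integrable (fun q => v q - deriv h q.1 * u q) (cellMeasure Γ) :=
    (Hv.val.mem.sub (hp.memLp_deriv_mul Hu.val.mem)).integrable (by norm_num)
  have iFz : Integrable (fun q => v₁ q - deriv h q.1 * u₁ q) (cellMeasure Γ) :=
    (Hv.val.mem₁.sub (hp.memLp_deriv_mul Hu.val.mem₁)).integrable (by norm_num)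
  have iFx := mk Hv.val.mem₀ Hv.val.mem₁ Hu.val.mem Hu.val.mem₀ Hu.val.mem₁
  have iFxz := mk Hv.grad₀.mem₁ Hv.grad₁.mem₁ Hu.val.mem₁ Hu.grad₀.mem₁ Hu.grad₁.mem₁
  exact ⟨tangential_bot hΓ dx dz dxz iF iFx iFz iFxz, tangential_top hΓ dx dz dxz iF iFx iFz iFxz⟩

/-- The energy inequality for the velocity. -/
theorem momentum_energy (hΓ : 0 < Γ) (hp : IsProfile Γ h)
    (Hu : H2 Γ h u u₀ u₁ u₀₀ u₁₀ u₀₁ u₁₁ bu tu bu₀ tu₀ bu₁ tu₁)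
    (Hv : H2 Γ h v v₀ v₁ v₀₀ v₁₀ v₀₁ v₁₁ bv tv bv₀ tv₀ bv₁ tv₁)
    (Hp : H1 Γ h p p₀ p₁ bp tp)
    (hut : MemLp ut 2 (cellMeasure Γ)) (hvt : MemLp vt 2 (cellMeasure Γ))
    (hT : MemLp T 2 (cellMeasure Γ))
    (hdiv : ∀ᵐ q ∂cellMeasure Γ, u₀ q + v₁ q = 0)
    (hb : ∀ᵐ x ∂volume.restrict (Ioo 0 Γ), bv x - deriv h x * bu x = 0)
    (ht : ∀ᵐ x ∂volume.restrict (Ioo 0 Γ), tv x - deriv h x * tu x = 0)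
    {c Ra : ℝ} (hu : ∀ᵐ q ∂cellMeasure Γ,
      c * (ut q + (u q * u₀ q + v q * u₁ q)) - (u₀₀ q + u₁₁ q) + p₀ q = 0)
    (hv : ∀ᵐ q ∂cellMeasure Γ,
      c * (vt q + (u q * v₀ q + v q * v₁ q)) - (v₀₀ q + v₁₁ q) + p₁ q = Ra * T q)
    {a a' L : ℝ → ℝ} (hL : ∀ x, 0 ≤ L x) (hLsq : ∀ x, L x ^ 2 = 1 + deriv h x ^ 2)
    (ha : ∀ᵐ x ∂volume.restrict (Ioo 0 Γ), 0 ≤ a x ∧ 0 ≤ a' x)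
    (hk : ∀ᵐ x ∂volume.restrict (Ioo 0 Γ), |deriv (deriv h) x / L x ^ 3| ≤
      2 * a x + 1 / (4 * L x) * min 1 (Real.sqrt (a x)))
    (hk' : ∀ᵐ x ∂volume.restrict (Ioo 0 Γ), |deriv (deriv h) x / L x ^ 3| ≤
      2 * a' x + 1 / (4 * L x) * min 1 (Real.sqrt (a' x)))
    (hsb : ∀ᵐ x ∂volume.restrict (Ioo 0 Γ), 2 * deriv h x * (bu₀ x - bv₁ x) -
      (bv₀ x + bu₁ x) * (1 - deriv h x ^ 2) = -(2 * a x * L x ^ 3 * bu x))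
    (hst : ∀ᵐ x ∂volume.restrict (Ioo 0 Γ), 2 * deriv h x * (tu₀ x - tv₁ x) -
      (tv₀ x + tu₁ x) * (1 - deriv h x ^ 2) = 2 * a' x * L x ^ 3 * tu x)
    {M : ℝ} (hM : ∀ᵐ x ∂volume.restrict (Ioo 0 Γ), |deriv (deriv h) x| ≤ M) :
    c * ((∫ q, ut q * u q ∂cellMeasure Γ) + ∫ q, vt q * v q ∂cellMeasure Γ) +
      1 / 2 * ∫ q, (u₁ q ^ 2 + v₁ q ^ 2) ∂cellMeasure Γ ≤
    Ra * ∫ q, T q * v q ∂cellMeasure Γ := by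
  have eu := H2.energy (F := fun _ => 0) hp Hu.val Hv.val hdiv hb ht Hu hut Hp.mem₀
    (memLp_const 0) hu
  have ev := H2.energy hp Hu.val Hv.val hdiv hb ht Hv hvt Hp.mem₁ (hT.const_mul Ra) hv
  have ep := H1.advection hp Hu.val Hv.val hdiv hb ht Hp
  have ip : (∫ q, p₀ q * u q ∂cellMeasure Γ) + ∫ q, p₁ q * v q ∂cellMeasure Γ = 0 := by
    rw [← ep, ← integral_add (integrable_mul_of_memLp Hp.mem₀ Hu.val.mem)
      (integrable_mul_of_memLp Hp.mem₁ Hv.val.mem)]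
    refine integral_congr_ae (ae_of_all _ fun q => ?_)
    ring
  have eT : ∫ q, Ra * T q * v q ∂cellMeasure Γ = Ra * ∫ q, T q * v q ∂cellMeasure Γ := by
    simp only [mul_assoc, integral_const_mul]
  have iu1 := Hu.val.mem₁.integrable_sq
  have iv1 := Hv.val.mem₁.integrable_sq
  have iu0 := Hu.val.mem₀.integrable_sq
  have iv0 := Hv.val.mem₀.integrable_sq
  have gu := (H1.green hp Hu.grad₀ Hu.grad₁ Hu.val).1
  have gv := (H1.green hp Hv.grad₀ Hv.grad₁ Hv.val).1
  obtain ⟨tb, tt⟩ := tangential_wall hΓ hp Hu Hv hb ht hM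
  have bdry : (∫ x in Ioo 0 Γ, ((tu₁ x - deriv h x * tu₀ x) * tu x -
        (bu₁ x - deriv h x * bu₀ x) * bu x)) +
      (∫ x in Ioo 0 Γ, ((tv₁ x - deriv h x * tv₀ x) * tv x -
        (bv₁ x - deriv h x * bv₀ x) * bv x)) ≤
      1 / 2 * ∫ q, (u₁ q ^ 2 + v₁ q ^ 2) ∂cellMeasure Γ := by
    have iuv : Integrable (fun q => u₁ q ^ 2 + v₁ q ^ 2) (cellMeasure Γ) := iu1.add iv1
    rw [cellMeasure, integral_prod _ iuv, ← integral_add gu gv, ← integral_const_mul]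
    refine integral_mono_ae (gu.add gv) (iuv.integral_prod_left.const_mul _) ?_
    filter_upwards [tb, tt, hb, ht, ha, hk, hk', hsb, hst, Hu.val.dz, Hv.val.dz,
      HeatSlice.ae_integrable_sq Hu.val.mem₁, HeatSlice.ae_integrable_sq Hv.val.mem₁]
      with x tb tt hb ht ha hk hk' hsb hst du dv su sv
    have hL1 : 1 ≤ L x := by
      have := hLsq x
      nlinarith [hL x, sq_nonneg (deriv h x)]
    have hL0 : L x ≠ 0 := by linarith
    have w := wall_coercive (b := bu x) (t := tu x) hL1 ha.1 ha.2 hk hk'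
    have e1 : L x ^ 3 * ((2 * a' x + deriv (deriv h) x / L x ^ 3) * tu x ^ 2 +
        (2 * a x - deriv (deriv h) x / L x ^ 3) * bu x ^ 2) =
        (2 * a' x * L x ^ 3 + deriv (deriv h) x) * tu x ^ 2 +
        (2 * a x * L x ^ 3 - deriv (deriv h) x) * bu x ^ 2 := by
      field_simp
    rw [e1, hLsq] at w
    have hbv : bv x = deriv h x * bu x := by linarith
    have htv : tv x = deriv h x * tu x := by linarith
    have f1 := du.sq_endpoints_le su
    have f2 := dv.sq_endpoints_le sv
    rw [hbv, htv] at f2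
    rw [sub_zero, one_mul] at f1 f2
    have f3 : ∫ z in Ioo (0 : ℝ) 1, (u₁ (x, z) ^ 2 + v₁ (x, z) ^ 2) =
      (∫ z in Ioo (0 : ℝ) 1, u₁ (x, z) ^ 2) + ∫ z in Ioo (0 : ℝ) 1, v₁ (x, z) ^ 2 :=
      integral_add su sv
    have f4 : (deriv h x * tu x - deriv h x * bu x) ^ 2 = deriv h x ^ 2 * (tu x - bu x) ^ 2 := by
      ring
    rw [f4] at f2
    -- The slip condition involves the symmetric gradient, while Green's formula gives the full
    -- normal derivative. Their difference is the derivative of u·n = 0 along the wall, which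
    -- contributes h''.
    have g1 : (tu₁ x - deriv h x * tu₀ x) + (tv₁ x - deriv h x * tv₀ x) * deriv h x =
      -((2 * a' x * L x ^ 3 + deriv (deriv h) x) * tu x) := by linear_combination -hst - tt
    have g2 : (bu₁ x - deriv h x * bu₀ x) + (bv₁ x - deriv h x * bv₀ x) * deriv h x =
      (2 * a x * L x ^ 3 - deriv (deriv h) x) * bu x := by linear_combination -hsb - tb
    have g3 : (tu₁ x - deriv h x * tu₀ x) * tu x - (bu₁ x - deriv h x * bu₀ x) * bu x +
        ((tv₁ x - deriv h x * tv₀ x) * tv x - (bv₁ x - deriv h x * bv₀ x) * bv x) =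
        -((2 * a' x * L x ^ 3 + deriv (deriv h) x) * tu x ^ 2 +
          (2 * a x * L x ^ 3 - deriv (deriv h) x) * bu x ^ 2) := by
      rw [hbv, htv]
      linear_combination tu x * g1 - bu x * g2
    have f5 : (1 + deriv h x ^ 2) * (tu x - bu x) ^ 2 =
      (tu x - bu x) ^ 2 + deriv h x ^ 2 * (tu x - bu x) ^ 2 := by ring
    rw [f3, g3]
    linarith only [w, f1, f2, f5]
  have su : ∫ q, u₁ q ^ 2 ∂cellMeasure Γ ≤ ∫ q, (u₀ q ^ 2 + u₁ q ^ 2) ∂cellMeasure Γ :=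
    integral_mono iu1 (iu0.add iu1) fun q => by
      simp only; linarith [sq_nonneg (u₀ q)]
  have sv : ∫ q, v₁ q ^ 2 ∂cellMeasure Γ ≤ ∫ q, (v₀ q ^ 2 + v₁ q ^ 2) ∂cellMeasure Γ :=
    integral_mono iv1 (iv0.add iv1) fun q => by
      simp only; linarith [sq_nonneg (v₀ q)]
  have suv : ∫ q, (u₁ q ^ 2 + v₁ q ^ 2) ∂cellMeasure Γ =
    (∫ q, u₁ q ^ 2 ∂cellMeasure Γ) + ∫ q, v₁ q ^ 2 ∂cellMeasure Γ := integral_add iu1 iv1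
  rw [eT] at ev
  simp only [zero_mul, integral_zero] at eu
  rw [suv] at bdry ⊢
  linarith

end Momentum

end RayleighBenard

namespace RayleighBenard

/-! ### Strong solutions at almost every time -/

theorem ae_Ioi_of_ae_Ioo {p : ℝ → Prop}
    (H : ∀ a b : ℝ, 0 < a → a < b → ∀ᵐ t ∂volume.restrict (Ioo a b), p t) :
    ∀ᵐ t ∂volume.restrict (Ioi (0 : ℝ)), p t := by
  have hU : (Ioi (0 : ℝ)) ⊆ ⋃ n : ℕ, Ioo (1 / ((n : ℝ) + 1)) (n + 2) := by
    intro t ht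
    obtain ⟨n, hn⟩ := exists_nat_one_div_lt (mem_Ioi.1 ht)
    obtain ⟨m, hm⟩ := exists_nat_gt t
    refine mem_iUnion.2 ⟨max n m, ?_, ?_⟩
    · refine lt_of_le_of_lt ?_ hn
      gcongr
      exact_mod_cast le_max_left n m
    · have : (m : ℝ) ≤ ((max n m : ℕ) : ℝ) := by exact_mod_cast le_max_right n m
      linarith
  refine ae_restrict_of_ae_restrict_of_subset hU ?_
  rw [ae_restrict_iUnion_iff]
  intro n
  refine H _ _ (by positivity) ?_
  have : 1 / ((n : ℝ) + 1) ≤ 1 := by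
    rw [div_le_one (by positivity)]
    linarith [(Nat.cast_nonneg n : (0 : ℝ) ≤ n)]
  linarith [(Nat.cast_nonneg n : (0 : ℝ) ≤ n)]

/-! ### Strong fields and boundary conditions on time slices -/

section Fields

variable {Γ : ℝ} {h : ℝ → ℝ}

theorem LocL2.ae_memLp {f : ℝ → ℝ × ℝ → ℝ} (H : LocL2 Γ h f) :
    ∀ᵐ t ∂volume.restrict (Ioi (0 : ℝ)), MemLp (f t) 2 (volume.restrict (cell Γ h)) := by
  refine ae_Ioi_of_ae_Ioo fun a b ha hab => ?_
  have h1 := H a b ha hab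
  filter_upwards [h1.1.prodMk_left, h1.integrable_sq.prod_right_ae] with t h2 h3
  exact (memLp_two_iff_integrable_sq h2).2 h3

theorem H1.of_weak {f g₀ g₁ : ℝ × ℝ → ℝ} (hΓ : 0 < Γ) (hp : IsProfile Γ h)
    (w₀ : IsWeakPartial h 0 f g₀) (w₁ : IsWeakPartial h 1 f g₁)
    (hper : ∀ᵐ y ∂volume.restrict (strip h), f (y.1 + Γ, y.2) = f y)
    (hf : MemLp f 2 (volume.restrict (cell Γ h))) (h₀ : MemLp g₀ 2 (volume.restrict (cell Γ h)))
    (h₁ : MemLp g₁ 2 (volume.restrict (cell Γ h))) :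
    H1 Γ h (flat h f) (flat h g₀) (flat h g₁) (trace h .bot f) (trace h .top f) :=
  ⟨memLp_flat hp.continuous hf, memLp_flat hp.continuous h₀, memLp_flat hp.continuous h₁,
    hasDx_of_weak hΓ hp w₀ w₁ hper, hasDz_of_weak hΓ hp w₀ w₁ h₁⟩

theorem StrongField.ae_H2 (hΓ : 0 < Γ) (hp : IsProfile Γ h) (F : StrongField Γ h) :
    ∀ᵐ t ∂volume.restrict (Ioi (0 : ℝ)),
      H2 Γ h (flat h (F.val t)) (flat h (F.grad 0 t)) (flat h (F.grad 1 t))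
        (flat h (F.hess 0 0 t)) (flat h (F.hess 1 0 t)) (flat h (F.hess 0 1 t))
        (flat h (F.hess 1 1 t)) (trace h .bot (F.val t)) (trace h .top (F.val t))
        (trace h .bot (F.grad 0 t)) (trace h .top (F.grad 0 t))
        (trace h .bot (F.grad 1 t)) (trace h .top (F.grad 1 t)) := by
  filter_upwards [ae_restrict_mem measurableSet_Ioi, F.val_L2.ae_memLp, (F.grad_L2 0).ae_memLp,
    (F.grad_L2 1).ae_memLp, (F.hess_L2 0 0).ae_memLp, (F.hess_L2 1 0).ae_memLp,
    (F.hess_L2 0 1).ae_memLp, (F.hess_L2 1 1).ae_memLp, F.weak_grad 0, F.weak_grad 1,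
    F.weak_hess 0 0, F.weak_hess 1 0, F.weak_hess 0 1, F.weak_hess 1 1]
    with t ht m m₀ m₁ m₀₀ m₁₀ m₀₁ m₁₁ w₀ w₁ w₀₀ w₁₀ w₀₁ w₁₁
  have hper := F.periodic t ht
  exact ⟨H1.of_weak hΓ hp w₀ w₁ (ae_of_all _ hper) m m₀ m₁,
    H1.of_weak hΓ hp w₀₀ w₁₀ (w₀.periodic hp hper) m₀ m₀₀ m₁₀,
    H1.of_weak hΓ hp w₀₁ w₁₁ (w₁.periodic hp hper) m₁ m₀₁ m₁₁⟩

theorem lineElement_pos (h : ℝ → ℝ) (x : ℝ) : 0 < lineElement h x :=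
  Real.sqrt_pos.2 (by positivity)

theorem lineElement_sq (h : ℝ → ℝ) (x : ℝ) : lineElement h x ^ 2 = 1 + deriv h x ^ 2 :=
  Real.sq_sqrt (by positivity)

theorem curvature_eq (h : ℝ → ℝ) (w : Wall) (x : ℝ) :
    curvature h w x = w.sign * (deriv (deriv h) x / lineElement h x ^ 3) := by
  have : (1 + deriv h x ^ 2) ^ (3 / 2 : ℝ) = lineElement h x ^ 3 := by
    rw [lineElement, Real.sqrt_eq_rpow, ← Real.rpow_natCast (_ ^ (1 / 2 : ℝ)) 3,
      ← Real.rpow_mul (by positivity)]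
    norm_num
  rw [curvature, this, mul_div_assoc]

theorem Wall.sign_sq (w : Wall) : w.sign ^ 2 = 1 := by cases w <;> simp [Wall.sign]

theorem Wall.abs_sign (w : Wall) : |w.sign| = 1 := by cases w <;> simp [Wall.sign]

theorem no_penetration_iff (w : Wall) (x : ℝ) (b : Fin 2 → ℝ) :
    ∑ i, normal h w x i * b i = 0 ↔ b 1 - deriv h x * b 0 = 0 := by
  have hL := (lineElement_pos h x).ne'
  have hs : w.sign ≠ 0 := by cases w <;> simp [Wall.sign]
  have : ∑ i, normal h w x i * b i = w.sign / lineElement h x * (b 1 - deriv h x * b 0) := by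
    simp only [Fin.sum_univ_two, normal, Matrix.cons_val_zero, Matrix.cons_val_one]
    ring
  rw [this, mul_eq_zero, or_iff_right (div_ne_zero hs hL)]

/-- The slip condition in terms of `h'`. -/
theorem slip_iff (w : Wall) (x a : ℝ) (b : Fin 2 → ℝ) (g : Fin 2 → Fin 2 → ℝ)
    (hb : b 1 - deriv h x * b 0 = 0) :
    ∑ i, ∑ j, tangent h w x i * ((1 / 2) * (g i j + g j i)) * normal h w x j +
      a * ∑ i, tangent h w x i * b i = 0 ↔
    2 * deriv h x * (g 0 0 - g 1 1) - (g 0 1 + g 1 0) * (1 - deriv h x ^ 2) =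
      w.sign * (2 * a * lineElement h x ^ 3 * b 0) := by
  have hL := (lineElement_pos h x).ne'
  have hL2 := lineElement_sq h x
  have hb1 : b 1 = deriv h x * b 0 := by linarith
  have hs := w.sign_sq
  have key : 2 * lineElement h x ^ 2 *
      (∑ i, ∑ j, tangent h w x i * ((1 / 2) * (g i j + g j i)) * normal h w x j +
      a * ∑ i, tangent h w x i * b i) =
      2 * deriv h x * (g 0 0 - g 1 1) - (g 0 1 + g 1 0) * (1 - deriv h x ^ 2) -
      w.sign * (2 * a * lineElement h x ^ 3 * b 0) := by
    have e3 : lineElement h x ^ 3 = lineElement h x * (1 + deriv h x ^ 2) := by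
      rw [← hL2]; ring
    simp only [Fin.sum_univ_two, tangent, normal, Matrix.cons_val_zero, Matrix.cons_val_one, hb1]
    rw [e3]
    field_simp
    linear_combination (2 * deriv h x * (g 0 0 - g 1 1) -
      (g 0 1 + g 1 0) * (1 - deriv h x ^ 2)) * hs
  have h2 : 2 * lineElement h x ^ 2 ≠ 0 := by positivity
  rw [← sub_eq_zero (b := w.sign * _), ← key, mul_eq_zero, or_iff_right h2]

end Fields

namespace StrongSolution

variable {Γ : ℝ} {h : ℝ → ℝ} {α : Wall → ℝ → ℝ} {Pr Ra : ℝ}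

theorem fluxDensity_eq (S : StrongSolution Γ h α Pr Ra) (t x : ℝ) :
    S.fluxDensity t x =
      deriv h x * trace h .bot (S.T.grad 0 t) x - trace h .bot (S.T.grad 1 t) x := by
  have hL := (lineElement_pos h x).ne'
  simp only [fluxDensity, Fin.sum_univ_two, normal, Matrix.cons_val_zero, Matrix.cons_val_one,
    Wall.sign]
  field_simp
  ring

theorem ae_heatSlice (S : StrongSolution Γ h α Pr Ra) (hΓ : 0 < Γ) (hp : IsProfile Γ h) :
    ∀ᵐ t ∂volume.restrict (Ioi (0 : ℝ)),
      HeatSlice Γ h (flat h (S.T.val t)) (flat h (S.T.grad 0 t)) (flat h (S.T.grad 1 t))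
        (flat h (S.T.hess 0 0 t)) (flat h (S.T.hess 1 0 t)) (flat h (S.T.hess 0 1 t))
        (flat h (S.T.hess 1 1 t)) (flat h (S.T.dt t))
        (flat h ((S.u 0).val t)) (flat h ((S.u 0).grad 0 t)) (flat h ((S.u 0).grad 1 t))
        (flat h ((S.u 1).val t)) (flat h ((S.u 1).grad 0 t)) (flat h ((S.u 1).grad 1 t))
        (trace h .bot (S.T.grad 0 t)) (trace h .top (S.T.grad 0 t))
        (trace h .bot (S.T.grad 1 t)) (trace h .top (S.T.grad 1 t))
        (trace h .bot ((S.u 0).val t)) (trace h .top ((S.u 0).val t))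
        (trace h .bot ((S.u 1).val t)) (trace h .top ((S.u 1).val t)) := by
  have hc := hp.continuous
  filter_upwards [S.T.ae_H2 hΓ hp, (S.u 0).ae_H2 hΓ hp, (S.u 1).ae_H2 hΓ hp, S.T.dt_L2.ae_memLp,
    S.divergence_free, S.heat, S.T_bot, S.T_top, S.no_penetration .bot, S.no_penetration .top]
    with t hT hu hv hTt hd he hb ht nb nt
  refine ⟨hT.val.congr_trace hb ht, hT.grad₀, hT.grad₁, memLp_flat hc hTt, hu.val, hv.val, ?_, ?_,
    ?_, ?_⟩
  · filter_upwards [ae_flat hc hd] with q hq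
    simpa [Fin.sum_univ_two, flat] using hq
  · filter_upwards [nb] with x hx using (no_penetration_iff .bot x _).1 hx
  · filter_upwards [nt] with x hx using (no_penetration_iff .top x _).1 hx
  · filter_upwards [ae_flat hc he] with q hq
    simpa [Fin.sum_univ_two, flat] using hq

theorem ae_momentum_energy (S : StrongSolution Γ h α Pr Ra) (hΓ : 0 < Γ) (hp : IsProfile Γ h)
    (hα : ∀ w : Wall, ∀ᵐ x ∂volume.restrict (Ioo 0 Γ), 0 < α w x)
    (hκ : ∀ w : Wall, ∀ᵐ x ∂volume.restrict (Ioo 0 Γ), |curvature h w x| ≤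
      2 * α w x + 1 / (4 * Real.sqrt (1 + deriv h x ^ 2)) * min 1 (Real.sqrt (α w x))) :
    ∀ᵐ t ∂volume.restrict (Ioi (0 : ℝ)),
      Pr⁻¹ * ((∫ q, flat h ((S.u 0).dt t) q * flat h ((S.u 0).val t) q ∂cellMeasure Γ) +
        ∫ q, flat h ((S.u 1).dt t) q * flat h ((S.u 1).val t) q ∂cellMeasure Γ) +
      1 / 2 * ∫ q, (flat h ((S.u 0).grad 1 t) q ^ 2 + flat h ((S.u 1).grad 1 t) q ^ 2)
        ∂cellMeasure Γ ≤
      Ra * ∫ q, flat h (S.T.val t) q * flat h ((S.u 1).val t) q ∂cellMeasure Γ := by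
  have hc := hp.continuous
  obtain ⟨K, hK⟩ := hp.lipschitz_deriv
  have hκ' : ∀ w : Wall, ∀ᵐ x ∂volume.restrict (Ioo 0 Γ),
      |deriv (deriv h) x / lineElement h x ^ 3| ≤
      2 * α w x + 1 / (4 * lineElement h x) * min 1 (Real.sqrt (α w x)) := fun w => by
    filter_upwards [hκ w] with x hx
    rwa [curvature_eq, abs_mul, w.abs_sign, one_mul] at hx
  filter_upwards [S.T.ae_H2 hΓ hp, (S.u 0).ae_H2 hΓ hp, (S.u 1).ae_H2 hΓ hp,
    (S.u 0).dt_L2.ae_memLp, (S.u 1).dt_L2.ae_memLp, S.divergence_free,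
    S.no_penetration .bot, S.no_penetration .top, S.p_L2, (S.gradp_L2 0).ae_memLp,
    (S.gradp_L2 1).ae_memLp, S.weak_gradp 0, S.weak_gradp 1, S.momentum 0, S.momentum 1,
    S.slip .bot, S.slip .top, ae_restrict_mem measurableSet_Ioi]
    with t hT hu hv hut hvt hd nb nt mp mp₀ mp₁ wp₀ wp₁ e₀ e₁ sb st ht
  have nb' : ∀ᵐ x ∂volume.restrict (Ioo 0 Γ), trace h .bot ((S.u 1).val t) x -
      deriv h x * trace h .bot ((S.u 0).val t) x = 0 := by
    filter_upwards [nb] with x hx using (no_penetration_iff .bot x _).1 hx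
  have nt' : ∀ᵐ x ∂volume.restrict (Ioo 0 Γ), trace h .top ((S.u 1).val t) x -
      deriv h x * trace h .top ((S.u 0).val t) x = 0 := by
    filter_upwards [nt] with x hx using (no_penetration_iff .top x _).1 hx
  refine momentum_energy (a := α .bot) (a' := α .top) (L := lineElement h) (M := K) hΓ hp hu hv
    (H1.of_weak hΓ hp wp₀ wp₁ (ae_of_all _ (S.p_periodic t ht)) mp mp₀ mp₁)
    (memLp_flat hc hut) (memLp_flat hc hvt) hT.val.mem ?_ nb' nt' ?_ ?_
    (fun x => (lineElement_pos h x).le) (lineElement_sq h) ?_ (hκ' .bot) (hκ' .top) ?_ ?_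
    (ae_of_all _ fun x => norm_deriv_le_of_lipschitz hK)
  · filter_upwards [ae_flat hc hd] with q hq
    simpa [Fin.sum_univ_two, flat] using hq
  · filter_upwards [ae_flat hc e₀] with q hq
    simpa [Fin.sum_univ_two, flat] using hq
  · filter_upwards [ae_flat hc e₁] with q hq
    simpa [Fin.sum_univ_two, flat] using hq
  · filter_upwards [hα .bot, hα .top] with x h1 h2 using ⟨h1.le, h2.le⟩
  · filter_upwards [sb, nb'] with x hx hn
    have := (slip_iff .bot x (α .bot x) (fun i => trace h .bot ((S.u i).val t) x)
      (fun i j => trace h .bot ((S.u j).grad i t) x) hn).1 hx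
    simp only [Wall.sign] at this
    linarith
  · filter_upwards [st, nt'] with x hx hn
    have := (slip_iff .top x (α .top x) (fun i => trace h .top ((S.u i).val t) x)
      (fun i j => trace h .top ((S.u j).grad i t) x) hn).1 hx
    simp only [Wall.sign] at this
    linarith

end StrongSolution

end RayleighBenard

namespace RayleighBenard

/-! ### Integration in time -/

/-- `f ∈ L²_loc((0,∞); L²(μ))` with weak time derivative `g ∈ L²_loc((0,∞); L²(μ))`. -/
structure TimeReg {X : Type*} [MeasurableSpace X] (μ : Measure X) (f g : ℝ → X → ℝ) : Prop where
  mem : ∀ a b : ℝ, 0 < a → a < b →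
    MemLp (Function.uncurry f) 2 ((volume.restrict (Ioo a b)).prod μ)
  mem_dt : ∀ a b : ℝ, 0 < a → a < b →
    MemLp (Function.uncurry g) 2 ((volume.restrict (Ioo a b)).prod μ)
  ftc : ∀ s t : ℝ, 0 < s → s ≤ t → ∀ᵐ x ∂μ, f t x - f s x = ∫ r in s..t, g r x

theorem exists_of_ae_Ioo {a b : ℝ} (hab : a < b) {p : ℝ → Prop}
    (hp : ∀ᵐ t ∂volume.restrict (Ioo a b), p t) : ∃ t ∈ Ioo a b, p t := by
  have : (ae (volume.restrict (Ioo a b))).NeBot := ae_neBot.2 (by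
    rw [Ne, Measure.restrict_eq_zero]; simp [hab])
  obtain ⟨t, h1, h2⟩ := (hp.and (ae_restrict_mem measurableSet_Ioo)).exists
  exact ⟨t, h2, h1⟩

theorem integral_time_eq {X : Type*} [MeasurableSpace X] {μ : Measure X} [SFinite μ] {s t : ℝ}
    {K : ℝ → X → ℝ} {A : X → ℝ}
    (hK : Integrable (Function.uncurry K) ((volume.restrict (Ioo s t)).prod μ))
    (hA : ∀ᵐ x ∂μ, ∫ r in Ioo s t, K r x = A x) :
    IntegrableOn (fun r => ∫ x, K r x ∂μ) (Ioo s t) ∧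
      ∫ r in Ioo s t, ∫ x, K r x ∂μ = ∫ x, A x ∂μ :=
  ⟨hK.integral_prod_left, (integral_integral_swap hK).trans (integral_congr_ae hA)⟩

namespace TimeReg

variable {X : Type*} [MeasurableSpace X] {μ : Measure X} [IsFiniteMeasure μ] {f g : ℝ → X → ℝ}
  {s t : ℝ}

theorem exists_memLp (H : TimeReg μ f g) {a b : ℝ} (ha : 0 < a) (hab : a < b) :
    ∃ r ∈ Ioo a b, MemLp (f r) 2 μ := by
  refine exists_of_ae_Ioo hab ?_
  have h1 := H.mem a b ha hab
  filter_upwards [h1.1.prodMk_left, h1.integrable_sq.prod_right_ae] with t h2 h3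
  exact (memLp_two_iff_integrable_sq h2).2 h3

theorem integrable_dt (H : TimeReg μ f g) (hs : 0 < s) (hst : s < t) :
    Integrable (Function.uncurry g) ((volume.restrict (Ioo s t)).prod μ) :=
  (H.mem_dt s t hs hst).integrable (by norm_num)

/-- Joint measurability gives only almost every time. The value at an arbitrary t is the value at a
good earlier time plus an integral of the time derivative. -/
theorem aestronglyMeasurable (H : TimeReg μ f g) (ht : 0 < t) : AEStronglyMeasurable (f t) μ := by
  obtain ⟨r, hr, hm⟩ := H.exists_memLp (half_pos ht) (half_lt_self ht)
  have hr0 : 0 < r := (half_pos ht).trans hr.1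
  have h1 : AEStronglyMeasurable (fun x => f r x + ∫ ρ in Ioo r t, g ρ x) μ :=
    hm.1.add (H.integrable_dt hr0 hr.2).1.prod_swap.integral_prod_right'
  refine h1.congr ?_
  filter_upwards [H.ftc r t hr0 hr.2.le] with x hx
  rw [← integral_Ioc_eq_integral_Ioo, ← intervalIntegral.integral_of_le hr.2.le, ← hx]
  ring

/-- The variable upper limit is written as an indicator so that joint measurability follows from
measurability of parametrised integrals. -/
theorem aestronglyMeasurable_primitive (H : TimeReg μ f g) (hs : 0 < s) (hst : s < t) :
    AEStronglyMeasurable (fun q : ℝ × X => ∫ ρ in Ioo s t, (if ρ < q.1 then 1 else 0) * g ρ q.2)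
      ((volume.restrict (Ioo s t)).prod μ) := by
  have hg := (H.integrable_dt hs hst).1
  have hq : Measure.QuasiMeasurePreserving
      (fun y : (ℝ × X) × ℝ => (y.2, y.1.2))
      (((volume.restrict (Ioo s t)).prod μ).prod (volume.restrict (Ioo s t)))
      ((volume.restrict (Ioo s t)).prod μ) :=
    Measure.measurePreserving_swap.quasiMeasurePreserving.comp
      (QuasiMeasurePreserving.prodMap Measure.quasiMeasurePreserving_snd
        (Measure.QuasiMeasurePreserving.id _))
  have h1 : AEStronglyMeasurable
      (fun y : (ℝ × X) × ℝ => (if y.2 < y.1.1 then (1 : ℝ) else 0) * g y.2 y.1.2)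
      (((volume.restrict (Ioo s t)).prod μ).prod (volume.restrict (Ioo s t))) := by
    refine AEStronglyMeasurable.mul ?_ (hg.comp_quasiMeasurePreserving hq)
    exact (Measurable.ite (measurableSet_lt measurable_snd (measurable_fst.comp measurable_fst))
      measurable_const measurable_const).aestronglyMeasurable
  exact h1.integral_prod_right'

/-- For almost every `x` the function `f · x` is absolutely continuous in time. -/
theorem acRep (H : TimeReg μ f g) (hs : 0 < s) (hst : s < t) :
    ∀ᵐ x ∂μ, ACRep s t (fun r => f r x) (fun r => g r x) (f s x) (f t x) := by
  have hl : AEStronglyMeasurable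
      (fun q : ℝ × X => f s q.2 + ∫ ρ in Ioo s t, (if ρ < q.1 then 1 else 0) * g ρ q.2)
      ((volume.restrict (Ioo s t)).prod μ) :=
    ((H.aestronglyMeasurable hs).comp_quasiMeasurePreserving
      Measure.quasiMeasurePreserving_snd).add (H.aestronglyMeasurable_primitive hs hst)
  have hk := (H.mem s t hs hst).1
  have hpr : ∀ r ∈ Ioo s t, ∀ x, ∫ ρ in Ioo s t, (if ρ < r then 1 else 0) * g ρ x =
      ∫ ρ in s..r, g ρ x := by
    intro r hr x
    rw [intervalIntegral.integral_of_le hr.1.le, integral_Ioc_eq_integral_Ioo,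
      setIntegral_eq_of_subset_of_forall_sdiff_eq_zero (s := Ioo s r)
        (f := fun ρ => (if ρ < r then 1 else 0) * g ρ x) measurableSet_Ioo
        (Ioo_subset_Ioo_right hr.2.le)]
    · refine setIntegral_congr_fun measurableSet_Ioo fun ρ hρ => ?_
      simp [hρ.2]
    · rintro ρ ⟨hρ, hn⟩
      have : ¬ ρ < r := fun hlt => hn ⟨hρ.1, hlt⟩
      simp [this]
  have hae : ∀ᵐ r ∂volume.restrict (Ioo s t), ∀ᵐ x ∂μ, f r x = f s x +
      ∫ ρ in Ioo s t, (if ρ < r then 1 else 0) * g ρ x := by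
    filter_upwards [ae_restrict_mem measurableSet_Ioo] with r hr
    filter_upwards [H.ftc s r hs hr.1.le] with x hx
    rw [hpr r hr, ← hx]; ring
  -- For each time the formula holds outside a null set of x that depends on the time. Two
  -- inequalities on the product space allow the order of the quantifiers to be exchanged.
  have h1 := ae_prod_le_of_ae_ae_le hk.aemeasurable hl.aemeasurable (by
    filter_upwards [hae] with r hr
    filter_upwards [hr] with x hx using hx.le)
  have h2 := ae_prod_le_of_ae_ae_le hl.aemeasurable hk.aemeasurable (by
    filter_upwards [hae] with r hr
    filter_upwards [hr] with x hx using hx.ge)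
  have h3 := (Measure.measurePreserving_swap (μ := μ)
    (ν := volume.restrict (Ioo s t))).quasiMeasurePreserving.ae (h1.and h2)
  filter_upwards [Measure.ae_ae_of_ae_prod h3, (H.integrable_dt hs hst).prod_left_ae,
    H.ftc s t hs hst.le] with x hx hgi hst'
  have h4 := ACRep.of_integral (f := fun r => f r x) (g := fun r => g r x) (α := f s x) hst
    ((intervalIntegrable_iff_integrableOn_Ioo_of_le hst.le).2 hgi) (by
    filter_upwards [hx, ae_restrict_mem measurableSet_Ioo] with r hr hm
    have h5 := le_antisymm hr.1 hr.2
    simp only [Prod.swap_prod_mk] at h5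
    rw [hpr r hm] at h5
    exact h5)
  rwa [← hst', add_sub_cancel] at h4

/-- Square integrability is moved from a good earlier time r to t: the squared increment is at most
(t - r) times the time integral of g², by Cauchy–Schwarz. -/
theorem memLp (H : TimeReg μ f g) (ht : 0 < t) : MemLp (f t) 2 μ := by
  obtain ⟨r, hr, hm⟩ := H.exists_memLp (half_pos ht) (half_lt_self ht)
  have hr0 : 0 < r := (half_pos ht).trans hr.1
  have i1 := (H.mem_dt r t hr0 hr.2).integrable_sq
  have hd : MemLp (fun x => f t x - f r x) 2 μ := by
    have ms : AEStronglyMeasurable (fun x => f t x - f r x) μ :=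
      (H.aestronglyMeasurable ht).sub hm.1
    rw [memLp_two_iff_integrable_sq ms]
    refine (i1.integral_prod_right.const_mul (t - r)).mono' (ms.pow 2) ?_
    filter_upwards [H.acRep hr0 hr.2, i1.prod_left_ae] with x h1 h2
    rw [Real.norm_eq_abs, abs_of_nonneg (sq_nonneg _)]
    exact h1.sq_endpoints_le h2
  have := hd.add hm
  refine this.ae_eq (ae_of_all _ fun x => ?_)
  simp

theorem integral_linear (H : TimeReg μ f g) (hs : 0 < s) (hst : s < t) {ζ : X → ℝ} {C : ℝ}
    (hζ : AEStronglyMeasurable ζ μ) (hC : ∀ᵐ x ∂μ, |ζ x| ≤ C) :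
    IntegrableOn (fun r => ∫ x, g r x * ζ x ∂μ) (Ioo s t) ∧
      ∫ r in Ioo s t, ∫ x, g r x * ζ x ∂μ = ∫ x, (f t x - f s x) * ζ x ∂μ := by
  refine integral_time_eq ((H.integrable_dt hs hst).mul_bdd (c := C)
    (hζ.comp_quasiMeasurePreserving Measure.quasiMeasurePreserving_snd)
    (Measure.quasiMeasurePreserving_snd.ae hC)) ?_
  filter_upwards [H.acRep hs hst] with x hx
  rw [integral_mul_const, hx.setIntegral_eq]

theorem integral_sq (H : TimeReg μ f g) (hs : 0 < s) (hst : s < t) :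
    IntegrableOn (fun r => ∫ x, g r x * f r x ∂μ) (Ioo s t) ∧
      ∫ r in Ioo s t, ∫ x, g r x * f r x ∂μ =
        1 / 2 * ((∫ x, f t x ^ 2 ∂μ) - ∫ x, f s x ^ 2 ∂μ) := by
  have h1 := integral_time_eq (K := fun r x => g r x * f r x)
    (A := fun x => 1 / 2 * (f t x ^ 2 - f s x ^ 2))
    (integrable_mul_of_memLp (H.mem_dt s t hs hst) (H.mem s t hs hst)) (by
      filter_upwards [H.acRep hs hst] with x hx
      have h2 := ((hx.mul hx).const_mul (1 / 2)).setIntegral_eq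
      have h3 : 1 / 2 * (f t x ^ 2 - f s x ^ 2) =
        1 / 2 * (f t x * f t x) - 1 / 2 * (f s x * f s x) := by ring
      rw [h3, ← h2]
      refine integral_congr_ae (ae_of_all _ fun r => ?_)
      ring)
  refine ⟨h1.1, h1.2.trans ?_⟩
  rw [integral_const_mul, integral_sub (H.memLp (hs.trans hst)).integrable_sq
    (H.memLp hs).integrable_sq]

theorem integral_comp (H : TimeReg μ f g) (hs : 0 < s) (hst : s < t) {Φ Φ' : ℝ → ℝ} {K : NNReal}
    (hL : LipschitzWith K Φ) (hΦ : ∀ y, HasDerivAt Φ (Φ' y) y) (hc : Continuous Φ') :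
    ∫ r in Ioo s t, ∫ x, g r x * Φ' (f r x) ∂μ = ∫ x, (Φ (f t x) - Φ (f s x)) ∂μ := by
  have hb : ∀ y, ‖Φ' y‖ ≤ K := fun y => by
    rw [← (hΦ y).deriv]; exact norm_deriv_le_of_lipschitz hL
  refine (integral_time_eq (K := fun r x => g r x * Φ' (f r x))
    ((H.integrable_dt hs hst).mul_bdd (c := K)
      (hc.comp_aestronglyMeasurable (H.mem s t hs hst).1) (ae_of_all _ fun q => hb _)) ?_).2
  filter_upwards [H.acRep hs hst] with x hx
  rw [← (hx.comp hL hΦ).setIntegral_eq]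
  refine integral_congr_ae (ae_of_all _ fun r => ?_)
  ring

end TimeReg

section Fields

variable {Γ : ℝ} {h : ℝ → ℝ}

theorem LocL2.flat {f : ℝ → ℝ × ℝ → ℝ} (hc : Continuous h) (H : LocL2 Γ h f) (a b : ℝ)
    (ha : 0 < a) (hab : a < b) :
    MemLp (Function.uncurry fun t => flat h (f t)) 2
      ((volume.restrict (Ioo a b)).prod (cellMeasure Γ)) :=
  (H a b ha hab).comp_measurePreserving
    ((MeasurePreserving.id _).prod (measurePreserving_shear_cell hc))

theorem StrongField.timeReg (hp : IsProfile Γ h) (F : StrongField Γ h) :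
    TimeReg (cellMeasure Γ) (fun t => flat h (F.val t)) (fun t => flat h (F.dt t)) :=
  ⟨F.val_L2.flat hp.continuous, F.dt_L2.flat hp.continuous,
    fun s t hs hst => ae_flat hp.continuous (F.time_deriv s t hs hst)⟩

theorem StrongField.tendsto_initial (hp : IsProfile Γ h) (F : StrongField Γ h) :
    Tendsto (fun t : ℝ => eLpNorm (flat h (F.val t) - flat h (F.val 0)) 2 (cellMeasure Γ))
      (𝓝[>] (0 : ℝ)) (𝓝 0) := by
  have hc := hp.continuous
  have := F.initial
  rw [← (measurePreserving_shear_cell (Γ := Γ) hc).map_eq] at this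
  refine this.congr fun t => ?_
  rw [(shear h hc).measurableEmbedding.eLpNorm_map_measure]
  rfl

end Fields

end RayleighBenard

namespace RayleighBenard

/-! ### The maximum principle -/

/-- The kink of the positive part at 0 is harmless because q' vanishes there. This yields C¹
truncations, as required by the chain rule along lines. -/
theorem hasDerivAt_comp_max {q q' : ℝ → ℝ} (hq : ∀ x, HasDerivAt q (q' x) x) (h0 : q' 0 = 0)
    (s : ℝ) : HasDerivAt (fun s => q (max s 0)) (q' (max s 0)) s := by
  rcases lt_trichotomy s 0 with h | rfl | h
  · rw [max_eq_right h.le, h0]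
    refine (hasDerivAt_const s (q 0)).congr_of_eventuallyEq ?_
    filter_upwards [Iio_mem_nhds h] with y hy
    rw [max_eq_right (le_of_lt hy)]
  · have h1 : HasDerivWithinAt (fun s => q (max s 0)) (q' (max 0 0)) (Iic 0) 0 := by
      rw [max_self, h0]
      refine (hasDerivWithinAt_const (0 : ℝ) (Iic 0) (q 0)).congr (fun y hy => ?_) (by simp)
      rw [max_eq_right hy]
    have h2 : HasDerivWithinAt (fun s => q (max s 0)) (q' (max 0 0)) (Ici 0) 0 := by
      rw [max_self]
      refine (hq 0).hasDerivWithinAt.congr (fun y hy => ?_) (by simp)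
      rw [max_eq_left hy]
    have h3 := h1.union h2
    rwa [Iic_union_Ici, hasDerivWithinAt_univ] at h3
  · rw [max_eq_left h.le]
    refine (hq s).congr_of_eventuallyEq ?_
    filter_upwards [Ioi_mem_nhds h] with y hy
    rw [max_eq_left (le_of_lt hy)]

theorem hasDerivAt_sq_div (x : ℝ) :
    HasDerivAt (fun x : ℝ => x ^ 2 / (1 + x ^ 2)) (2 * x / (1 + x ^ 2) ^ 2) x := by
  have h1 : HasDerivAt (fun x : ℝ => x ^ 2) (2 * x) x := by simpa using hasDerivAt_pow 2 x
  have h2 := h1.div (h1.const_add 1) (by positivity)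
  refine h2.congr_deriv ?_
  congr 1
  ring

theorem hasDerivAt_sub_arctan (x : ℝ) :
    HasDerivAt (fun x : ℝ => x - Real.arctan x) (x ^ 2 / (1 + x ^ 2)) x := by
  refine ((hasDerivAt_id' x).sub (Real.hasDerivAt_arctan x)).congr_deriv ?_
  have : 1 + x ^ 2 ≠ 0 := by positivity
  field_simp
  ring

theorem arctan_lt_self {x : ℝ} (hx : 0 < x) : Real.arctan x < x := by
  have := Real.lt_tan (Real.arctan_pos.2 hx) (Real.arctan_lt_pi_div_two x)
  rwa [Real.tan_arctan] at this

theorem lipschitz_of_hasDerivAt {q q' : ℝ → ℝ} (hq : ∀ x, HasDerivAt q (q' x) x)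
    (hb : ∀ x, |q' x| ≤ 1) : LipschitzWith 1 q := by
  refine lipschitzWith_of_nnnorm_deriv_le (fun x => (hq x).differentiableAt) fun x => ?_
  rw [(hq x).deriv, ← NNReal.coe_le_coe]
  simpa using hb x

section Slices

variable {Γ : ℝ} {h : ℝ → ℝ} {α : Wall → ℝ → ℝ} {Pr Ra : ℝ}

/-- The maximum principle, for both bounds at once: `s` is a sign. -/
theorem StrongSolution.ae_mul_sub_nonpos (S : StrongSolution Γ h α Pr Ra) (hΓ : 0 < Γ)
    (hp : IsProfile Γ h) {s k : ℝ} (hs : s * s = 1) (h0 : s * (0 - k) ≤ 0) (h1 : s * (1 - k) ≤ 0)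
    (hT0 : ∀ᵐ q ∂cellMeasure Γ, s * (flat h (S.T.val 0) q - k) ≤ 0) {t : ℝ} (ht : 0 < t) :
    ∀ᵐ q ∂cellMeasure Γ, s * (flat h (S.T.val t) q - k) ≤ 0 := by
  -- P is bounded, nondecreasing and C¹ with bounded derivative, hence admissible as a test before T
  -- is known to be bounded. Q is its primitive, and it vanishes exactly on (-∞, 0].
  set P : ℝ → ℝ := fun y => max y 0 ^ 2 / (1 + max y 0 ^ 2)
  set P' : ℝ → ℝ := fun y => 2 * max y 0 / (1 + max y 0 ^ 2) ^ 2
  set Q : ℝ → ℝ := fun y => max y 0 - Real.arctan (max y 0)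
  have dP : ∀ y, HasDerivAt P (P' y) y := hasDerivAt_comp_max hasDerivAt_sq_div (by simp)
  have dQ : ∀ y, HasDerivAt Q (P y) y := hasDerivAt_comp_max hasDerivAt_sub_arctan (by simp)
  have P0 : ∀ y, 0 ≤ P y := fun y => by positivity
  have P1 : ∀ y, P y ≤ 1 := fun y => by
    simp only [P]
    rw [div_le_one (by positivity)]
    linarith
  have P'0 : ∀ y, 0 ≤ P' y := fun y => by
    have : 0 ≤ max y 0 := le_max_right _ _
    positivity
  have P'1 : ∀ y, P' y ≤ 1 := fun y => by
    have : 0 ≤ max y 0 := le_max_right _ _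
    simp only [P']
    rw [div_le_one (by positivity)]
    nlinarith [sq_nonneg (max y 0 - 1), sq_nonneg (max y 0), sq_nonneg (max y 0 ^ 2)]
  have hs1 : |s| = 1 := by
    have : |s| * |s| = 1 := by rw [← abs_mul, hs, abs_one]
    nlinarith [abs_nonneg s]
  have lin : ∀ y, HasDerivAt (fun y => s * (y - k)) s y := fun y => by
    simpa using ((hasDerivAt_id' y).sub_const k).const_mul s
  have dΨ : ∀ y, HasDerivAt (fun y => Q (s * (y - k))) (s * P (s * (y - k))) y := fun y =>
    ((dQ _).comp y (lin y)).congr_deriv (by ring)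
  have dΦ : ∀ y, HasDerivAt (fun y => s * P (s * (y - k))) (P' (s * (y - k))) y := fun y =>
    (((dP _).comp y (lin y)).const_mul s).congr_deriv (by linear_combination P' (s * (y - k)) * hs)
  have bΦ : ∀ y, |s * P (s * (y - k))| ≤ 1 := fun y => by
    rw [abs_mul, hs1, one_mul, abs_of_nonneg (P0 _)]; exact P1 _
  have lΨ := lipschitz_of_hasDerivAt dΨ bΦ
  have lΦ := lipschitz_of_hasDerivAt dΦ fun y => by rw [abs_of_nonneg (P'0 _)]; exact P'1 _
  have cP' : Continuous P' := by
    refine Continuous.div (by fun_prop) (by fun_prop) fun y => by positivity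
  have cΦ' : Continuous fun y => P' (s * (y - k)) := cP'.comp (by fun_prop)
  have zP : ∀ y, y ≤ 0 → P y = 0 := fun y hy => by simp [P, max_eq_right hy]
  have Q0 : ∀ y, 0 ≤ Q y := fun y => by
    rcases (le_max_right y 0).eq_or_lt with h | h
    · simp [Q, ← h]
    · exact sub_nonneg.2 (arctan_lt_self h).le
  have Qle : ∀ y, Q y ≤ max y 0 := fun y =>
    sub_le_self _ (Real.arctan_nonneg.2 (le_max_right _ _))
  have R := S.T.timeReg hp
  have iΨ : ∀ {r : ℝ}, 0 < r →
      Integrable (fun q => Q (s * (flat h (S.T.val r) q - k))) (cellMeasure Γ) := by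
    intro r hr
    have m := R.memLp hr
    have i1 : Integrable (fun q => |flat h (S.T.val r) q - k|) (cellMeasure Γ) :=
      ((m.integrable (by norm_num)).sub (integrable_const k)).abs
    refine i1.mono' (lΨ.continuous.comp_aestronglyMeasurable m.1) (ae_of_all _ fun q => ?_)
    rw [Real.norm_eq_abs, abs_of_nonneg (Q0 _)]
    refine (Qle _).trans (max_le ((le_abs_self _).trans_eq ?_) (abs_nonneg _))
    rw [abs_mul, hs1, one_mul]
  -- The integral of Q decreases on positive times. As r → 0 it tends to 0, because Q is at most the
  -- positive part, which the initial bound and L² convergence control by |T(r) - T(0)|.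
  have mono : ∀ r ∈ Ioo 0 t, ∫ q, Q (s * (flat h (S.T.val t) q - k)) ∂cellMeasure Γ ≤
      ∫ q, Q (s * (flat h (S.T.val r) q - k)) ∂cellMeasure Γ := by
    intro r hr
    have e := R.integral_comp hr.1 hr.2 lΨ dΨ lΦ.continuous
    rw [integral_sub (iΨ ht) (iΨ hr.1)] at e
    have : ∫ r in Ioo r t, ∫ q, flat h (S.T.dt r) q * (s * P (s * (flat h (S.T.val r) q - k)))
        ∂cellMeasure Γ ≤ 0 := by
      refine integral_nonpos_of_ae ?_
      filter_upwards [ae_restrict_of_ae_restrict_of_subset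
        (fun x hx => mem_Ioi.2 (hr.1.trans hx.1)) (S.ae_heatSlice hΓ hp)] with r Sr
      exact Sr.integral_mul_comp_nonpos hp lΦ dΦ cΦ' (fun y => P'0 _) bΦ lΨ dΨ
        (by rw [zP _ h0, mul_zero]) (by rw [zP _ h1, mul_zero])
    linarith
  have key : ENNReal.ofReal (∫ q, Q (s * (flat h (S.T.val t) q - k)) ∂cellMeasure Γ) ≤ 0 := by
    have lim := ENNReal.Tendsto.mul_const (b := (cellMeasure Γ) univ ^ (1 / (1 : ℝ≥0∞).toReal -
      1 / (2 : ℝ≥0∞).toReal)) (S.T.tendsto_initial hp) (Or.inr (by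
        refine ENNReal.rpow_ne_top_of_nonneg (by norm_num) (measure_ne_top _ _)))
    rw [zero_mul] at lim
    refine ge_of_tendsto lim ?_
    filter_upwards [Ioo_mem_nhdsGT ht] with r hr
    refine (ENNReal.ofReal_le_ofReal (mono r hr)).trans ?_
    have hm : AEStronglyMeasurable (fun q => Q (s * (flat h (S.T.val r) q - k))) (cellMeasure Γ) :=
      (iΨ hr.1).1
    calc ENNReal.ofReal (∫ q, Q (s * (flat h (S.T.val r) q - k)) ∂cellMeasure Γ)
        ≤ ‖∫ q, Q (s * (flat h (S.T.val r) q - k)) ∂cellMeasure Γ‖ₑ := by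
          rw [Real.enorm_eq_ofReal_abs]; exact ENNReal.ofReal_le_ofReal (le_abs_self _)
      _ ≤ eLpNorm (fun q => Q (s * (flat h (S.T.val r) q - k))) 1 (cellMeasure Γ) := by
          rw [eLpNorm_one_eq_lintegral_enorm]; exact enorm_integral_le_lintegral_enorm _
      _ ≤ eLpNorm (fun q => Q (s * (flat h (S.T.val r) q - k))) 2 (cellMeasure Γ) *
          (cellMeasure Γ) univ ^ (1 / (1 : ℝ≥0∞).toReal - 1 / (2 : ℝ≥0∞).toReal) :=
          eLpNorm_le_eLpNorm_mul_rpow_measure_univ (by norm_num) hm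
      _ ≤ _ := by
          refine mul_le_mul_left (eLpNorm_mono_ae ?_) _
          filter_upwards [hT0] with q hq
          rw [Real.norm_eq_abs, abs_of_nonneg (Q0 _), Pi.sub_apply, Real.norm_eq_abs]
          refine (Qle _).trans (max_le ?_ (abs_nonneg _))
          calc s * (flat h (S.T.val r) q - k)
              ≤ s * (flat h (S.T.val r) q - flat h (S.T.val 0) q) := by linarith
            _ ≤ _ := (le_abs_self _).trans_eq (by rw [abs_mul, hs1, one_mul])
  have hz : ∫ q, Q (s * (flat h (S.T.val t) q - k)) ∂cellMeasure Γ = 0 :=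
    le_antisymm (ENNReal.ofReal_eq_zero.1 (le_zero_iff.1 key)) (integral_nonneg fun q => Q0 _)
  filter_upwards [(integral_eq_zero_iff_of_nonneg (fun q => Q0 _) (iΨ ht)).1 hz] with q hq
  by_contra hn
  have h2 : 0 < max (s * (flat h (S.T.val t) q - k)) 0 := lt_max_of_lt_left (not_le.1 hn)
  have h3 := arctan_lt_self h2
  simp only [Q, Pi.zero_apply] at hq
  linarith

theorem StrongSolution.ae_temperature_mem (S : StrongSolution Γ h α Pr Ra) (hΓ : 0 < Γ)
    (hp : IsProfile Γ h)
    (hT0 : ∀ᵐ y ∂volume.restrict (cell Γ h), 0 ≤ S.T.val 0 y ∧ S.T.val 0 y ≤ 1) {t : ℝ}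
    (ht : 0 < t) : ∀ᵐ q ∂cellMeasure Γ, 0 ≤ flat h (S.T.val t) q ∧ flat h (S.T.val t) q ≤ 1 := by
  have h0 := ae_flat hp.continuous hT0
  have hu := S.ae_mul_sub_nonpos hΓ hp (s := 1) (k := 1) (by norm_num) (by norm_num) (by norm_num)
    (by filter_upwards [h0] with q hq; simp only [flat]; linarith [hq.2]) ht
  have hl := S.ae_mul_sub_nonpos hΓ hp (s := -1) (k := 0) (by norm_num) (by norm_num) (by norm_num)
    (by filter_upwards [h0] with q hq; simp only [flat]; linarith [hq.1]) ht
  filter_upwards [hu, hl] with q h1 h2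
  constructor <;> linarith

/-- The velocity is bounded in `L²` for small times. -/
theorem StrongField.exists_bound_near_zero (hp : IsProfile Γ h) (F : StrongField Γ h)
    (h0 : MemLp (F.val 0) 2 (volume.restrict (cell Γ h))) :
    ∃ U : ℝ, ∀ᶠ s in 𝓝[>] (0 : ℝ), ∫ q, flat h (F.val s) q ^ 2 ∂cellMeasure Γ ≤ U := by
  have m0 := memLp_flat hp.continuous h0
  refine ⟨2 * 1 + 2 * ∫ q, flat h (F.val 0) q ^ 2 ∂cellMeasure Γ, ?_⟩
  filter_upwards [(F.tendsto_initial hp).eventually_le_const zero_lt_one, self_mem_nhdsWithin]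
    with s hs hs0
  have ms := (F.timeReg hp).memLp (mem_Ioi.1 hs0)
  have md : MemLp (flat h (F.val s) - flat h (F.val 0)) 2 (cellMeasure Γ) := ms.sub m0
  have e1 : ∫ q, (flat h (F.val s) q - flat h (F.val 0) q) ^ 2 ∂cellMeasure Γ ≤ 1 := by
    rw [md.eLpNorm_eq_integral_rpow_norm (by norm_num) (by norm_num)] at hs
    have h2 := ENNReal.ofReal_le_one.1 hs
    simp only [ENNReal.toReal_ofNat, Real.rpow_ofNat, Real.norm_eq_abs, sq_abs, Pi.sub_apply] at h2
    have h3 : 0 ≤ ∫ q, (flat h (F.val s) q - flat h (F.val 0) q) ^ 2 ∂cellMeasure Γ :=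
      integral_nonneg fun q => sq_nonneg _
    by_contra hn
    have h4 := Real.one_lt_rpow (not_le.1 hn) (z := (2 : ℝ)⁻¹) (by norm_num)
    linarith
  have e2 : ∫ q, flat h (F.val s) q ^ 2 ∂cellMeasure Γ ≤
      ∫ q, (2 * (flat h (F.val s) q - flat h (F.val 0) q) ^ 2 + 2 * flat h (F.val 0) q ^ 2)
        ∂cellMeasure Γ := by
    refine integral_mono ms.integrable_sq
      ((md.integrable_sq.const_mul 2).add (m0.integrable_sq.const_mul 2)) fun q => ?_
    simp only
    nlinarith [sq_nonneg (flat h (F.val s) q - 2 * flat h (F.val 0) q)]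
  have e3 : ∫ q, (2 * (flat h (F.val s) q - flat h (F.val 0) q) ^ 2 + 2 * flat h (F.val 0) q ^ 2)
      ∂cellMeasure Γ = 2 * (∫ q, (flat h (F.val s) q - flat h (F.val 0) q) ^ 2 ∂cellMeasure Γ) +
        2 * ∫ q, flat h (F.val 0) q ^ 2 ∂cellMeasure Γ := by
    rw [← integral_const_mul, ← integral_const_mul]
    exact integral_add (md.integrable_sq.const_mul 2) (m0.integrable_sq.const_mul 2)
  linarith

end Slices

end RayleighBenard

namespace RayleighBenard

/-! ### The bound on the Nusselt number -/

/-- With l = √Ra and δ = θ/√Ra the layer convection is θ/2 A₁ + θ/(2Ra) B₁. The energy balances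
bound it by (θ/2 + θ(1 + D²)(1 + 2M)) N plus time-derivative terms. The normalisation of θ makes
this coefficient exactly 1/2, so half of N is absorbed. -/
theorem combine_estimates {N X A A₁ B B₁ ET EU W Z c Ra D M θ R : ℝ} (hRa : 1 ≤ Ra) (hθ : 0 < θ)
    (hθ1 : θ * (1 + 2 * ((1 + D ^ 2) * (1 + 2 * M))) = 1)
    (h1 : ET + A = N) (h2 : c * EU + 1 / 2 * B ≤ Ra * W) (h3 : W ≤ Z + (1 + 2 * M) * N)
    (h4 : N ≤ X + θ / Real.sqrt Ra / 2 * (Real.sqrt Ra * A₁ + (Real.sqrt Ra)⁻¹ * B₁) + R)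
    (hA : A₁ ≤ A) (hB : B₁ ≤ (1 + D ^ 2) * B) :
    1 / 2 * N ≤ X + -(θ / 2) * ET + θ * (1 + D ^ 2) * Z + -(θ * (1 + D ^ 2) * c / Ra) * EU + R := by
  have hRa0 : 0 < Ra := by linarith
  have hsq : 0 < Real.sqrt Ra := Real.sqrt_pos.2 hRa0
  have hss : Real.sqrt Ra * Real.sqrt Ra = Ra := Real.mul_self_sqrt hRa0.le
  have e1 : θ / Real.sqrt Ra / 2 * (Real.sqrt Ra * A₁ + (Real.sqrt Ra)⁻¹ * B₁) =
      θ / 2 * A₁ + θ / (2 * Ra) * B₁ := by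
    have : θ / (2 * Ra) = θ / (2 * (Real.sqrt Ra * Real.sqrt Ra)) := by rw [hss]
    rw [this]; field_simp
  have e2 : θ / 2 * A₁ ≤ θ / 2 * A := mul_le_mul_of_nonneg_left hA (by positivity)
  have e3 : θ / (2 * Ra) * B₁ ≤ θ / (2 * Ra) * ((1 + D ^ 2) * (2 * (Ra * W - c * EU))) :=
    mul_le_mul_of_nonneg_left (hB.trans (mul_le_mul_of_nonneg_left (by linarith) (by positivity)))
      (by positivity)
  have e4 : θ / (2 * Ra) * ((1 + D ^ 2) * (2 * (Ra * W - c * EU))) =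
      θ * (1 + D ^ 2) * W - θ * (1 + D ^ 2) * c / Ra * EU := by field_simp
  have e5 : θ * (1 + D ^ 2) * W ≤ θ * (1 + D ^ 2) * (Z + (1 + 2 * M) * N) :=
    mul_le_mul_of_nonneg_left h3 (by positivity)
  rw [e1] at h4
  have e6 : N * (θ * (1 + 2 * ((1 + D ^ 2) * (1 + 2 * M)))) = N := by rw [hθ1, mul_one]
  have hA' : A = N - ET := by linarith
  rw [hA'] at e2
  linarith

/-- The quadratic terms at the final time (a, c, e) enter with a favourable sign and are dropped.
Those at the initial time (b, d, f) are bounded by the maximum principle and by the initial kinetic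
energy. -/
theorem combine_integrals {I X Z a b c d e f Γ U Pr Ra D M θ L : ℝ} (hRa : 1 ≤ Ra) (hPr : 0 < Pr)
    (hΓ : 0 < Γ) (hθ : 0 < θ) (hθ1 : θ ≤ 1) (hM : 0 ≤ M) (ha : 0 ≤ a) (hc : 0 ≤ c) (hd : 0 ≤ d)
    (he : 0 ≤ e) (hf : 0 ≤ f) (hX : X ≤ 1 * Γ) (hZ : Z ≤ 2 * (1 + M) * Γ) (hb : b ≤ 1 * Γ)
    (hU : d + f ≤ U)
    (h : 1 / 2 * I ≤ X + -(θ / 2) * (1 / 2 * (a - b)) + θ * (1 + D ^ 2) * Z +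
      -(θ * (1 + D ^ 2) * Pr⁻¹ / Ra) * (1 / 2 * (c - d) + 1 * (1 / 2 * (e - f))) + 1 * L) :
    I ≤ 2 * (Γ + Γ + (1 + D ^ 2) * (2 * (1 + M)) * Γ + (1 + D ^ 2) * Pr⁻¹ * U) + 2 * L := by
  have hRa0 : 0 < Ra := by linarith
  have hU0 : 0 ≤ U := by linarith
  have c1 : -(θ / 2) * (1 / 2 * (a - b)) ≤ Γ := by
    have h1 : θ * (b - a) ≤ θ * Γ := mul_le_mul_of_nonneg_left (by linarith) hθ.le
    have h2 : θ * Γ ≤ Γ := mul_le_of_le_one_left hΓ.le hθ1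
    linarith
  have c2 : θ * (1 + D ^ 2) * Z ≤ (1 + D ^ 2) * (2 * (1 + M)) * Γ := by
    calc _ ≤ θ * (1 + D ^ 2) * (2 * (1 + M) * Γ) := mul_le_mul_of_nonneg_left hZ (by positivity)
      _ ≤ 1 * (1 + D ^ 2) * (2 * (1 + M) * Γ) := by gcongr
      _ = _ := by ring
  have h1 : 0 ≤ θ * (1 + D ^ 2) * Pr⁻¹ / Ra := by positivity
  have h2 : θ * (1 + D ^ 2) * Pr⁻¹ / Ra ≤ (1 + D ^ 2) * Pr⁻¹ := by
    refine (div_le_self (by positivity) hRa).trans ?_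
    rw [mul_assoc]
    exact mul_le_of_le_one_left (by positivity) hθ1
  have c3 : -(θ * (1 + D ^ 2) * Pr⁻¹ / Ra) * (1 / 2 * (c - d) + 1 * (1 / 2 * (e - f))) ≤
      (1 + D ^ 2) * Pr⁻¹ * U := by
    calc _ ≤ θ * (1 + D ^ 2) * Pr⁻¹ / Ra * U := by
          rw [neg_mul, ← mul_neg]
          exact mul_le_mul_of_nonneg_left (by linarith) h1
      _ ≤ _ := mul_le_mul_of_nonneg_right h2 hU0
  linarith

/-! ### Bounds on the profile by ‖h'‖_∞ and ‖κ‖_∞ -/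

section Profile

variable {Γ : ℝ} {h : ℝ → ℝ}

theorem ae_abs_le_supNorm {f : ℝ → ℝ} {C : ℝ} (hC : ∀ᵐ x ∂volume.restrict (Ioo 0 Γ), |f x| ≤ C) :
    ∀ᵐ x ∂volume.restrict (Ioo 0 Γ), |f x| ≤ supNorm Γ f := by
  have hfin : eLpNorm f ∞ (volume.restrict (Ioo 0 Γ)) ≠ ⊤ := by
    rw [eLpNorm_exponent_top]
    exact (eLpNormEssSup_lt_top_of_ae_bound hC).ne
  filter_upwards [ae_le_eLpNormEssSup (f := f) (μ := volume.restrict (Ioo 0 Γ))] with x hx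
  rw [← eLpNorm_exponent_top] at hx
  rw [supNorm, ← Real.norm_eq_abs, ← toReal_enorm]
  exact ENNReal.toReal_mono hfin hx

theorem IsProfile.ae_abs_deriv_le (hp : IsProfile Γ h) :
    ∀ᵐ x ∂volume.restrict (Ioo 0 Γ), |deriv h x| ≤ supNorm Γ (deriv h) := by
  obtain ⟨D, hD⟩ := (isCompact_Icc (a := (0 : ℝ)) (b := Γ)).exists_bound_of_continuousOn
    hp.continuous_deriv.continuousOn
  refine ae_abs_le_supNorm (C := D) ?_
  filter_upwards [ae_restrict_mem measurableSet_Ioo] with x hx using hD x (Ioo_subset_Icc_self hx)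

theorem IsProfile.ae_abs_deriv_deriv_le (hp : IsProfile Γ h) {D : ℝ}
    (hD : ∀ᵐ x ∂volume.restrict (Ioo 0 Γ), |deriv h x| ≤ D) :
    ∀ᵐ x ∂volume.restrict (Ioo 0 Γ),
      |deriv (deriv h) x| ≤ (1 + D ^ 2) ^ 2 * curvatureNorm Γ h := by
  obtain ⟨K, hK⟩ := hp.lipschitz_deriv
  have one_le : ∀ x, 1 ≤ lineElement h x := fun x => by
    have := lineElement_sq h x
    nlinarith [lineElement_pos h x, sq_nonneg (deriv h x)]
  have hb : ∀ x, |curvature h .top x| ≤ K := fun x => by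
    have h1 : |deriv (deriv h) x| ≤ K := norm_deriv_le_of_lipschitz hK
    have h2 : 1 ≤ lineElement h x ^ 3 := one_le_pow₀ (one_le x)
    rw [curvature_eq, abs_mul, Wall.abs_sign, one_mul, abs_div,
      abs_of_pos (by positivity : 0 < lineElement h x ^ 3)]
    exact (div_le_self (abs_nonneg _) h2).trans h1
  filter_upwards [hD, ae_abs_le_supNorm (ae_of_all _ hb)] with x h1 h2
  have hL := one_le x
  have h3 : |curvature h .top x| ≤ curvatureNorm Γ h := h2.trans (le_max_right _ _)
  have h4 : deriv (deriv h) x = curvature h .top x * lineElement h x ^ 3 := by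
    have : lineElement h x ≠ 0 := (lineElement_pos h x).ne'
    rw [curvature_eq, Wall.sign]
    field_simp
  have h5 : lineElement h x ^ 3 ≤ (1 + D ^ 2) ^ 2 := by
    -- The exponent is raised from 3 to 4 so that the bound is polynomial in D.
    calc lineElement h x ^ 3 ≤ lineElement h x ^ 4 := pow_le_pow_right₀ hL (by norm_num)
      _ = (1 + deriv h x ^ 2) ^ 2 := by rw [← lineElement_sq]; ring
      _ ≤ (1 + D ^ 2) ^ 2 := by
        have : deriv h x ^ 2 ≤ D ^ 2 := sq_le_sq' (by linarith [(abs_le.1 h1).1]) (abs_le.1 h1).2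
        gcongr
  have h6 : 0 < lineElement h x ^ 3 := by positivity
  rw [h4, abs_mul, abs_of_pos h6, mul_comm]
  exact mul_le_mul h5 h3 (abs_nonneg _) (by positivity)

theorem IsProfile.abs_sub_le (hp : IsProfile Γ h) {D : ℝ} (hD0 : 0 ≤ D)
    (hD : ∀ᵐ x ∂volume.restrict (Ioo 0 Γ), |deriv h x| ≤ D) {x : ℝ} (hx : x ∈ Ioo 0 Γ) :
    |h x - h 0| ≤ D * Γ := by
  rw [← intervalIntegral.integral_deriv_eq_sub (fun y _ => hp.differentiable y)
    (hp.continuous_deriv.intervalIntegrable _ _)]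
  rw [ae_restrict_iff' measurableSet_Ioo] at hD
  have := intervalIntegral.norm_integral_le_of_norm_le_const_ae (a := 0) (b := x) (C := D)
    (f := deriv h) (by
      filter_upwards [hD] with y hy hm
      rw [uIoc_of_le hx.1.le] at hm
      exact hy ⟨hm.1, hm.2.trans_lt hx.2⟩)
  rw [sub_zero, abs_of_pos hx.1] at this
  exact this.trans (mul_le_mul_of_nonneg_left hx.2.le hD0)

end Profile

theorem integral_cell_le {Γ C : ℝ} (hΓ : 0 < Γ) {k : ℝ × ℝ → ℝ} (hC : 0 ≤ C)
    (hk : ∀ᵐ q ∂cellMeasure Γ, k q ≤ C) : ∫ q, k q ∂cellMeasure Γ ≤ C * Γ := by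
  have hm : (cellMeasure Γ).real univ = Γ := by
    rw [cellMeasure, ← univ_prod_univ, measureReal_prod_prod]
    simp [hΓ.le]
  by_cases hi : Integrable k (cellMeasure Γ)
  · refine (integral_mono_ae hi (integrable_const C) hk).trans ?_
    rw [integral_const, hm, smul_eq_mul, mul_comm]
  -- If k is not integrable, its integral is 0 by convention, and the bound still holds because C ≥
  -- 0.
  · rw [integral_undef hi]; positivity

/-! ### The flux integrated over a time interval (s, t) -/

namespace StrongSolution

variable {Γ : ℝ} {h : ℝ → ℝ} {α : Wall → ℝ → ℝ} {Pr Ra : ℝ}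

theorem flux_eq (S : StrongSolution Γ h α Pr Ra) (t : ℝ) :
    S.flux t = ∫ x in Ioo 0 Γ,
      (deriv h x * trace h .bot (S.T.grad 0 t) x - trace h .bot (S.T.grad 1 t) x) := by
  simp only [flux, fluxDensity_eq]

theorem ae_integrableOn_fluxDensity (S : StrongSolution Γ h α Pr Ra) (hΓ : 0 < Γ)
    (hp : IsProfile Γ h) :
    ∀ᵐ t ∂volume.restrict (Ioi (0 : ℝ)), IntegrableOn (S.fluxDensity t) (Ioo 0 Γ) := by
  filter_upwards [S.ae_heatSlice hΓ hp] with t St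
  rw [funext (S.fluxDensity_eq t)]
  exact (St.integrableOn_flux hΓ hp).1

/-- Measurability in time is not visible from the pointwise traces. Green's formula with a fixed
cut-off rewrites the flux as cell integrals of ∇T and ∂₁∂₁T + ∂₂∂₂T, which are integrable on (s, t)
× Ω. -/
theorem integrableOn_flux (S : StrongSolution Γ h α Pr Ra) (hΓ : 0 < Γ) (hp : IsProfile Γ h)
    {s t : ℝ} (hs : 0 < s) (hst : s < t) : IntegrableOn S.flux (Ioo s t) := by
  have hc := hp.continuous
  obtain ⟨D, hD⟩ := hp.exists_deriv_bound
  have int : ∀ {f : ℝ → ℝ × ℝ → ℝ} {w : ℝ × ℝ → ℝ} {C : ℝ}, LocL2 Γ h f →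
      AEStronglyMeasurable w (cellMeasure Γ) → (∀ᵐ q ∂cellMeasure Γ, |w q| ≤ C) →
      Integrable (Function.uncurry fun t q => flat h (f t) q * w q)
        ((volume.restrict (Ioo s t)).prod (cellMeasure Γ)) := by
    intro f w C hf hw hb
    exact ((hf.flat hc s t hs hst).integrable (by norm_num)).mul_bdd (c := C)
      (hw.comp_quasiMeasurePreserving Measure.quasiMeasurePreserving_snd)
      (Measure.quasiMeasurePreserving_snd.ae hb)
  have hcut : ∀ᵐ q ∂cellMeasure Γ, |cutoff 1 q.2| ≤ 1 := by
    filter_upwards [ae_cell_mem Γ] with q hq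
    rw [abs_of_nonneg (cutoff_nonneg _ _)]
    exact cutoff_le_one one_pos hq.2.1.le
  have mcut : AEStronglyMeasurable (fun q : ℝ × ℝ => cutoff 1 q.2) (cellMeasure Γ) :=
    ((cutoff_continuous one_pos).comp continuous_snd).aestronglyMeasurable
  have mcut' : AEStronglyMeasurable (fun q : ℝ × ℝ => cutoff' 1 q.2) (cellMeasure Γ) :=
    ((measurable_cutoff' 1).comp measurable_snd).aestronglyMeasurable
  have md : AEStronglyMeasurable (fun q : ℝ × ℝ => -(deriv h q.1 * cutoff' 1 q.2))
      (cellMeasure Γ) :=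
    ((hp.continuous_deriv.comp continuous_fst).aestronglyMeasurable.mul mcut').neg
  have bd : ∀ᵐ q ∂cellMeasure Γ, |-(deriv h q.1 * cutoff' 1 q.2)| ≤ D * (1 : ℝ)⁻¹ := by
    filter_upwards [hD] with q hq
    rw [abs_neg, abs_mul]
    exact mul_le_mul hq (abs_cutoff'_le one_pos _) (abs_nonneg _) ((abs_nonneg _).trans hq)
  have i1 := (int (S.T.hess_L2 0 0) mcut hcut).add (int (S.T.hess_L2 1 1) mcut hcut)
  have i2 := (int (S.T.grad_L2 0) md bd).add
    (int (S.T.grad_L2 1) mcut' (ae_of_all _ fun q => abs_cutoff'_le one_pos q.2))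
  refine (i1.integral_prod_left.add i2.integral_prod_left).congr ?_
  filter_upwards [ae_restrict_of_ae_restrict_of_subset
    (fun x hx => mem_Ioi.2 (hs.trans hx.1)) (S.ae_heatSlice hΓ hp)] with r Sr
  rw [S.flux_eq, (Sr.integrableOn_flux hΓ hp).2]
  simp only [Pi.add_apply, Function.uncurry_apply_pair, add_mul]

variable {D M N θ U : ℝ}

/-- Integrating the combined pointwise estimate in time makes every time-derivative term telescope.
Only R grows with t - s; the rest of the bound depends on s solely through U. -/
theorem integral_flux_le (S : StrongSolution Γ h α Pr Ra) (hΓ : 0 < Γ) (hp : IsProfile Γ h)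
    (hPr : 0 < Pr) (hRa : 1 ≤ Ra)
    (hα : ∀ w : Wall, ∀ᵐ x ∂volume.restrict (Ioo 0 Γ), 0 < α w x)
    (hκ : ∀ w : Wall, ∀ᵐ x ∂volume.restrict (Ioo 0 Γ), |curvature h w x| ≤
      2 * α w x + 1 / (4 * Real.sqrt (1 + deriv h x ^ 2)) * min 1 (Real.sqrt (α w x)))
    (hT0 : ∀ᵐ y ∂volume.restrict (cell Γ h), 0 ≤ S.T.val 0 y ∧ S.T.val 0 y ≤ 1)
    (hD : ∀ᵐ x ∂volume.restrict (Ioo 0 Γ), |deriv h x| ≤ D)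
    (hM0 : 0 ≤ M) (hM : ∀ x ∈ Ioo 0 Γ, |h x - h 0| ≤ M)
    (hN : ∀ᵐ x ∂volume.restrict (Ioo 0 Γ), |deriv (deriv h) x| ≤ N)
    (hθ : 0 < θ) (hθ1 : θ * (1 + 2 * ((1 + D ^ 2) * (1 + 2 * M))) = 1)
    {s t : ℝ} (hs : 0 < s) (hst : s < t)
    (hU : (∫ q, flat h ((S.u 0).val s) q ^ 2 ∂cellMeasure Γ) +
      ∫ q, flat h ((S.u 1).val s) q ^ 2 ∂cellMeasure Γ ≤ U) :
    ∫ r in Ioo s t, S.flux r ≤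
      2 * (Γ + Γ + (1 + D ^ 2) * (2 * (1 + M)) * Γ + (1 + D ^ 2) * Pr⁻¹ * U) +
        2 * ((t - s) * ((1 + D ^ 2) * Γ * Real.sqrt Ra / θ + N * Γ)) := by
  have hRa0 : 0 < Ra := by linarith
  have hsq1 : 1 ≤ Real.sqrt Ra := Real.one_le_sqrt.2 hRa
  have hsq0 : 0 < Real.sqrt Ra := by linarith
  have hθle : θ ≤ 1 := by
    have : 0 ≤ 2 * ((1 + D ^ 2) * (1 + 2 * M)) := by positivity
    nlinarith
  set δ := θ / Real.sqrt Ra with hδ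
  have hδ0 : 0 < δ := by positivity
  have hδ1 : δ ≤ 1 := (div_le_one hsq0).2 (by linarith)
  have ht : 0 < t := hs.trans hst
  have hζ : ∀ᵐ q ∂cellMeasure Γ, |h q.1 - h 0 + q.2 - (1 + M)| ≤ 2 * (1 + M) := by
    filter_upwards [ae_cell_mem Γ] with q hq
    have h1 := abs_le.1 (hM q.1 hq.1)
    rw [abs_le]
    constructor <;> linarith [hq.2.1, hq.2.2, h1.1, h1.2]
  have mζ : AEStronglyMeasurable (fun q : ℝ × ℝ => h q.1 - h 0 + q.2 - (1 + M))
      (cellMeasure Γ) := by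
    have := hp.continuous
    exact Continuous.aestronglyMeasurable (by fun_prop)
  have hχ : ∀ᵐ q ∂cellMeasure Γ, |cutoff δ q.2| ≤ 1 := by
    filter_upwards [ae_cell_mem Γ] with q hq
    rw [abs_of_nonneg (cutoff_nonneg _ _)]
    exact cutoff_le_one hδ0 hq.2.1.le
  have mχ : AEStronglyMeasurable (fun q : ℝ × ℝ => cutoff δ q.2) (cellMeasure Γ) :=
    ((cutoff_continuous hδ0).comp continuous_snd).aestronglyMeasurable
  have RT := S.T.timeReg hp
  have gX := RT.integral_linear hs hst mχ hχ
  have gZ := RT.integral_linear hs hst mζ hζ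
  have gT := RT.integral_sq hs hst
  have gu := ((S.u 0).timeReg hp).integral_sq hs hst
  have gv := ((S.u 1).timeReg hp).integral_sq hs hst
  have comb : ∀ {f g : ℝ → ℝ} {a b : ℝ} (c : ℝ), (IntegrableOn f (Ioo s t) ∧
      ∫ r in Ioo s t, f r = a) → (IntegrableOn g (Ioo s t) ∧ ∫ r in Ioo s t, g r = b) →
      IntegrableOn (fun r => f r + c * g r) (Ioo s t) ∧
        ∫ r in Ioo s t, (f r + c * g r) = a + c * b := by
    intro f g a b c hf hg
    refine ⟨hf.1.add (hg.1.const_mul c), ?_⟩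
    rw [integral_add hf.1 (hg.1.const_mul c), integral_const_mul, hf.2, hg.2]
  set R := (1 + D ^ 2) * Γ * Real.sqrt Ra / θ + N * Γ
  have gR : IntegrableOn (fun _ : ℝ => R) (Ioo s t) ∧ ∫ r in Ioo s t, R = (t - s) * R := by
    refine ⟨integrable_const _, ?_⟩
    simp [hst.le]
  have guv : IntegrableOn (fun r => (∫ q, flat h ((S.u 0).dt r) q * flat h ((S.u 0).val r) q
      ∂cellMeasure Γ) + 1 * ∫ q, flat h ((S.u 1).dt r) q * flat h ((S.u 1).val r) q
      ∂cellMeasure Γ) (Ioo s t) ∧ _ := comb 1 gu gv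
  -- This nesting reproduces the right-hand side of `combine_estimates` with its exact time
  -- integral.
  have G := comb 1 (comb (-(θ * (1 + D ^ 2) * Pr⁻¹ / Ra)) (comb (θ * (1 + D ^ 2))
    (comb (-(θ / 2)) gX gT) gZ) guv) gR
  have hT01 : ∀ {r : ℝ}, 0 < r → _ := fun {r} hr => S.ae_temperature_mem hΓ hp hT0 hr
  have key := (integral_mono_ae ((S.integrableOn_flux hΓ hp hs hst).const_mul (1 / 2)) G.1 (by
    filter_upwards [ae_restrict_of_ae_restrict_of_subset
      (fun x hx => mem_Ioi.2 (hs.trans hx.1)) (S.ae_heatSlice hΓ hp),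
      ae_restrict_of_ae_restrict_of_subset (fun x hx => mem_Ioi.2 (hs.trans hx.1))
        (S.ae_momentum_energy hΓ hp hα hκ), ae_restrict_mem measurableSet_Ioo] with r Sr mr hr
    have h01 := hT01 (hs.trans hr.1)
    have e1 := Sr.energy h01 hp
    have e2 := Sr.buoyancy_le h01 hΓ hp hM
    have e3 := Sr.flux_le hΓ hp h01 hδ0 hδ1 hsq0 hD hN
    have e4 : (1 + D ^ 2) * Γ / δ + N * Γ = R := by
      simp only [R, hδ]; field_simp
    rw [e4] at e3
    rw [← S.flux_eq] at e1 e2 e3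
    have hA : ∫ q, flat h (S.T.grad 1 r) q ^ 2 ∂cellMeasure Γ ≤
        ∫ q, (flat h (S.T.grad 0 r) q ^ 2 + flat h (S.T.grad 1 r) q ^ 2) ∂cellMeasure Γ :=
      integral_mono Sr.hT.mem₁.integrable_sq
        (Sr.hT.mem₀.integrable_sq.add Sr.hT.mem₁.integrable_sq) fun q => by
          simp only; linarith [sq_nonneg (flat h (S.T.grad 0 r) q)]
    have hB : ∫ q, (flat h ((S.u 1).grad 1 r) q - deriv h q.1 * flat h ((S.u 0).grad 1 r) q) ^ 2
        ∂cellMeasure Γ ≤ (1 + D ^ 2) * ∫ q, (flat h ((S.u 0).grad 1 r) q ^ 2 +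
          flat h ((S.u 1).grad 1 r) q ^ 2) ∂cellMeasure Γ := by
      have mw : MemLp (fun q => flat h ((S.u 1).grad 1 r) q -
          deriv h q.1 * flat h ((S.u 0).grad 1 r) q) 2 (cellMeasure Γ) :=
        Sr.hv.mem₁.sub (hp.memLp_deriv_mul Sr.hu.mem₁)
      rw [← integral_const_mul]
      refine integral_mono_ae mw.integrable_sq
        ((Sr.hu.mem₁.integrable_sq.add Sr.hv.mem₁.integrable_sq).const_mul _) ?_
      filter_upwards [ae_cell_fst hD] with q hq
      set a := flat h ((S.u 1).grad 1 r) q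
      set b := flat h ((S.u 0).grad 1 r) q
      have e5 : deriv h q.1 ^ 2 ≤ D ^ 2 := sq_le_sq' (by linarith [(abs_le.1 hq).1]) (abs_le.1 hq).2
      have e6 : deriv h q.1 ^ 2 * (b ^ 2 + a ^ 2) ≤ D ^ 2 * (b ^ 2 + a ^ 2) :=
        mul_le_mul_of_nonneg_right e5 (by positivity)
      have e7 : b ^ 2 + a ^ 2 + deriv h q.1 ^ 2 * (b ^ 2 + a ^ 2) - (a - deriv h q.1 * b) ^ 2 =
        (deriv h q.1 * a + b) ^ 2 := by ring
      have e8 := sq_nonneg (deriv h q.1 * a + b)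
      have e9 : (1 + D ^ 2) * (b ^ 2 + a ^ 2) = b ^ 2 + a ^ 2 + D ^ 2 * (b ^ 2 + a ^ 2) := by ring
      linarith only [e6, e7, e8, e9]
    have := combine_estimates hRa hθ hθ1 e1 mr e2 e3 hA hB
    simp only [one_mul]
    linarith)).trans_eq G.2
  rw [integral_const_mul] at key
  have bound : ∀ {w : ℝ × ℝ → ℝ} {C : ℝ}, 0 ≤ C → (∀ᵐ q ∂cellMeasure Γ, |w q| ≤ C) →
      ∫ q, (flat h (S.T.val t) q - flat h (S.T.val s) q) * w q ∂cellMeasure Γ ≤ C * Γ := by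
    intro w C hC hw
    refine integral_cell_le hΓ hC ?_
    filter_upwards [hw, hT01 hs, hT01 ht] with q h1 h2 h3
    refine (le_abs_self _).trans ?_
    rw [abs_mul]
    have h4 : |flat h (S.T.val t) q - flat h (S.T.val s) q| ≤ 1 := by
      rw [abs_le]; constructor <;> linarith [h2.1, h2.2, h3.1, h3.2]
    calc _ ≤ 1 * C := mul_le_mul h4 h1 (abs_nonneg _) zero_le_one
      _ = C := one_mul C
  have bX := bound zero_le_one hχ
  have bZ := bound (by positivity) hζ
  have bT : ∫ q, flat h (S.T.val s) q ^ 2 ∂cellMeasure Γ ≤ 1 * Γ := by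
    refine integral_cell_le hΓ zero_le_one ?_
    filter_upwards [hT01 hs] with q hq
    exact pow_le_one₀ hq.1 hq.2
  have pos : ∀ k : ℝ × ℝ → ℝ, 0 ≤ ∫ q, k q ^ 2 ∂cellMeasure Γ := fun k =>
    integral_nonneg fun q => sq_nonneg _
  exact combine_integrals hRa hPr hΓ hθ hθle hM0 (pos _) (pos _) (pos _) (pos _) (pos _) bX bZ bT hU
    key

end StrongSolution

end RayleighBenard

/-! ### From (s, t) to (0, t), and the limit t → ∞ -/

namespace RayleighBenard

/-- A nonnegative function whose integrals over `(s, t)` are bounded as `s → 0`. -/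
theorem integrableOn_Ioc_of_bounded {f : ℝ → ℝ} {t B : ℝ} (ht : 0 < t)
    (hi : ∀ s, 0 < s → s < t → IntegrableOn f (Ioo s t))
    (h0 : ∀ᵐ r ∂volume.restrict (Ioi (0 : ℝ)), 0 ≤ f r)
    (hb : ∀ᶠ s in 𝓝[>] (0 : ℝ), ∫ r in Ioo s t, f r ≤ B) :
    IntegrableOn f (Ioc 0 t) ∧ ∫ r in Ioc 0 t, f r ≤ B := by
  set a : ℕ → ℝ := fun n => t / (n + 2)
  have ha0 : ∀ n, 0 < a n := fun n => by positivity
  have hat : ∀ n, a n < t := fun n => by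
    refine div_lt_self ht ?_
    linarith [(Nat.cast_nonneg n : (0 : ℝ) ≤ n)]
  have hlim : Tendsto a atTop (𝓝 0) :=
    tendsto_const_nhds.div_atTop (tendsto_atTop_add_const_right _ _ tendsto_natCast_atTop_atTop)
  have hlim' : Tendsto a atTop (𝓝[>] 0) :=
    tendsto_nhdsWithin_iff.2 ⟨hlim, Eventually.of_forall fun n => ha0 n⟩
  have hi' : ∀ n, IntegrableOn f (Ioc (a n) t) := fun n =>
    (integrableOn_Ioc_iff_integrableOn_Ioo).2 (hi (a n) (ha0 n) (hat n))
  have hb' : ∀ᶠ n in atTop, ∫ r in Ioc (a n) t, f r ≤ B := by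
    filter_upwards [hlim'.eventually hb] with n hn
    rwa [integral_Ioc_eq_integral_Ioo]
  have hint : IntegrableOn f (Ioc 0 t) := by
    -- Nonnegativity identifies the integral of the norm with the bounded integral, which gives
    -- integrability up to 0 although nothing controls the second derivatives of T there.
    refine integrableOn_Ioc_of_intervalIntegral_norm_bounded_left (I := B) hi' hlim ?_
    filter_upwards [hb'] with n hn
    refine le_of_eq_of_le (integral_congr_ae ?_) hn
    filter_upwards [ae_restrict_of_ae_restrict_of_subset
      (fun x hx => mem_Ioi.2 ((ha0 n).trans hx.1)) h0] with r hr
    rw [Real.norm_eq_abs, abs_of_nonneg hr]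
  refine ⟨hint, ?_⟩
  have hanti : Antitone a := fun m n hmn => by
    simp only [a]
    gcongr
  have hU : ⋃ n, Ioc (a n) t = Ioc 0 t := by
    ext r
    simp only [mem_iUnion, mem_Ioc]
    constructor
    · rintro ⟨n, h1, h2⟩
      exact ⟨(ha0 n).trans h1, h2⟩
    · rintro ⟨h1, h2⟩
      obtain ⟨n, hn⟩ := (hlim.eventually_lt_const h1).exists
      exact ⟨n, hn, h2⟩
  have hT := tendsto_setIntegral_of_monotone (μ := volume) (f := f) (s := fun n => Ioc (a n) t)
    (fun n => measurableSet_Ioc) (fun m n hmn => Ioc_subset_Ioc_left (hanti hmn)) (by rwa [hU])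
  rw [hU] at hT
  exact le_of_tendsto hT hb'

namespace StrongSolution

variable {Γ : ℝ} {h : ℝ → ℝ} {α : Wall → ℝ → ℝ} {Pr Ra : ℝ}

theorem ae_flux_nonneg (S : StrongSolution Γ h α Pr Ra) (hΓ : 0 < Γ) (hp : IsProfile Γ h)
    (hT0 : ∀ᵐ y ∂volume.restrict (cell Γ h), 0 ≤ S.T.val 0 y ∧ S.T.val 0 y ≤ 1) :
    ∀ᵐ t ∂volume.restrict (Ioi (0 : ℝ)), 0 ≤ S.flux t := by
  filter_upwards [S.ae_heatSlice hΓ hp, ae_restrict_mem measurableSet_Ioi] with t St ht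
  rw [S.flux_eq]
  refine integral_nonneg_of_ae ?_
  filter_upwards [St.flux_signs (S.ae_temperature_mem hΓ hp hT0 ht) hΓ hp] with x hx
  simp only [Pi.zero_apply]
  linarith [hx.1]

/-- An affine bound for the time integral bounds the Nusselt number by the slope. -/
theorem nusselt_le_of_affine (S : StrongSolution Γ h α Pr Ra) (hΓ : 0 < Γ) (hp : IsProfile Γ h)
    {K R : ℝ} (H : ∀ t : ℝ, 0 < t → ∫ s in (0 : ℝ)..t, S.flux s ≤ K + t * (Γ * R)) :
    S.nusselt ≤ ((R : ℝ) : EReal) := by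
  have hlim : Tendsto (fun t : ℝ => ((t⁻¹ * (Γ⁻¹ * K) + R : ℝ) : EReal)) atTop (𝓝 (R : EReal)) := by
    refine (continuous_coe_real_ereal.tendsto R).comp ?_
    have := (tendsto_inv_atTop_zero (𝕜 := ℝ)).mul_const (Γ⁻¹ * K) |>.add_const R
    simpa using this
  rw [nusselt, ← hlim.limsup_eq]
  refine limsup_le_limsup ?_
  filter_upwards [eventually_gt_atTop 0] with t ht
  rw [EReal.coe_le_coe_iff, intervalIntegral.integral_const_mul, area_eq hΓ hp.continuous]
  calc t⁻¹ * (Γ⁻¹ * ∫ s in (0 : ℝ)..t, S.flux s) ≤ t⁻¹ * (Γ⁻¹ * (K + t * (Γ * R))) := by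
        gcongr
        exact H t ht
    _ = t⁻¹ * (Γ⁻¹ * K) + R := by field_simp

end StrongSolution

/-- The constant in the bound on the Nusselt number, as a function of `‖h'‖_∞` and `|Ω|`. -/
noncomputable def nusseltConst (D A : ℝ) : ℝ :=
  2 * ((1 + D ^ 2) * (1 + 2 * ((1 + D ^ 2) * (1 + 2 * |D * A|))) + (1 + D ^ 2) ^ 2)

theorem nusseltConst_pos (D A : ℝ) : 0 < nusseltConst D A := by
  unfold nusseltConst; positivity

theorem supNorm_nonneg (Γ : ℝ) (f : ℝ → ℝ) : 0 ≤ supNorm Γ f := ENNReal.toReal_nonneg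

/-- Here M = DΓ and θ = 1/E. The kinetic energy stays bounded as s → 0, so the bound on (s, t) is
uniform in s and passes to (0, t); it is affine in t, and only its slope ΓR survives in the limit.
-/
theorem StrongSolution.nusselt_le {Γ : ℝ} {h : ℝ → ℝ} {α : Wall → ℝ → ℝ} {Pr Ra : ℝ}
    (S : StrongSolution Γ h α Pr Ra) (hΓ : 0 < Γ) (hp : IsProfile Γ h) (hPr : 0 < Pr)
    (hRa : 1 ≤ Ra) (hα : ∀ w : Wall, ∀ᵐ x ∂volume.restrict (Ioo 0 Γ), 0 < α w x)
    (hκ : ∀ w : Wall, ∀ᵐ x ∂volume.restrict (Ioo 0 Γ), |curvature h w x| ≤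
      2 * α w x + 1 / (4 * Real.sqrt (1 + deriv h x ^ 2)) * min 1 (Real.sqrt (α w x)))
    (hu0 : ∀ j, MemLp ((S.u j).val 0) 2 (volume.restrict (cell Γ h)))
    (hT0 : ∀ᵐ y ∂volume.restrict (cell Γ h), 0 ≤ S.T.val 0 y ∧ S.T.val 0 y ≤ 1) :
    (∀ t : ℝ, 0 < t → IntervalIntegrable S.flux volume 0 t) ∧
    S.nusselt ≤ ((nusseltConst (supNorm Γ (deriv h)) (area Γ h) *
      (Ra ^ (1 / 2 : ℝ) + curvatureNorm Γ h) : ℝ) : EReal) := by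
  set D := supNorm Γ (deriv h)
  have hD0 : 0 ≤ D := supNorm_nonneg _ _
  have hκ0 : 0 ≤ curvatureNorm Γ h := (supNorm_nonneg _ _).trans (le_max_left _ _)
  have hD := hp.ae_abs_deriv_le
  have hM : ∀ x ∈ Ioo 0 Γ, |h x - h 0| ≤ D * Γ := fun x hx => hp.abs_sub_le hD0 hD hx
  have hN := hp.ae_abs_deriv_deriv_le hD
  set E := 1 + 2 * ((1 + D ^ 2) * (1 + 2 * (D * Γ)))
  have hE : 0 < E := by positivity
  obtain ⟨U₀, hU₀⟩ := (S.u 0).exists_bound_near_zero hp (hu0 0)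
  obtain ⟨U₁, hU₁⟩ := (S.u 1).exists_bound_near_zero hp (hu0 1)
  set K := 2 * (Γ + Γ + (1 + D ^ 2) * (2 * (1 + D * Γ)) * Γ + (1 + D ^ 2) * Pr⁻¹ * (U₀ + U₁))
  set R := 2 * ((1 + D ^ 2) * Real.sqrt Ra * E + (1 + D ^ 2) ^ 2 * curvatureNorm Γ h)
  have hR : 0 ≤ R := by positivity
  have main : ∀ t : ℝ, 0 < t → IntegrableOn S.flux (Ioc 0 t) ∧
      ∫ r in Ioc 0 t, S.flux r ≤ K + t * (Γ * R) := by
    intro t ht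
    refine integrableOn_Ioc_of_bounded ht (fun s hs hst => S.integrableOn_flux hΓ hp hs hst)
      (S.ae_flux_nonneg hΓ hp hT0) ?_
    filter_upwards [hU₀, hU₁, Ioo_mem_nhdsGT ht] with s h0 h1 hs
    have key := S.integral_flux_le hΓ hp hPr hRa hα hκ hT0 hD (by positivity) hM hN (inv_pos.2 hE)
      (inv_mul_cancel₀ hE.ne') hs.1 hs.2 (add_le_add h0 h1)
    have e1 : 2 * ((t - s) * ((1 + D ^ 2) * Γ * Real.sqrt Ra / E⁻¹ +
        (1 + D ^ 2) ^ 2 * curvatureNorm Γ h * Γ)) = (t - s) * (Γ * R) := by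
      rw [div_inv_eq_mul]; ring
    rw [e1] at key
    refine key.trans ?_
    gcongr
    linarith [hs.1]
  refine ⟨fun t ht => (intervalIntegrable_iff_integrableOn_Ioc_of_le ht.le).2 (main t ht).1, ?_⟩
  refine (S.nusselt_le_of_affine hΓ hp (K := K) (R := R) fun t ht => ?_).trans ?_
  · rw [intervalIntegral.integral_of_le ht.le]
    exact (main t ht).2
  · rw [EReal.coe_le_coe_iff, area_eq hΓ hp.continuous, ← Real.sqrt_eq_rpow, nusseltConst,
      abs_of_nonneg (by positivity : 0 ≤ D * Γ)]
    -- The constant multiplies the sum of √Ra and the curvature norm; the two cross terms are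
    -- nonnegative and only enlarge the bound.
    have h1 : 0 ≤ (1 + D ^ 2) * E * curvatureNorm Γ h := by positivity
    have h2 : 0 ≤ (1 + D ^ 2) ^ 2 * Real.sqrt Ra := by positivity
    linarith

end RayleighBenard

theorem theorem1 :
    ∃ C : ℝ → ℝ → ℝ, (∀ a b : ℝ, 0 < C a b) ∧
      ∀ (Γ : ℝ) (h : ℝ → ℝ) (α : RayleighBenard.Wall → ℝ → ℝ) (Pr Ra : ℝ)
        (S : RayleighBenard.StrongSolution Γ h α Pr Ra),
        0 < Γ → RayleighBenard.IsProfile Γ h → 0 < Pr → 1 ≤ Ra →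
        (∀ w : RayleighBenard.Wall, ∀ᵐ y₁ ∂volume.restrict (Ioo 0 Γ), 0 < α w y₁) →
        (∀ w : RayleighBenard.Wall, ∀ᵐ y₁ ∂volume.restrict (Ioo 0 Γ),
          |RayleighBenard.curvature h w y₁| ≤
            2 * α w y₁ +
              1 / (4 * Real.sqrt (1 + deriv h y₁ ^ 2)) * min 1 (Real.sqrt (α w y₁))) →
        (∀ j, MemLp ((S.u j).val 0) 2 (volume.restrict (RayleighBenard.cell Γ h))) →
        (∀ᵐ y ∂volume.restrict (RayleighBenard.cell Γ h), 0 ≤ S.T.val 0 y ∧ S.T.val 0 y ≤ 1) →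
        -- the boundary and time integrals in the Nusselt number converge
        (∀ᵐ t ∂volume.restrict (Ioi (0 : ℝ)), IntegrableOn (S.fluxDensity t) (Ioo 0 Γ)) ∧
        (∀ t : ℝ, 0 < t → IntervalIntegrable S.flux volume 0 t) ∧
        S.nusselt ≤
          ((C (RayleighBenard.supNorm Γ (deriv h)) (RayleighBenard.area Γ h) *
            (Ra ^ (1 / 2 : ℝ) + RayleighBenard.curvatureNorm Γ h) : ℝ) : EReal) := by
  refine ⟨RayleighBenard.nusseltConst, RayleighBenard.nusseltConst_pos, ?_⟩
  intro Γ h α Pr Ra S hΓ hp hPr hRa hα hκ hu0 hT0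
  exact ⟨S.ae_integrableOn_fluxDensity hΓ hp, S.nusselt_le hΓ hp hPr hRa hα hκ hu0 hT0⟩
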